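/- Let $U_q(\mathfrak g)$ be the quantized enveloping algebra over $\mathbb Q(q)$ of type $A_1^{(1)}$, with Cartan matrix $(a_{ij})=\begin{pmatrix}2&-2\\-2&2\end{pmatrix}$: it is generated by $E_i,F_i,K_i^{\pm1}$ ($i=1,2$) with relations $K_iK_j=K_jK_i$, $K_iK_i^{-1}=K_i^{-1}K_i=1$, $K_iE_jK_i^{-1}=q^{a_{ij}}E_j$, $K_iF_jK_i^{-1}=q^{-a_{ij}}F_j$, $E_iF_j-F_jE_i=\delta_{ij}\frac{K_i-K_i^{-1}}{q-q^{-1}}$, and the quantum Serre relations $x_i^3x_j-[3]x_i^2x_jx_i+[3]x_ix_jx_i^2-x_jx_i^3=0$ ($i\ne j$) for $x=E$ and $x=F$. Here $[k]=\frac{q^k-q^{-k}}{q-q^{-1}}$, $[k]!=[k]\cdots[1]$ and $x^{(k)}=x^k/[k]!$. Let $T_1,T_2$ be Lusztig's automorphisms of $U_q(\mathfrak g)$, given by $T_i(E_i)=-K_i^{-1}F_i$, $T_i(F_i)=-E_iK_i$, $T_i(K_j)=K_jK_i^{-a_{ij}}$ and, for $j\neq i$, $T_i(E_j)=\sum_{r+s=2}(-1)^rq^{-r}E_i^{(r)}E_jE_i^{(s)}$,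 $T_i(F_j)=\sum_{r+s=2}(-1)^rq^{r}F_i^{(s)}F_jF_i^{(r)}$. Put $v_0=E_1$, $v_1=T_1(E_2)$, $v_2=T_1T_2(E_1)$, $v_3=T_1T_2T_1(E_2)$ and $u_i=(1-q^{-2})^{-2i}v_i$. Let $U_q^+(w)$, $w=s_1s_2s_1s_2$, be the $\mathbb Q(q)$-subalgebra generated by $v_0,v_1,v_2,v_3$. For $\mathbf a=(a_3,a_2,a_1,a_0)\in\mathbb N^4$ (with $0\in\mathbb N$) let $E[\mathbf a]=q^{\sum_i\binom{a_i}{2}}u_3^{a_3}u_2^{a_2}u_1^{a_1}u_0^{a_0}$ (the dual PBW basis) and $N(\mathbf a)=(a_3+a_2+a_1+a_0)^2-7a_3-5a_2-3a_1-a_0$. Let $S(\mathbf a)$ be the set of all $\mathbf b\in\mathbb N^4$ with $\mathbf b\ne\mathbf a$ and $\mathbf b-\mathbf a\in\mathbb N(-1,2,-1,0)+\mathbb N(0,-1,2,-1)$. Let $\sigma$ be the ring anti-automorphism of $U_q^+(w)$ with $\sigma(q)=q^{-1}$ and $\sigma(u_i)=q^{2i}u_i$ for $0\le i\le 3$. The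 dual canonical basis of $U_q^+(w)$ is the unique $\mathbb Q(q)$-basis $\{B[\mathbf a]:\mathbf a\in\mathbb N^4\}$ such that, for every $\mathbf a\in\mathbb N^4$, $$B[\mathbf a]-E[\mathbf a]\in\sum_{\mathbf b\in S(\mathbf a)}q\mathbb Z[q]\,E[\mathbf b],\qquad \sigma(B[\mathbf a])=q^{-N(\mathbf a)}B[\mathbf a].$$ Put $B[\mathbf a]=0$ for $\mathbf a\in\mathbb Z^4\setminus\mathbb N^4$. **Theorem.** The dual canonical basis of $U_q^+(w)$ exists and is unique, and for every integer $n\ge1$ it satisfies $$\begin{aligned} B[n,0,0,n-1]&=q^{n-1}u_3B[n-1,0,0,n-1]-q^{2n-1}u_2B[n-1,0,1,n-2]\\ &=q^{3n-3}B[n-1,0,0,n-1]u_3-q^{2n-3}B[n-1,0,1,n-2]u_2,\\[4pt] B[n-1,0,0,n]&=q^{n-1}B[n-1,0,0,n-1]u_0-q^{2n-1}B[n-2,1,0,n-1]u_1\\ &=q^{3n-3}u_0B[n-1,0,0,n-1]-q^{2n-3}u_1B[n-2,1,0,n-1],\\[4pt] B[n,0,0,n]&=q^{n-1}B[n,0,0,n-1]u_0-q^{2n}B[n-1,1,0,n-1]u_1\\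 &=q^{3n-1}u_0B[n,0,0,n-1]-q^{2n-2}u_1B[n-1,1,0,n-1]\\ &=q^{n-1}u_3B[n-1,0,0,n]-q^{2n}u_2B[n-1,0,1,n-1]\\ &=q^{3n-1}B[n-1,0,0,n]u_3-q^{2n-2}B[n-1,0,1,n-1]u_2. \end{aligned}$$ -/

import Mathlib

noncomputable section

namespace KroneckerQuantum

/-! ### Ground field and quantum integers -/

/-- The ground field `ℚ(q)`. -/
abbrev Kq : Type := RatFunc ℚ

/-- The deformation parameter `q`. -/
def q : Kq := RatFunc.X

/-- The quantum integer `[k] = (q^k - q^{-k}) / (q - q^{-1})`. -/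
def qInt (k : ℤ) : Kq := (q ^ k - q ^ (-k)) / (q - q⁻¹)

/-- The quantum factorial `[k]! = [k][k-1]⋯[1]`. -/
def qFact (k : ℕ) : Kq := ∏ i ∈ Finset.range k, qInt ((i : ℤ) + 1)

/-- The divided power `x^(k) = x^k / [k]!`. -/
def divPow {A : Type} [Ring A] [Algebra Kq A] (x : A) (k : ℕ) : A := (qFact k)⁻¹ • x ^ k

/-! ### The quantized enveloping algebra of type `A₁⁽¹⁾`

The two simple roots `α₁, α₂` are indexed by `0, 1 : Fin 2`. -/

/-- The Cartan matrix of the Kronecker quiver. -/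
def cartan : Matrix (Fin 2) (Fin 2) ℤ := !![2, -2; -2, 2]

/-- The generators `E_i`, `F_i`, `K_i`, `K_i⁻¹`. -/
inductive Gen : Type
  | E (i : Fin 2)
  | F (i : Fin 2)
  | K (i : Fin 2)
  | Kinv (i : Fin 2)

/-- The free `ℚ(q)`-algebra on the generators. -/
abbrev Free : Type := FreeAlgebra Kq Gen

def fE (i : Fin 2) : Free := FreeAlgebra.ι Kq (Gen.E i)
def fF (i : Fin 2) : Free := FreeAlgebra.ι Kq (Gen.F i)
def fK (i : Fin 2) : Free := FreeAlgebra.ι Kq (Gen.K i)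
def fKinv (i : Fin 2) : Free := FreeAlgebra.ι Kq (Gen.Kinv i)

/-- The quantum Serre expression `x³y - [3]x²yx + [3]xyx² - yx³`. -/
def serre (x y : Free) : Free :=
  x ^ 3 * y - qInt 3 • (x ^ 2 * y * x) + qInt 3 • (x * y * x ^ 2) - y * x ^ 3

/-- The defining relations of `U_q(𝔤)`. -/
inductive Rel : Free → Free → Prop
  | K_comm (i j : Fin 2) : Rel (fK i * fK j) (fK j * fK i)
  | K_Kinv (i : Fin 2) : Rel (fK i * fKinv i) 1
  | Kinv_K (i : Fin 2) : Rel (fKinv i * fK i) 1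
  | K_E (i j : Fin 2) : Rel (fK i * fE j * fKinv i) (q ^ cartan i j • fE j)
  | K_F (i j : Fin 2) : Rel (fK i * fF j * fKinv i) (q ^ (-cartan i j) • fF j)
  | E_F (i j : Fin 2) : Rel (fE i * fF j - fF j * fE i)
      (if i = j then (q - q⁻¹)⁻¹ • (fK i - fKinv i) else 0)
  | serre_E (i j : Fin 2) (h : i ≠ j) : Rel (serre (fE i) (fE j)) 0
  | serre_F (i j : Fin 2) (h : i ≠ j) : Rel (serre (fF i) (fF j)) 0

/-- The quantized enveloping algebra `U_q(𝔤)`. -/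
abbrev Uq : Type := RingQuot Rel

/-- The quotient map from the free algebra. -/
def toUq : Free →ₐ[Kq] Uq := RingQuot.mkAlgHom Kq Rel

/-- `K_i^m` for an integer `m`, as a word in the generators. -/
def fKpow (i : Fin 2) (m : ℤ) : Free :=
  if 0 ≤ m then fK i ^ m.toNat else fKinv i ^ (-m).toNat

/-- The values of Lusztig's `T_i` (denoted `T'_{i,-1}` by Lusztig) on the generators, written
as elements of the free algebra. -/
def braidGen (i : Fin 2) : Gen → Free
  | Gen.E j =>
      if j = i then -(fKinv i * fF i)
      else ∑ p ∈ Finset.HasAntidiagonal.antidiagonal (2 : ℕ),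
        ((-1 : Kq) ^ p.1 * q ^ (-(p.1 : ℤ))) • (divPow (fE i) p.1 * fE j * divPow (fE i) p.2)
  | Gen.F j =>
      if j = i then -(fE i * fK i)
      else ∑ p ∈ Finset.HasAntidiagonal.antidiagonal (2 : ℕ),
        ((-1 : Kq) ^ p.1 * q ^ (p.1 : ℤ)) • (divPow (fF i) p.2 * fF j * divPow (fF i) p.1)
  | Gen.K j => fK j * fKpow i (-cartan i j)
  | Gen.Kinv j => fKpow i (cartan i j) * fKinv j

/-- Lusztig's `T_i` on representatives: the endomorphism of the free algebra with the prescribed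
values on the generators. `T_i` is the map that it induces on `U_q(𝔤)`, so that the class of
`braid i (braid j x)` is `T_i (T_j x)`. -/
def braid (i : Fin 2) : Free →ₐ[Kq] Free := FreeAlgebra.lift Kq (braidGen i)

/-! ### The subalgebra `U_q⁺(w)` for `w = s₁ s₂ s₁ s₂` -/

/-- The root vectors `v₀ = E₁`, `v₁ = T₁(E₂)`, `v₂ = T₁T₂(E₁)`, `v₃ = T₁T₂T₁(E₂)`. -/
def v : Fin 4 → Uq :=
  ![toUq (fE 0), toUq (braid 0 (fE 1)), toUq (braid 0 (braid 1 (fE 0))),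
    toUq (braid 0 (braid 1 (braid 0 (fE 1))))]

/-- The algebra `U_q⁺(s₁s₂s₁s₂)`, generated by the root vectors. -/
def Uplus : Subalgebra Kq Uq := Algebra.adjoin Kq (Set.range v)

/-- The rescaled generators `u_i = (1 - q⁻²)^{-2i} v_i`. -/
def u (i : Fin 4) : Uplus :=
  ((1 - q ^ (-2 : ℤ)) ^ (2 * (i : ℕ)))⁻¹ • ⟨v i, Algebra.subset_adjoin ⟨i, rfl⟩⟩

/-! ### The dual PBW basis and the dual canonical basis

An index `(a₃, a₂, a₁, a₀)` is an element of `ℕ × ℕ × ℕ × ℕ`, in this order. -/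

/-- The index set `ℕ⁴`. -/
abbrev Idx : Type := ℕ × ℕ × ℕ × ℕ

/-- The dual PBW element `E[a] = q^{b(a)} u₃^{a₃} u₂^{a₂} u₁^{a₁} u₀^{a₀}` with
`b(a) = ∑ binom(a_i, 2)`. -/
def dualPBW : Idx → Uplus
  | (a₃, a₂, a₁, a₀) =>
      q ^ (a₃.choose 2 + a₂.choose 2 + a₁.choose 2 + a₀.choose 2) •
        (u 3 ^ a₃ * u 2 ^ a₂ * u 1 ^ a₁ * u 0 ^ a₀)

/-- The norm `N(a) = (a₃+a₂+a₁+a₀)² - 7a₃ - 5a₂ - 3a₁ - a₀`. -/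
def normN : Idx → ℤ
  | (a₃, a₂, a₁, a₀) => ((a₃ : ℤ) + a₂ + a₁ + a₀) ^ 2 - 7 * a₃ - 5 * a₂ - 3 * a₁ - a₀

/-- The partial order `a ⊲ b`: the difference `b - a` is an `ℕ`-combination of `(-1,2,-1,0)` and
`(0,-1,2,-1)`. -/
def Below : Idx → Idx → Prop
  | (a₃, a₂, a₁, a₀), (b₃, b₂, b₁, b₀) => ∃ r s : ℕ,
      (b₃ : ℤ) - a₃ = -r ∧ (b₂ : ℤ) - a₂ = 2 * r - s ∧
      (b₁ : ℤ) - a₁ = -r + 2 * s ∧ (b₀ : ℤ) - a₀ = -s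

/-- The `ℤ[q]`-module `⊕_{b ∈ S(a)} q ℤ[q] E[b]`, where `S(a) = {b | a ⊲ b, b ≠ a}`. -/
def lowerLattice (a : Idx) : AddSubgroup Uplus :=
  AddSubgroup.closure {x | ∃ (b : Idx) (f : Polynomial ℤ),
    Below a b ∧ b ≠ a ∧ x = (q * Polynomial.aeval q f) • dualPBW b}

/-- `σ` is the ring anti-automorphism of `U_q⁺(w)` with `σ(q) = q⁻¹` and `σ(u_i) = q^{2i} u_i`. -/
structure IsSigma (σ : Uplus ≃+* Uplusᵐᵒᵖ) : Prop where
  map_q : σ (algebraMap Kq Uplus q) = MulOpposite.op (algebraMap Kq Uplus q⁻¹)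
  map_u : ∀ i : Fin 4, σ (u i) = MulOpposite.op (q ^ (2 * (i : ℕ)) • u i)

/-- The family `B` is the dual canonical basis of `U_q⁺(w)`: it is a `ℚ(q)`-basis, it is
unitriangular over the dual PBW basis with off-diagonal coefficients in `q ℤ[q]`, and
`σ(B[a]) = q^{-N(a)} B[a]`. -/
structure IsDualCanonicalBasis (B : Idx → Uplus) : Prop where
  linearIndependent : LinearIndependent Kq B
  span_eq_top : Submodule.span Kq (Set.range B) = ⊤
  unitriangular : ∀ a, B a - dualPBW a ∈ lowerLattice a
  sigma_invariant : ∃ σ : Uplus ≃+* Uplusᵐᵒᵖ, IsSigma σ ∧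
    ∀ a, σ (B a) = MulOpposite.op (q ^ (-normN a) • B a)

/-- `B[a₃,a₂,a₁,a₀]` for integer indices, with the convention that it is `0` if some index is
negative. -/
def bracket (B : Idx → Uplus) (a₃ a₂ a₁ a₀ : ℤ) : Uplus :=
  if 0 ≤ a₃ ∧ 0 ≤ a₂ ∧ 0 ≤ a₁ ∧ 0 ≤ a₀ then B (a₃.toNat, a₂.toNat, a₁.toNat, a₀.toNat) else 0

end KroneckerQuantum

end

noncomputable section

section
namespace KroneckerQuantum
open Polynomial

/-! ### The ground field -/

/-! The imaginary root vector D = E₂E₁ − q⁻²E₁E₂ satisfies [D, v_j] = [2] v_{j+1}. For j = 0 this is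
the formula for T₁(E₂), for j = 1 a computation (`bracket_imag_v1`), and for j = 2 it is the image
of the case j = 0 under T₁T₂, which fixes D (`toUq_braid_imagFree`). Applying [D, ·], and the
bracket with the next imaginary vector, to the Serre relations yields the straightening relations of
the u_i (`isLadder_u`). The ordered monomials are independent because a representation by difference
operators separates them by leading terms (`linearIndependent_mono`). The map σ is the restriction
of a semilinear anti-automorphism of the whole algebra (`isSigma_sigmaEquiv`).

Straightening gives q^{N(a)} σ(E[a]) = E[a] + higher terms over ℤ[q, q⁻¹]. Existence and uniqueness
of the basis then follow by the Kazhdan–Lusztig argument (`exists_canonical`, `canonical_unique`): a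
Laurent polynomial that the bar involution negates is p − p̄ with p in qℤ[q], and a bar-invariant
element of qℤ[q] is zero. Hence a recursion holds as soon as its right-hand side is unitriangular at
a and has the right behaviour under σ.

The behaviour under σ comes from closed formulas. Put Δ₁ = u₃u₁ − q²u₂², Δ₀ = u₂u₀ − q²u₁², z = u₃u₀
− q²u₂u₁ and T = q⁻²Δ₁Δ₀. The minors Δ₁, Δ₀ q-commute with all u_i, and z commutes with T. With S₀ =
0, S₁ = 1, S_{n+2} = z S_{n+1} − T S_n, one has B[m,0,0,m] = q^{2m(m−1)} S_{m+1} and B[m+1,0,0,m] =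
q^{m(2m−1)} (u₃ S_{m+1} − q² Δ₁u₂ S_m), and the mirror image for B[m,0,0,m+1]. Left multiplication
by Δ₁ and right multiplication by Δ₀ preserve canonical elements up to powers of q, which supplies
the remaining elements in the recursions. The identity `chebRight_eq` makes the rows eigenvectors of
σ, `chebRight_last` leads from rows back to the S_n, and an induction alternates between the two
shapes (`left_expansion`, `diag_expansion`). The other version of each recursion is its image under
σ. -/

theorem aeval_q (p : ℚ[X]) : aeval q p = algebraMap ℚ[X] Kq p := by
  have : aeval q = IsScalarTower.toAlgHom ℚ ℚ[X] Kq := by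
    ext; simp [q]
  rw [this]; rfl

theorem aeval_q_ne_zero {p : ℚ[X]} (hp : p ≠ 0) : aeval q p ≠ 0 := by
  rw [aeval_q]; exact RatFunc.algebraMap_ne_zero hp

theorem aeval_q_ne_zero_of_eval {p : ℚ[X]} (a : ℚ) (hp : p.eval a ≠ 0) : aeval q p ≠ 0 :=
  aeval_q_ne_zero fun h => hp (by simp [h])

theorem q_ne_zero : q ≠ 0 := RatFunc.X_ne_zero

theorem q_sq_add_one_ne_zero : q ^ 2 + 1 ≠ 0 := by
  have h := aeval_q_ne_zero_of_eval (p := (X ^ 2 + 1 : ℚ[X])) 2 (by norm_num)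
  simpa only [map_add, map_sub, map_pow, aeval_X, map_one] using h

theorem q_sq_sub_one_ne_zero : q ^ 2 - 1 ≠ 0 := by
  have h := aeval_q_ne_zero_of_eval (p := (X ^ 2 - 1 : ℚ[X])) 2 (by norm_num)
  simpa only [map_add, map_sub, map_pow, aeval_X, map_one] using h

theorem q_four_add_sq_add_one_ne_zero : q ^ 4 + q ^ 2 + 1 ≠ 0 := by
  have h := aeval_q_ne_zero_of_eval (p := (X ^ 4 + X ^ 2 + 1 : ℚ[X])) 2 (by norm_num)
  simpa only [map_add, map_sub, map_pow, aeval_X, map_one] using h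

theorem q_four_add_one_ne_zero : q ^ 4 + 1 ≠ 0 := by
  have h := aeval_q_ne_zero_of_eval (p := (X ^ 4 + 1 : ℚ[X])) 2 (by norm_num)
  simpa only [map_add, map_sub, map_pow, aeval_X, map_one] using h

theorem q_sub_inv_ne_zero : q - q⁻¹ ≠ 0 := by
  have h : q - q⁻¹ = (q ^ 2 - 1) * q⁻¹ := by field_simp [q_ne_zero]
  rw [h]
  exact mul_ne_zero q_sq_sub_one_ne_zero (inv_ne_zero q_ne_zero)

theorem q_add_inv_ne_zero : q + q⁻¹ ≠ 0 := by
  have h : q + q⁻¹ = (q ^ 2 + 1) * q⁻¹ := by field_simp [q_ne_zero]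
  rw [h]
  exact mul_ne_zero q_sq_add_one_ne_zero (inv_ne_zero q_ne_zero)

theorem qInt_one : qInt 1 = 1 := by
  simp [qInt, q_sub_inv_ne_zero]

theorem qInt_two : qInt 2 = q + q⁻¹ := by
  rw [qInt, div_eq_iff q_sub_inv_ne_zero]
  have := q_ne_zero
  rw [zpow_neg, zpow_ofNat]
  field_simp
  ring

theorem qInt_three : qInt 3 = q ^ 2 + 1 + (q ^ 2)⁻¹ := by
  rw [qInt, div_eq_iff q_sub_inv_ne_zero]
  have := q_ne_zero
  rw [zpow_neg, zpow_ofNat]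
  field_simp
  ring

theorem qFact_zero : qFact 0 = 1 := by simp [qFact]
theorem qFact_one : qFact 1 = 1 := by simp [qFact, qInt_one]
theorem qFact_two : qFact 2 = q + q⁻¹ := by
  simp [qFact, Finset.prod_range_succ, qInt_one, qInt_two, one_add_one_eq_two]

/-! ### The bar involution -/

/-- If p vanished at q⁻¹, the reversed polynomial would vanish at the transcendental element q. This
makes the bar involution well defined on fractions. -/
theorem aeval_q_inv_ne_zero {p : ℚ[X]} (hp : p ≠ 0) : aeval q⁻¹ p ≠ 0 := by
  let _ : Invertible q⁻¹ := invertibleOfNonzero (inv_ne_zero q_ne_zero)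
  have h := eval₂_reverse_mul_pow (algebraMap ℚ Kq) q⁻¹ p
  have hr : aeval q p.reverse ≠ 0 := aeval_q_ne_zero (by simpa using hp)
  intro h0
  rw [aeval_def] at h0
  rw [h0] at h
  have : ⅟(q⁻¹) = q := by simp
  rw [this] at h
  rcases mul_eq_zero.mp h with h | h
  · exact hr (by rw [aeval_def]; exact h)
  · exact pow_ne_zero _ (inv_ne_zero q_ne_zero) h

/-- The bar involution `q ↦ q⁻¹` of `ℚ(q)`. -/
def bar : Kq →+* Kq :=
  RatFunc.liftRingHom (aeval q⁻¹ : ℚ[X] →ₐ[ℚ] Kq).toRingHom (by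
    intro p hp
    have := aeval_q_inv_ne_zero (nonZeroDivisors.ne_zero hp)
    simpa using this)

theorem bar_q : bar q = q⁻¹ := by
  have h : q = algebraMap ℚ[X] Kq X := by simp [q]
  conv_lhs => rw [h]
  simp only [bar, RatFunc.liftRingHom_algebraMap]
  simp

/-- The target may be noncommutative, since this is applied to maps into the opposite of U_q⁺(w);
inverses are therefore compared by hand. -/
theorem ringHom_ext_q {R : Type*} [Ring R] {f g : Kq →+* R} (h : f q = g q) : f = g := by
  have hp : ∀ p : ℚ[X], f (algebraMap ℚ[X] Kq p) = g (algebraMap ℚ[X] Kq p) := by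
    intro p
    induction p using Polynomial.induction_on' with
    | add a b ha hb => simp [ha, hb]
    | monomial n c =>
      rw [← C_mul_X_pow_eq_monomial, map_mul, map_mul, map_mul, map_pow, map_pow, map_pow]
      have h1 : algebraMap ℚ[X] Kq X = q := by simp [q]
      rw [h1, h]
      congr 1
      exact RingHom.congr_fun (Subsingleton.elim
        ((f.comp (algebraMap ℚ[X] Kq)).comp C) ((g.comp (algebraMap ℚ[X] Kq)).comp C)) c
  ext x
  induction x using RatFunc.induction_on with
  | f a b hb =>
    have hb' : algebraMap ℚ[X] Kq b ≠ 0 := RatFunc.algebraMap_ne_zero hb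
    set y := algebraMap ℚ[X] Kq b with hy
    have hinv : f y⁻¹ = g y⁻¹ := by
      calc f y⁻¹ = f y⁻¹ * (g y * g y⁻¹) := by rw [← map_mul, mul_inv_cancel₀ hb']; simp
        _ = f y⁻¹ * f y * g y⁻¹ := by rw [← hp b, mul_assoc]
        _ = g y⁻¹ := by rw [← map_mul, inv_mul_cancel₀ hb']; simp
    rw [div_eq_mul_inv, map_mul, map_mul, hp, hinv]

theorem bar_bar (x : Kq) : bar (bar x) = x := by
  have : bar.comp bar = RingHom.id Kq := ringHom_ext_q (by simp [bar_q])
  exact RingHom.congr_fun this x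

theorem bar_zpow (n : ℤ) : bar (q ^ n) = q ^ (-n) := by
  rw [map_zpow₀, bar_q, inv_zpow, zpow_neg]

theorem bar_pow (n : ℕ) : bar (q ^ n) = (q ^ n)⁻¹ := by
  rw [map_pow, bar_q, inv_pow]

/-! ### The lattices `q ℤ[q]` and `ℤ[q, q⁻¹]` -/

/-- The subgroup `q ℤ[q]` of `ℚ(q)`. -/
def qZq : AddSubgroup Kq :=
  AddMonoidHom.range
    ((AddMonoidHom.mulLeft q).comp (aeval q : ℤ[X] →ₐ[ℤ] Kq).toRingHom.toAddMonoidHom)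

theorem mem_qZq {x : Kq} : x ∈ qZq ↔ ∃ f : ℤ[X], x = q * aeval q f := by
  constructor
  · rintro ⟨f, rfl⟩; exact ⟨f, rfl⟩
  · rintro ⟨f, rfl⟩; exact ⟨f, rfl⟩

theorem pow_mul_mem_qZq (n : ℕ) {x : Kq} (hx : x ∈ qZq) : q ^ n * x ∈ qZq := by
  obtain ⟨f, rfl⟩ := mem_qZq.mp hx
  exact mem_qZq.mpr ⟨X ^ n * f, by simp; ring⟩

theorem zpow_mul_mem_qZq {n : ℤ} (hn : 0 ≤ n) {x : Kq} (hx : x ∈ qZq) : q ^ n * x ∈ qZq := by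
  lift n to ℕ using hn
  rw [zpow_natCast]
  exact pow_mul_mem_qZq n hx

theorem q_zpow_mem_qZq {n : ℤ} (hn : 1 ≤ n) : q ^ n ∈ qZq := by
  obtain ⟨k, rfl⟩ : ∃ k : ℕ, n = k + 1 := ⟨(n - 1).toNat, by omega⟩
  refine mem_qZq.mpr ⟨X ^ k, ?_⟩
  rw [zpow_add_one₀ q_ne_zero, mul_comm]
  simp

/-- The subring `ℤ[q, q⁻¹]` of `ℚ(q)`. -/
def laurent : Subring Kq :=
  (LaurentPolynomial.eval₂ (Int.castRingHom Kq) (Units.mk0 q q_ne_zero)).range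

theorem zpow_mem_laurent (n : ℤ) : q ^ n ∈ laurent :=
  ⟨LaurentPolynomial.T n, by simp⟩

theorem laurent_induction {P : Kq → Prop} (hadd : ∀ x y, P x → P y → P (x + y))
    (hmon : ∀ (c n : ℤ), P (c * q ^ n)) {x : Kq} (hx : x ∈ laurent) : P x := by
  obtain ⟨p, rfl⟩ := hx
  induction p using LaurentPolynomial.induction_on' with
  | add p q hp hq => rw [map_add]; exact hadd _ _ hp hq
  | C_mul_T n a => simpa using hmon a n

theorem bar_mem_laurent {x : Kq} (hx : x ∈ laurent) : bar x ∈ laurent := by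
  refine laurent_induction (P := fun x => bar x ∈ laurent) ?_ ?_ hx
  · intro x y hx hy; rw [map_add]; exact add_mem hx hy
  · intro c n
    rw [map_mul, map_intCast, bar_zpow]
    exact mul_mem (intCast_mem _ _) (zpow_mem_laurent _)

theorem qZq_le_laurent {x : Kq} (hx : x ∈ qZq) : x ∈ laurent := by
  obtain ⟨f, rfl⟩ := mem_qZq.mp hx
  clear hx
  refine mul_mem (by simpa using zpow_mem_laurent 1) ?_
  induction f using Polynomial.induction_on' with
  | add a b ha hb => rw [map_add]; exact add_mem ha hb
  | monomial n c =>
    rw [← C_mul_X_pow_eq_monomial, map_mul, map_pow, aeval_X, aeval_C]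
    exact mul_mem (by simp) (by simpa using zpow_mem_laurent n)

/-- The terms are sorted by the sign of their exponents. -/
theorem laurent_decomp {x : Kq} (hx : x ∈ laurent) :
    ∃ p ∈ qZq, ∃ c : ℤ, ∃ r ∈ qZq, x = p + c + bar r := by
  refine laurent_induction
    (P := fun x => ∃ p ∈ qZq, ∃ c : ℤ, ∃ r ∈ qZq, x = p + c + bar r) ?_ ?_ hx
  · rintro _ _ ⟨p, hp, c, r, hr, rfl⟩ ⟨p', hp', c', r', hr', rfl⟩
    exact ⟨p + p', add_mem hp hp', c + c', r + r', add_mem hr hr', by push_cast; simp; ring⟩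
  · intro c n
    rcases lt_trichotomy n 0 with h | h | h
    · refine ⟨0, zero_mem _, 0, c * q ^ (-n), ?_, by simp [bar_q]⟩
      rw [← zsmul_eq_mul]
      exact zsmul_mem (q_zpow_mem_qZq (by omega)) _
    · exact ⟨0, zero_mem _, c, 0, zero_mem _, by simp [h]⟩
    · refine ⟨c * q ^ n, ?_, 0, 0, zero_mem _, by simp⟩
      rw [← zsmul_eq_mul]
      exact zsmul_mem (q_zpow_mem_qZq (by omega)) _

theorem aeval_int_q_injective : Function.Injective (aeval q : ℤ[X] →ₐ[ℤ] Kq) := by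
  rw [injective_iff_map_eq_zero]
  intro f hf
  by_contra hne
  have h : aeval q (f.map (Int.castRingHom ℚ)) = aeval q f := by
    rw [aeval_def, aeval_def, eval₂_map]
    congr 1
    exact Subsingleton.elim _ _
  refine aeval_q_ne_zero (p := f.map (Int.castRingHom ℚ)) ?_ (h.trans hf)
  rwa [Ne, Polynomial.map_eq_zero_iff (RingHom.injective_int _)]

/-- The groups qℤ[q], ℤ and q⁻¹ℤ[q⁻¹] are independent. After multiplication by a power of q the
three parts become polynomials whose exponents lie in disjoint ranges. -/
theorem eq_zero_of_decomp {p r : Kq} {c : ℤ} (hp : p ∈ qZq) (hr : r ∈ qZq)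
    (h : p + c + bar r = 0) : p = 0 ∧ c = 0 := by
  obtain ⟨f, rfl⟩ := mem_qZq.mp hp
  obtain ⟨g, rfl⟩ := mem_qZq.mp hr
  have hq := q_ne_zero
  let _ : Invertible q := invertibleOfNonzero hq
  set n := g.natDegree
  have hbar : bar (aeval q g) = eval₂ (Int.castRingHom Kq) q⁻¹ g := by
    rw [aeval_def, hom_eval₂, bar_q]
    congr 1
    exact Subsingleton.elim _ _
  have hrev : eval₂ (Int.castRingHom Kq) q⁻¹ g * q ^ n = aeval q g.reverse := by
    let _ : Invertible q⁻¹ := invertibleOfNonzero (inv_ne_zero q_ne_zero)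
    have h2 := eval₂_reverse_mul_pow (Int.castRingHom Kq) q⁻¹ g
    have : ⅟(q⁻¹) = q := by simp
    rw [this] at h2
    rw [← h2, aeval_def, mul_assoc, ← mul_pow, inv_mul_cancel₀ hq, one_pow, mul_one]
    exact congrArg (fun i => eval₂ i q g.reverse) (Subsingleton.elim _ _)
  -- The relation times q^(n+1): the three summands live in degrees at least n + 2, equal to n + 1,
  -- and at most n.
  have hpoly : X ^ (n + 2) * f + C c * X ^ (n + 1) + g.reverse = 0 := by
    apply aeval_int_q_injective
    have : aeval q (C c : ℤ[X]) = (c : Kq) := by simp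
    rw [map_add, map_add, map_mul, map_mul, map_pow, map_pow, aeval_X, this, map_zero, ← hrev,
      ← hbar]
    rw [map_mul, bar_q] at h
    calc _ = q ^ (n + 1) * (q * aeval q f + c + q⁻¹ * bar (aeval q g)) := by
            field_simp; ring
      _ = 0 := by rw [h, mul_zero]
  have hcoeff : ∀ k, n < k → g.reverse.coeff k = 0 := fun k hk =>
    coeff_eq_zero_of_natDegree_lt (lt_of_le_of_lt (reverse_natDegree_le g) hk)
  have hf : f = 0 := by
    ext k
    have := congrArg (fun s => coeff s (k + (n + 2))) hpoly
    simpa [coeff_X_pow_mul, hcoeff (k + (n + 2)) (by omega), coeff_X_pow,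
      show k + (n + 2) ≠ n + 1 by omega] using this
  have hc : c = 0 := by
    have := congrArg (fun s => coeff s (n + 1)) hpoly
    simpa [hf, hcoeff (n + 1) (by omega), coeff_X_pow] using this
  exact ⟨by simp [hf], hc⟩

/-- Such an element also lies in q⁻¹ℤ[q⁻¹]. This is the source of uniqueness of the canonical basis.
-/
theorem eq_zero_of_bar_eq {p : Kq} (hp : p ∈ qZq) (h : bar p = p) : p = 0 := by
  refine (eq_zero_of_decomp (c := 0) hp (neg_mem hp) ?_).1
  rw [map_neg, h]; simp

/-- The constant term satisfies 2c = 0 and the negative part is minus the bar of the positive part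
p. This is the source of existence of the canonical basis. -/
theorem exists_sub_bar {x : Kq} (hx : x ∈ laurent) (h : bar x = -x) :
    ∃ p ∈ qZq, x = p - bar p := by
  obtain ⟨p, hp, c, r, hr, rfl⟩ := laurent_decomp hx
  have h2 : (p + r) + ((2 * c : ℤ) : Kq) + bar (p + r) = 0 := by
    rw [map_add, map_add, bar_bar, map_intCast] at h
    rw [map_add]; push_cast
    linear_combination h
  obtain ⟨h3, h4⟩ := eq_zero_of_decomp (add_mem hp hr) (add_mem hp hr) h2
  have hc : c = 0 := by omega
  refine ⟨p, hp, ?_⟩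
  rw [eq_neg_of_add_eq_zero_right h3, hc]; simp [sub_eq_add_neg]

end KroneckerQuantum

end

section
namespace KroneckerQuantum

/-! ### Ladders of root vectors -/

section Ladder

variable {k A : Type*} [Field k] [Ring A] [Algebra k A]

/-- The derivation [D, ·] is applied to `h`. -/
theorem ladder_two {t : k} {D x₀ x₁ x₂ : A} (h₀ : D * x₀ - x₀ * D = x₁)
    (h₁ : D * x₁ - x₁ * D = x₂) (h : x₁ * x₀ = t ^ 2 • (x₀ * x₁)) :
    x₂ * x₀ = t ^ 2 • (x₀ * x₂) + (t ^ 2 - 1) • (x₁ * x₁) := by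
  linear_combination (norm := skip) D * h - h * D - h₁ * x₀ - x₁ * h₀
    + t ^ 2 • (h₀ * x₁) + t ^ 2 • (x₀ * h₁)
  simp only [mul_sub, sub_mul, mul_smul_comm, smul_mul_assoc, mul_assoc]
  module

/-- The derivation [D, ·] is applied to `ladder_two`. Both orders of x₁ and x₂ are kept, because
their commutation is only established in `ladder_step`. -/
theorem ladder_three {t : k} {D x₀ x₁ x₂ x₃ : A} (h₀ : D * x₀ - x₀ * D = x₁)
    (h₁ : D * x₁ - x₁ * D = x₂) (h₂ : D * x₂ - x₂ * D = x₃)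
    (h : x₁ * x₀ = t ^ 2 • (x₀ * x₁)) :
    x₃ * x₀ = t ^ 2 • (x₀ * x₃) + (t ^ 2 - 2) • (x₂ * x₁) + (2 * t ^ 2 - 1) • (x₁ * x₂) := by
  have h' := ladder_two h₀ h₁ h
  linear_combination (norm := skip) D * h' - h' * D - h₂ * x₀ - x₂ * h₀
    + t ^ 2 • (h₀ * x₂) + t ^ 2 • (x₀ * h₂) + (t ^ 2 - 1) • (h₁ * x₁ + x₁ * h₁)
  simp only [mul_sub, sub_mul, mul_add, add_mul, mul_smul_comm, smul_mul_assoc, mul_assoc]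
  module

/-- The derivation [P, ·] moves two rungs up, modulo terms ending in D. Applied to `h` and combined
with `ladder_three`, it produces the next q-commutation multiplied by t² + t⁻². -/
theorem ladder_step {t : k} (ht : t ≠ 0) (ht' : t ^ 4 + 1 ≠ 0) {D P x₀ x₁ x₂ x₃ : A}
    (h₀ : D * x₀ - x₀ * D = x₁)
    (h₁ : D * x₁ - x₁ * D = x₂) (h₂ : D * x₂ - x₂ * D = x₃)
    (p₀ : P * x₀ - x₀ * P = t ^ 2 • x₂ + (t ^ 2 - (t ^ 2)⁻¹) • (x₁ * D))
    (p₁ : P * x₁ - x₁ * P = t ^ 2 • x₃ + (t ^ 2 - (t ^ 2)⁻¹) • (x₂ * D))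
    (h : x₁ * x₀ = t ^ 2 • (x₀ * x₁)) : x₂ * x₁ = t ^ 2 • (x₁ * x₂) := by
  have h' := ladder_two h₀ h₁ h
  have h'' := ladder_three h₀ h₁ h₂ h
  have key : (t ^ 2 + (t ^ 2)⁻¹) • (x₂ * x₁) = (t ^ 2 + (t ^ 2)⁻¹) • (t ^ 2 • (x₁ * x₂)) := by
    linear_combination (norm := skip) h * P - P * h + p₁ * x₀ + x₁ * p₀
      - t ^ 2 • (p₀ * x₁) - t ^ 2 • (x₀ * p₁) + t ^ 2 • h''
      + (t ^ 2 - (t ^ 2)⁻¹) • (x₂ * h₀ - t ^ 2 • (x₁ * h₁) + h' * D)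
    simp only [mul_sub, sub_mul, mul_add, add_mul, mul_smul_comm, smul_mul_assoc, mul_assoc,
      smul_sub, smul_add]
    match_scalars <;> field_simp <;> ring
  have hne : t ^ 2 + (t ^ 2)⁻¹ ≠ 0 := by
    have : t ^ 2 + (t ^ 2)⁻¹ = (t ^ 4 + 1) * (t ^ 2)⁻¹ := by field_simp
    rw [this]
    exact mul_ne_zero ht' (inv_ne_zero (pow_ne_zero _ ht))
  exact smul_right_injective A hne key

end Ladder

/-! ### From the quantum Serre relations to the straightening relations -/

section Serre

variable {k A : Type*} [Field k] [Ring A] [Algebra k A] {t : k} {e f D P x₁ x₂ y₁ y₂ : A}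

/-- Here e and f play the roles of E₁ and E₂, and P is the imaginary root vector of twice the degree
of D. Its action on e is what `ladder_step` needs. -/
theorem bracket_root_left (ht : t ≠ 0) (hD : D = f * e - (t ^ 2)⁻¹ • (e * f))
    (hx₂ : D * x₁ - x₁ * D = x₂) (hx : x₁ * e = t ^ 2 • (e * x₁))
    (hP : P = f * x₁ - (t ^ 2)⁻¹ • (x₁ * f)) :
    P * e - e * P = t ^ 2 • x₂ + (t ^ 2 - (t ^ 2)⁻¹) • (x₁ * D) := by
  subst hP hx₂ hD
  linear_combination (norm := skip) f * hx - (t ^ 4)⁻¹ • (hx * f)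
  simp only [mul_sub, sub_mul, mul_smul_comm, smul_mul_assoc, mul_assoc, smul_sub]
  match_scalars <;> field_simp <;> ring

theorem bracket_root_right (ht : t ≠ 0) (hD : D = f * e - (t ^ 2)⁻¹ • (e * f))
    (hy₂ : D * y₁ - y₁ * D = y₂) (hy : f * y₁ = t ^ 2 • (y₁ * f))
    (hP : P = -(y₁ * e - (t ^ 2)⁻¹ • (e * y₁))) :
    P * f - f * P = -(t ^ 2 • y₂) + (t ^ 2 - (t ^ 2)⁻¹) • (D * y₁) := by
  subst hP hy₂ hD
  linear_combination (norm := skip) hy * e - (t ^ 4)⁻¹ • (e * hy)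
  simp only [mul_sub, sub_mul, mul_smul_comm, smul_mul_assoc, mul_assoc, smul_sub, neg_mul,
    mul_neg]
  match_scalars <;> field_simp <;> ring

/-- P has one expression from the e side and another from the f side. Computing [P, D] by the
Leibniz rule through D = fe − t⁻²ef, with both expressions in hand, gives (1 + t² + t⁻²)[P, D] = 0.
-/
theorem imaginary_comm (ht : t ≠ 0) (ht' : t ^ 4 + t ^ 2 + 1 ≠ 0)
    (hD : D = f * e - (t ^ 2)⁻¹ • (e * f))
    (hx₁ : D * e - e * D = x₁) (hy₁ : D * f - f * D = y₁)
    (hx : x₁ * e = t ^ 2 • (e * x₁)) (hy : f * y₁ = t ^ 2 • (y₁ * f))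
    (hP : P = f * x₁ - (t ^ 2)⁻¹ • (x₁ * f)) : P * D = D * P := by
  obtain ⟨x₂, hx₂⟩ : ∃ x₂, D * x₁ - x₁ * D = x₂ := ⟨_, rfl⟩
  obtain ⟨y₂, hy₂⟩ : ∃ y₂, D * y₁ - y₁ * D = y₂ := ⟨_, rfl⟩
  have hP' : P = -(y₁ * e - (t ^ 2)⁻¹ • (e * y₁)) := by
    linear_combination (norm := skip) hP - D * hD + hD * D - f * hx₁ + (t ^ 2)⁻¹ • (hx₁ * f)
      - hy₁ * e + (t ^ 2)⁻¹ • (e * hy₁)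
    simp only [mul_sub, sub_mul, mul_smul_comm, smul_mul_assoc, mul_assoc, smul_sub]
    module
  have hPe := bracket_root_left ht hD hx₂ hx hP
  have hPf := bracket_root_right ht hD hy₂ hy hP'
  have hA : f * x₂ - (t ^ 2)⁻¹ • (x₂ * f) = D * P - P * D - (y₁ * x₁ - (t ^ 2)⁻¹ • (x₁ * y₁)) := by
    rw [hP, ← hx₂, ← hy₁]
    simp only [mul_sub, sub_mul, mul_smul_comm, smul_mul_assoc, mul_assoc, smul_sub]
    module
  have hB : y₂ * e - (t ^ 2)⁻¹ • (e * y₂)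
      = -(D * P - P * D) - (y₁ * x₁ - (t ^ 2)⁻¹ • (x₁ * y₁)) := by
    rw [hP', ← hy₂, ← hx₁]
    simp only [mul_sub, sub_mul, mul_smul_comm, smul_mul_assoc, mul_assoc, smul_sub, mul_neg,
      neg_mul]
    module
  have hE : P * D - D * P = (P * f - f * P) * e + f * (P * e - e * P)
      - (t ^ 2)⁻¹ • ((P * e - e * P) * f) - (t ^ 2)⁻¹ • (e * (P * f - f * P)) := by
    rw [hD]
    simp only [mul_sub, sub_mul, mul_smul_comm, smul_mul_assoc, mul_assoc, smul_sub]
    module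
  rw [hPe, hPf] at hE
  have hκ : D * (y₁ * e) + f * x₁ * D - (t ^ 2)⁻¹ • (x₁ * D * f) - (t ^ 2)⁻¹ • (e * (D * y₁))
      = P * D - D * P := by
    linear_combination (norm := skip) D * hP' - hP * D - (t ^ 2)⁻¹ • (x₁ * hy₁)
      + (t ^ 2)⁻¹ • (hx₁ * y₁)
    simp only [mul_sub, sub_mul, mul_smul_comm, smul_mul_assoc, mul_assoc, smul_sub, mul_neg]
    module
  have key : (1 + t ^ 2 + (t ^ 2)⁻¹) • (P * D - D * P) = 0 := by
    linear_combination (norm := skip) hE + t ^ 2 • hA - t ^ 2 • hB + (t ^ 2 - (t ^ 2)⁻¹) • hκ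
    simp only [mul_sub, sub_mul, mul_add, add_mul, mul_smul_comm, smul_mul_assoc, mul_assoc,
      smul_sub, smul_add, mul_neg, neg_mul]
    match_scalars <;> field_simp <;> ring
  have hne : 1 + t ^ 2 + (t ^ 2)⁻¹ ≠ 0 := by
    have : 1 + t ^ 2 + (t ^ 2)⁻¹ = (t ^ 4 + t ^ 2 + 1) * (t ^ 2)⁻¹ := by field_simp; ring
    rw [this]
    exact mul_ne_zero ht' (inv_ne_zero (pow_ne_zero _ ht))
  exact sub_eq_zero.mp ((smul_eq_zero.mp key).resolve_left hne)

/-- As P and D commute, [D, ·] may be applied to `hP` and moves the whole formula one rung up. -/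
theorem bracket_shift {c d : k} {x x' x'' x''' : A} (hPD : P * D = D * P)
    (h : D * x - x * D = x') (h' : D * x' - x' * D = x'') (h'' : D * x'' - x'' * D = x''')
    (hP : P * x - x * P = c • x'' + d • (x' * D)) :
    P * x' - x' * P = c • x''' + d • (x'' * D) := by
  linear_combination (norm := skip) h * P - P * h + hPD * x - x * hPD + D * hP - hP * D
    + c • h'' + d • (h' * D)
  simp only [mul_sub, sub_mul, mul_add, add_mul, mul_smul_comm, smul_mul_assoc, mul_assoc]
  module

/-- The straightening relations satisfied by four consecutive root vectors. -/
structure IsLadder (t : k) (x : Fin 4 → A) : Prop where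
  r10 : x 1 * x 0 = t ^ 2 • (x 0 * x 1)
  r21 : x 2 * x 1 = t ^ 2 • (x 1 * x 2)
  r32 : x 3 * x 2 = t ^ 2 • (x 2 * x 3)
  r20 : x 2 * x 0 = t ^ 2 • (x 0 * x 2) + (t ^ 2 - 1) • (x 1 * x 1)
  r31 : x 3 * x 1 = t ^ 2 • (x 1 * x 3) + (t ^ 2 - 1) • (x 2 * x 2)
  r30 : x 3 * x 0 = t ^ 2 • (x 0 * x 3) + (t ^ 2 - (t ^ 2)⁻¹) • (x 2 * x 1)

/-- In terms of D the two Serre relations become the q-commutations of [D, e] with e and of f with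
[D, f]. Everything else follows by applying the brackets with D and P. -/
theorem isLadder_of_serre (ht : t ≠ 0) (ht' : t ^ 4 + t ^ 2 + 1 ≠ 0) (ht'' : t ^ 4 + 1 ≠ 0)
    (hef : e ^ 3 * f - (t ^ 2 + 1 + (t ^ 2)⁻¹) • (e ^ 2 * f * e)
      + (t ^ 2 + 1 + (t ^ 2)⁻¹) • (e * f * e ^ 2) - f * e ^ 3 = 0)
    (hfe : f ^ 3 * e - (t ^ 2 + 1 + (t ^ 2)⁻¹) • (f ^ 2 * e * f)
      + (t ^ 2 + 1 + (t ^ 2)⁻¹) • (f * e * f ^ 2) - e * f ^ 3 = 0)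
    (hD : D = f * e - (t ^ 2)⁻¹ • (e * f)) {x : Fin 4 → A} (h0 : x 0 = e)
    (h1 : D * x 0 - x 0 * D = x 1) (h2 : D * x 1 - x 1 * D = x 2)
    (h3 : D * x 2 - x 2 * D = x 3) : IsLadder t x := by
  have r10 : x 1 * x 0 = t ^ 2 • (x 0 * x 1) := by
    rw [← h1, h0, hD]
    linear_combination (norm := skip) -hef
    simp only [mul_sub, sub_mul, mul_smul_comm, smul_mul_assoc, mul_assoc, smul_sub, pow_succ,
      pow_zero, one_mul]
    match_scalars <;> field_simp <;> ring
  obtain ⟨y₁, hy₁⟩ : ∃ y₁, D * f - f * D = y₁ := ⟨_, rfl⟩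
  have hy : f * y₁ = t ^ 2 • (y₁ * f) := by
    rw [← hy₁, hD]
    linear_combination (norm := skip) -hfe
    simp only [mul_sub, sub_mul, mul_smul_comm, smul_mul_assoc, mul_assoc, smul_sub, pow_succ,
      pow_zero, one_mul]
    match_scalars <;> field_simp <;> ring
  obtain ⟨P, hP⟩ : ∃ P, P = f * x 1 - (t ^ 2)⁻¹ • (x 1 * f) := ⟨_, rfl⟩
  -- A fifth rung is needed, since the q-commutation of `x 3` with `x 2` comes from a step that
  -- reaches two rungs higher than `x 2`.
  obtain ⟨x₄, h4⟩ : ∃ x₄, D * x 3 - x 3 * D = x₄ := ⟨_, rfl⟩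
  rw [h0] at h1 r10
  have hPD : P * D = D * P := imaginary_comm ht ht' hD h1 hy₁ r10 hy hP
  have p0 := bracket_root_left ht hD h2 r10 hP
  have p1 := bracket_shift hPD h1 h2 h3 p0
  have p2 := bracket_shift hPD h2 h3 h4 p1
  have r21 := ladder_step ht ht'' h1 h2 h3 p0 p1 r10
  have r32 := ladder_step ht ht'' h2 h3 h4 p1 p2 r21
  rw [← h0] at h1 r10
  refine ⟨r10, r21, r32, ladder_two h1 h2 r10, ladder_two h2 h3 r21, ?_⟩
  -- The relation r21 merges the two middle terms of `ladder_three` into one with coefficient t² −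
  -- t⁻².
  linear_combination (norm := skip) ladder_three h1 h2 h3 r10 - (2 - (t ^ 2)⁻¹) • r21
  match_scalars <;> field_simp <;> ring

end Serre

end KroneckerQuantum

end

section
namespace KroneckerQuantum

/-! ### Commutation relations in the quantized enveloping algebra -/

section Chevalley

variable {k A : Type*} [Field k] [Ring A] [Algebra k A]

theorem reassoc_smul {a b c d : A} {r : k} (h : a * b = r • (c * d)) (x : A) :
    a * (b * x) = r • (c * (d * x)) := by
  rw [← mul_assoc, h, smul_mul_assoc, mul_assoc]

theorem reassoc_mul {a b c d : A} (h : a * b = c * d) (x : A) :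
    a * (b * x) = c * (d * x) := by
  rw [← mul_assoc, h, mul_assoc]

theorem reassoc_one {a b : A} (h : a * b = 1) (x : A) : a * (b * x) = x := by
  rw [← mul_assoc, h, one_mul]

/-- The Chevalley relations of type `A₁⁽¹⁾`, without the quantum Serre relations. -/
structure IsChevalley (t : k) (E F K L : Fin 2 → A) : Prop where
  ke00 : K 0 * E 0 = t ^ 2 • (E 0 * K 0)
  ke01 : K 0 * E 1 = (t ^ 2)⁻¹ • (E 1 * K 0)
  ke10 : K 1 * E 0 = (t ^ 2)⁻¹ • (E 0 * K 1)
  ke11 : K 1 * E 1 = t ^ 2 • (E 1 * K 1)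
  le00 : L 0 * E 0 = (t ^ 2)⁻¹ • (E 0 * L 0)
  le01 : L 0 * E 1 = t ^ 2 • (E 1 * L 0)
  le10 : L 1 * E 0 = t ^ 2 • (E 0 * L 1)
  le11 : L 1 * E 1 = (t ^ 2)⁻¹ • (E 1 * L 1)
  kf00 : K 0 * F 0 = (t ^ 2)⁻¹ • (F 0 * K 0)
  kf01 : K 0 * F 1 = t ^ 2 • (F 1 * K 0)
  kf10 : K 1 * F 0 = t ^ 2 • (F 0 * K 1)
  kf11 : K 1 * F 1 = (t ^ 2)⁻¹ • (F 1 * K 1)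
  lf00 : L 0 * F 0 = t ^ 2 • (F 0 * L 0)
  lf01 : L 0 * F 1 = (t ^ 2)⁻¹ • (F 1 * L 0)
  lf10 : L 1 * F 0 = (t ^ 2)⁻¹ • (F 0 * L 1)
  lf11 : L 1 * F 1 = t ^ 2 • (F 1 * L 1)
  kk : K 1 * K 0 = K 0 * K 1
  kl : K 1 * L 0 = L 0 * K 1
  lk : L 1 * K 0 = K 0 * L 1
  ll : L 1 * L 0 = L 0 * L 1
  kl0 : K 0 * L 0 = 1
  lk0 : L 0 * K 0 = 1
  kl1 : K 1 * L 1 = 1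
  lk1 : L 1 * K 1 = 1
  ef00 : E 0 * F 0 - F 0 * E 0 = (t - t⁻¹)⁻¹ • (K 0 - L 0)
  ef11 : E 1 * F 1 - F 1 * E 1 = (t - t⁻¹)⁻¹ • (K 1 - L 1)
  ef01 : E 0 * F 1 = F 1 * E 0
  ef10 : E 1 * F 0 = F 0 * E 1

namespace IsChevalley

variable {t : k} {E F K L : Fin 2 → A} {D G g v₁ v₂ : A}

theorem bracket_imaginary_F0 (h : IsChevalley t E F K L) (ht : t ≠ 0) (hs : t ^ 2 - 1 ≠ 0)
    (hD : D = E 1 * E 0 - (t ^ 2)⁻¹ • (E 0 * E 1)) :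
    D * F 0 - F 0 * D = ((t ^ 2)⁻¹ * (t + t⁻¹)) • (E 1 * K 0) := by
  rw [hD]
  linear_combination (norm := skip) E 1 * h.ef00 - (t ^ 2)⁻¹ • (h.ef00 * E 1)
    + h.ef10 * E 0 - (t ^ 2)⁻¹ • (E 0 * h.ef10)
  simp only [mul_sub, sub_mul, mul_smul_comm, smul_mul_assoc, mul_assoc, smul_sub, h.ke01, h.le01]
  match_scalars <;> field_simp <;> ring

theorem bracket_imaginary_F1 (h : IsChevalley t E F K L) (ht : t ≠ 0) (hs : t ^ 2 - 1 ≠ 0)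
    (hD : D = E 1 * E 0 - (t ^ 2)⁻¹ • (E 0 * E 1)) :
    D * F 1 - F 1 * D = -((t + t⁻¹) • (E 0 * L 1)) := by
  rw [hD]
  linear_combination (norm := skip) h.ef11 * E 0 - (t ^ 2)⁻¹ • (E 0 * h.ef11)
    + E 1 * h.ef01 - (t ^ 2)⁻¹ • (h.ef01 * E 1)
  simp only [mul_sub, sub_mul, mul_smul_comm, smul_mul_assoc, mul_assoc, smul_sub, h.ke10, h.le10]
  match_scalars <;> field_simp <;> ring

/-- Obtained by bracketing `hv₁` with `F 0`. The vector D commutes with `K 0` and `L 0` because its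
degree is the imaginary root. -/
theorem bracket_root_F0 (h : IsChevalley t E F K L) (ht : t ≠ 0) (hs : t ^ 2 - 1 ≠ 0)
    (hc : t + t⁻¹ ≠ 0)
    (hD : D = E 1 * E 0 - (t ^ 2)⁻¹ • (E 0 * E 1))
    (hv₁ : D * E 0 - E 0 * D = (t + t⁻¹) • v₁) : v₁ * F 0 - F 0 * v₁ = D * K 0 := by
  have h1 := h.bracket_imaginary_F0 ht hs hD
  have hDK : D * K 0 = K 0 * D ∧ D * L 0 = L 0 * D := by
    rw [hD]
    simp only [mul_sub, sub_mul, mul_smul_comm, smul_mul_assoc, mul_assoc, smul_sub, h.ke01,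
      h.le01, h.ke00, h.le00, reassoc_smul h.ke01, reassoc_smul h.ke00, reassoc_smul h.le00,
      reassoc_smul h.le01]
    constructor <;> match_scalars <;> field_simp
  refine smul_right_injective A hc ?_
  linear_combination (norm := skip) -hv₁ * F 0 + F 0 * hv₁ + h1 * E 0 - E 0 * h1
    + D * h.ef00 - h.ef00 * D + (t - t⁻¹)⁻¹ • (hDK.1 - hDK.2) - (t + t⁻¹) • (hD * K 0)
  simp only [mul_sub, sub_mul, mul_smul_comm, smul_mul_assoc, mul_assoc, smul_sub, h.ke00]
  match_scalars <;> field_simp <;> ring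

/-- `G` is the counterpart of D among the F's, and `g` in the lemmas below, with [F 0, G] = (t +
t⁻¹) g, represents T₁(F₂). The brackets of D, v₁ and v₂ with G and g prepare `braid_imaginary`. -/
theorem bracket_imaginary_FF (h : IsChevalley t E F K L) (ht : t ≠ 0) (hs : t ^ 2 - 1 ≠ 0)
    (hD : D = E 1 * E 0 - (t ^ 2)⁻¹ • (E 0 * E 1))
    (hG : G = F 0 * F 1 - t ^ 2 • (F 1 * F 0)) :
    D * G - G * D = ((t + t⁻¹) * (t - t⁻¹)⁻¹) • (K 0 * K 1 - L 0 * L 1) := by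
  have h0 := h.bracket_imaginary_F0 ht hs hD
  have h1 := h.bracket_imaginary_F1 ht hs hD
  rw [hG]
  linear_combination (norm := skip) h0 * F 1 + F 0 * h1 - t ^ 2 • (h1 * F 0) - t ^ 2 • (F 1 * h0)
    + (t + t⁻¹) • (h.ef11 * K 0 + h.ef00 * L 1)
  simp only [mul_sub, sub_mul, mul_add, add_mul, mul_smul_comm, smul_mul_assoc, mul_assoc,
    smul_sub, smul_add, h.kf01, h.lf10, reassoc_smul h.kf01, h.kk, h.lk, mul_neg, neg_mul]
  match_scalars <;> field_simp <;> ring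

theorem bracket_E1_FF (h : IsChevalley t E F K L) (ht : t ≠ 0) (hs : t ^ 2 - 1 ≠ 0)
    (hG : G = F 0 * F 1 - t ^ 2 • (F 1 * F 0)) :
    E 1 * G - G * E 1 = -((t ^ 2 * (t + t⁻¹)) • (F 0 * K 1)) := by
  rw [hG]
  linear_combination (norm := skip) F 0 * h.ef11 - t ^ 2 • (h.ef11 * F 0)
    + h.ef10 * F 1 - t ^ 2 • (F 1 * h.ef10)
  simp only [mul_sub, sub_mul, mul_smul_comm, smul_mul_assoc, mul_assoc, smul_sub, h.kf10, h.lf10]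
  match_scalars <;> field_simp <;> ring

theorem bracket_E0_FF (h : IsChevalley t E F K L) (ht : t ≠ 0) (hs : t ^ 2 - 1 ≠ 0)
    (hG : G = F 0 * F 1 - t ^ 2 • (F 1 * F 0)) :
    E 0 * G - G * E 0 = (t + t⁻¹) • (F 1 * L 0) := by
  rw [hG]
  linear_combination (norm := skip) h.ef00 * F 1 - t ^ 2 • (F 1 * h.ef00)
    + F 0 * h.ef01 - t ^ 2 • (h.ef01 * F 0)
  simp only [mul_sub, sub_mul, mul_smul_comm, smul_mul_assoc, mul_assoc, smul_sub, h.kf01, h.lf01]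
  match_scalars <;> field_simp <;> ring

theorem bracket_imaginary_g (h : IsChevalley t E F K L) (ht : t ≠ 0) (hs : t ^ 2 - 1 ≠ 0)
    (hc : t + t⁻¹ ≠ 0)
    (hD : D = E 1 * E 0 - (t ^ 2)⁻¹ • (E 0 * E 1))
    (hG : G = F 0 * F 1 - t ^ 2 • (F 1 * F 0)) (hg : F 0 * G - G * F 0 = (t + t⁻¹) • g) :
    D * g - g * D = -((t + t⁻¹) • (F 0 * (K 0 * K 1))) := by
  have hDF := h.bracket_imaginary_F0 ht hs hD
  have hDG := h.bracket_imaginary_FF ht hs hD hG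
  have hEG := h.bracket_E1_FF ht hs hG
  have hKG : K 0 * G = G * K 0 := by
    rw [hG]
    simp only [mul_sub, sub_mul, mul_smul_comm, smul_mul_assoc, mul_assoc, smul_sub,
      h.kf00, h.kf01, reassoc_smul h.kf00, reassoc_smul h.kf01]
    match_scalars <;> field_simp
  refine smul_right_injective A hc ?_
  linear_combination (norm := skip) -(D * hg) + hg * D + hDF * G - G * hDF + F 0 * hDG - hDG * F 0
    + ((t ^ 2)⁻¹ * (t + t⁻¹)) • (E 1 * hKG + hEG * K 0)
  simp only [mul_sub, sub_mul, mul_add, add_mul, mul_smul_comm, smul_mul_assoc, mul_assoc,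
    smul_sub, smul_add, h.kf00, h.kf10, h.lf00, h.lf10, reassoc_smul h.kf00, reassoc_smul h.lf00,
    h.kk, mul_neg, neg_mul]
  match_scalars <;> field_simp <;> ring

theorem bracket_E0_g (h : IsChevalley t E F K L) (ht : t ≠ 0) (hs : t ^ 2 - 1 ≠ 0)
    (hc : t + t⁻¹ ≠ 0)
    (hG : G = F 0 * F 1 - t ^ 2 • (F 1 * F 0)) (hg : F 0 * G - G * F 0 = (t + t⁻¹) • g) :
    E 0 * g - g * E 0 = G * L 0 := by
  have hEG := h.bracket_E0_FF ht hs hG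
  have hKG : K 0 * G = G * K 0 ∧ L 0 * G = G * L 0 := by
    rw [hG]
    simp only [mul_sub, sub_mul, mul_smul_comm, smul_mul_assoc, mul_assoc, smul_sub,
      h.kf00, h.kf01, reassoc_smul h.kf00, reassoc_smul h.kf01,
      h.lf00, h.lf01, reassoc_smul h.lf00, reassoc_smul h.lf01]
    constructor <;> match_scalars <;> field_simp
  refine smul_right_injective A hc ?_
  linear_combination (norm := skip) -(E 0 * hg) + hg * E 0 + h.ef00 * G - G * h.ef00
    + (t - t⁻¹)⁻¹ • (hKG.1 - hKG.2) + F 0 * hEG - hEG * F 0 - (t + t⁻¹) • (hG * L 0)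
  simp only [mul_sub, sub_mul, mul_smul_comm, smul_mul_assoc, mul_assoc,
    smul_sub, h.lf00]
  match_scalars <;> field_simp <;> ring

theorem bracket_root_g (h : IsChevalley t E F K L) (ht : t ≠ 0) (hs : t ^ 2 - 1 ≠ 0)
    (hc : t + t⁻¹ ≠ 0)
    (hD : D = E 1 * E 0 - (t ^ 2)⁻¹ • (E 0 * E 1))
    (hG : G = F 0 * F 1 - t ^ 2 • (F 1 * F 0)) (hg : F 0 * G - G * F 0 = (t + t⁻¹) • g)
    (hv₁ : D * E 0 - E 0 * D = (t + t⁻¹) • v₁) :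
    v₁ * g - g * v₁ = (t - t⁻¹)⁻¹ • (K 0 * (K 0 * K 1) - L 0 * (L 0 * L 1)) := by
  have hDg := h.bracket_imaginary_g ht hs hc hD hG hg
  have hEg := h.bracket_E0_g ht hs hc hG hg
  have hDG := h.bracket_imaginary_FF ht hs hD hG
  have hDL : D * L 0 = L 0 * D := by
    rw [hD]
    simp only [mul_sub, sub_mul, mul_smul_comm, smul_mul_assoc, mul_assoc, smul_sub, h.ke01,
      h.le01, h.ke00, h.le00, reassoc_smul h.ke01, reassoc_smul h.ke00, reassoc_smul h.le00,
      reassoc_smul h.le01]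
    match_scalars <;> field_simp
  refine smul_right_injective A hc ?_
  linear_combination (norm := skip) -(hv₁ * g) + g * hv₁ + D * hEg - hEg * D + hDg * E 0 - E 0 * hDg
    + hDG * L 0 + G * hDL + (t + t⁻¹) • (h.ef00 * (K 0 * K 1))
  simp only [mul_sub, sub_mul, mul_smul_comm, smul_mul_assoc, mul_assoc, smul_sub, mul_neg,
    neg_mul, h.ke00, h.ke10, reassoc_smul h.ke00, reassoc_smul h.ke10, h.kl, h.ll,
    reassoc_one h.kl0, reassoc_one h.lk0]
  match_scalars <;> field_simp <;> ring

/-- The degree α₁ + α₂ of D pairs to zero with both simple roots. -/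
theorem imaginary_comm_torus (h : IsChevalley t E F K L) (ht : t ≠ 0)
    (hD : D = E 1 * E 0 - (t ^ 2)⁻¹ • (E 0 * E 1)) :
    (K 0 * D = D * K 0 ∧ K 1 * D = D * K 1) ∧ (L 0 * D = D * L 0 ∧ L 1 * D = D * L 1) := by
  rw [hD]
  simp only [mul_sub, sub_mul, mul_smul_comm, smul_mul_assoc, mul_assoc, h.ke01,
    h.le01, h.ke00, h.le00, h.ke10, h.ke11, h.le10, h.le11, reassoc_smul h.ke01,
    reassoc_smul h.ke00, reassoc_smul h.le00, reassoc_smul h.le01, reassoc_smul h.ke11,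
    reassoc_smul h.ke10, reassoc_smul h.le10, reassoc_smul h.le11]
  refine ⟨⟨?_, ?_⟩, ?_, ?_⟩ <;> match_scalars <;> field_simp

theorem _root_.KroneckerQuantum.torus_root_succ {M D x y : A} {r c : k} (hc : c ≠ 0)
    (hD : M * D = D * M) (hx : M * x = r • (x * M)) (hy : D * x - x * D = c • y) :
    M * y = r • (y * M) := by
  refine smul_right_injective A hc ?_
  linear_combination (norm := skip) -(M * hy) + r • (hy * M) + hD * x - x * hD * 0 + D * hx
    - hx * D - r • (x * hD)
  simp only [mul_sub, sub_mul, mul_smul_comm, smul_mul_assoc, mul_assoc, mul_zero]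
  module

theorem torus_root (h : IsChevalley t E F K L) (ht : t ≠ 0) (hc : t + t⁻¹ ≠ 0)
    (hD : D = E 1 * E 0 - (t ^ 2)⁻¹ • (E 0 * E 1))
    (hv₁ : D * E 0 - E 0 * D = (t + t⁻¹) • v₁) :
    (K 0 * v₁ = t ^ 2 • (v₁ * K 0) ∧ K 1 * v₁ = (t ^ 2)⁻¹ • (v₁ * K 1)) ∧
      (L 0 * v₁ = (t ^ 2)⁻¹ • (v₁ * L 0) ∧ L 1 * v₁ = t ^ 2 • (v₁ * L 1)) := by
  obtain ⟨⟨h1, h2⟩, h3, h4⟩ := h.imaginary_comm_torus ht hD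
  exact ⟨⟨torus_root_succ hc h1 h.ke00 hv₁, torus_root_succ hc h2 h.ke10 hv₁⟩,
    torus_root_succ hc h3 h.le00 hv₁, torus_root_succ hc h4 h.le10 hv₁⟩

theorem bracket_root_two_g (h : IsChevalley t E F K L) (ht : t ≠ 0) (hs : t ^ 2 - 1 ≠ 0)
    (hc : t + t⁻¹ ≠ 0)
    (hD : D = E 1 * E 0 - (t ^ 2)⁻¹ • (E 0 * E 1))
    (hG : G = F 0 * F 1 - t ^ 2 • (F 1 * F 0)) (hg : F 0 * G - G * F 0 = (t + t⁻¹) • g)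
    (hv₁ : D * E 0 - E 0 * D = (t + t⁻¹) • v₁) (hv₂ : D * v₁ - v₁ * D = (t + t⁻¹) • v₂) :
    v₂ * g - g * v₂ = D * (K 0 * (K 0 * K 1)) := by
  have hDg := h.bracket_imaginary_g ht hs hc hD hG hg
  have hvg := h.bracket_root_g ht hs hc hD hG hg hv₁
  have hvF := h.bracket_root_F0 ht hs hc hD hv₁
  obtain ⟨⟨h1, h2⟩, h3, h4⟩ := h.imaginary_comm_torus ht hD
  obtain ⟨⟨k1, k2⟩, -, -⟩ := h.torus_root ht hc hD hv₁
  refine smul_right_injective A hc ?_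
  linear_combination (norm := skip) -(hv₂ * g) + g * hv₂ + D * hvg - hvg * D + hDg * v₁ - v₁ * hDg
    + (t + t⁻¹) • (hvF * (K 0 * K 1))
  simp only [mul_sub, sub_mul, mul_smul_comm, smul_mul_assoc, mul_assoc, smul_sub, mul_neg,
    neg_mul, h1, h2, h3, h4, k1, k2, reassoc_smul k1, reassoc_mul h1, reassoc_mul h3]
  match_scalars <;> field_simp <;> ring

/-- `X` is T₁(E₁), so the expression in divided powers is T₁ applied to the formula for T₂(E₁).
Moving `L 0` to the left reduces everything to the bracket of v₁ with `F 0`, and the factors K and L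
then cancel. -/
theorem braid_root_two (h : IsChevalley t E F K L) (ht : t ≠ 0) (hs : t ^ 2 - 1 ≠ 0)
    (hc : t + t⁻¹ ≠ 0)
    (hD : D = E 1 * E 0 - (t ^ 2)⁻¹ • (E 0 * E 1))
    (hv₁ : D * E 0 - E 0 * D = (t + t⁻¹) • v₁) {X : A} (hX : X = -(L 0 * F 0)) :
    D * v₁ - v₁ * D = (t + t⁻¹) • ((t + t⁻¹)⁻¹ • (X * (v₁ * v₁)) - t⁻¹ • (v₁ * X * v₁)
      + ((t ^ 2)⁻¹ * (t + t⁻¹)⁻¹) • (v₁ * v₁ * X)) := by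
  have hvF := h.bracket_root_F0 ht hs hc hD hv₁
  obtain ⟨⟨h1, -⟩, h3, -⟩ := h.imaginary_comm_torus ht hD
  obtain ⟨⟨k1, -⟩, k3, -⟩ := h.torus_root ht hc hD hv₁
  have k3' : v₁ * L 0 = t ^ 2 • (L 0 * v₁) := by
    rw [k3, smul_smul, mul_inv_cancel₀ (pow_ne_zero _ ht), one_smul]
  have hLK : L 0 * (D * (K 0 * v₁)) - t ^ 2 • (L 0 * (v₁ * (D * K 0))) = D * v₁ - v₁ * D := by
    rw [← h1, reassoc_smul k3, ← mul_assoc (L 0) D, h3, mul_assoc D, reassoc_one h.lk0,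
      ← mul_assoc (L 0), h.lk0, one_mul, smul_smul, mul_inv_cancel₀ (pow_ne_zero _ ht), one_smul]
  have e1 : v₁ * X = -(t ^ 2 • (L 0 * (v₁ * F 0))) := by
    rw [hX, mul_neg, ← mul_assoc, k3', smul_mul_assoc, mul_assoc]
  have e2 : v₁ * v₁ * X = -(t ^ 4 • (L 0 * (v₁ * (v₁ * F 0)))) := by
    rw [mul_assoc, e1, mul_neg, mul_smul_comm, ← mul_assoc v₁, k3', smul_mul_assoc, smul_smul,
      mul_assoc]
    congr 2
    ring
  rw [e2, e1, hX]
  linear_combination (norm := skip) -hLK - L 0 * hvF * v₁ + t ^ 2 • (L 0 * v₁ * hvF)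
  have hc' : t ^ 2 + 1 ≠ 0 := fun h0 => hc (by field_simp; linear_combination h0)
  simp only [mul_sub, sub_mul, mul_smul_comm, smul_mul_assoc, mul_assoc, smul_sub, mul_neg,
    neg_mul]
  match_scalars <;> field_simp <;> ring

/-- `X` and `v₂` are the images of E₂ and E₁ under T₁T₂, so the lemma says that T₁T₂ fixes D. The
torus factor of `X` cancels the one in `bracket_root_two_g`, and moving it past `v₂` turns the
q-commutator into a commutator. -/
theorem braid_imaginary (h : IsChevalley t E F K L) (ht : t ≠ 0) (hs : t ^ 2 - 1 ≠ 0)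
    (hc : t + t⁻¹ ≠ 0)
    (hD : D = E 1 * E 0 - (t ^ 2)⁻¹ • (E 0 * E 1))
    (hG : G = F 0 * F 1 - t ^ 2 • (F 1 * F 0)) (hg : F 0 * G - G * F 0 = (t + t⁻¹) • g)
    (hv₁ : D * E 0 - E 0 * D = (t + t⁻¹) • v₁) (hv₂ : D * v₁ - v₁ * D = (t + t⁻¹) • v₂)
    {X : A} (hX : X = -(L 0 * (L 0 * (L 1 * g)))) :
    X * v₂ - (t ^ 2)⁻¹ • (v₂ * X) = D := by
  have key := h.bracket_root_two_g ht hs hc hD hG hg hv₁ hv₂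
  obtain ⟨⟨h1, h2⟩, h3, h4⟩ := h.imaginary_comm_torus ht hD
  obtain ⟨-, k3, k4⟩ := h.torus_root ht hc hD hv₁
  have m3 := torus_root_succ hc h3 k3 hv₂
  have m4 := torus_root_succ hc h4 k4 hv₂
  have hD' : L 0 * (L 0 * (L 1 * (D * (K 0 * (K 0 * K 1))))) = D := by
    rw [reassoc_mul h4, reassoc_mul h3, reassoc_mul h3, reassoc_mul h.lk, reassoc_mul h.lk,
      h.lk1, mul_one, reassoc_one h.lk0, h.lk0, mul_one]
  rw [hX]
  linear_combination (norm := skip) L 0 * (L 0 * (L 1 * key)) + hD'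
  simp only [mul_sub, sub_mul, mul_smul_comm, smul_mul_assoc, mul_assoc, smul_sub, mul_neg,
    neg_mul, reassoc_smul m3, reassoc_smul m4]
  match_scalars <;> field_simp <;> ring

end IsChevalley
end Chevalley
end KroneckerQuantum

end

section
namespace KroneckerQuantum

/-! ### The root vectors in `U_q(𝔤)` -/

def Eu (i : Fin 2) : Uq := toUq (fE i)
def Fu (i : Fin 2) : Uq := toUq (fF i)
def Ku (i : Fin 2) : Uq := toUq (fK i)
def Lu (i : Fin 2) : Uq := toUq (fKinv i)

theorem toUq_rel {x y : Free} (h : Rel x y) : toUq x = toUq y := RingQuot.mkAlgHom_rel Kq h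

theorem Ku_Lu (i : Fin 2) : Ku i * Lu i = 1 := by
  simpa [Ku, Lu] using toUq_rel (Rel.K_Kinv i)

theorem Lu_Ku (i : Fin 2) : Lu i * Ku i = 1 := by
  simpa [Ku, Lu] using toUq_rel (Rel.Kinv_K i)

theorem Ku_comm (i j : Fin 2) : Ku i * Ku j = Ku j * Ku i := by
  simpa [Ku, Lu] using toUq_rel (Rel.K_comm i j)

theorem Ku_Eu (i j : Fin 2) : Ku i * Eu j = q ^ cartan i j • (Eu j * Ku i) := by
  have h : Ku i * Eu j * Lu i = q ^ cartan i j • Eu j := by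
    simpa [Ku, Lu, Eu] using toUq_rel (Rel.K_E i j)
  rw [← smul_mul_assoc, ← h, mul_assoc _ (Lu i), Lu_Ku, mul_one]

theorem Ku_Fu (i j : Fin 2) : Ku i * Fu j = q ^ (-cartan i j) • (Fu j * Ku i) := by
  have h : Ku i * Fu j * Lu i = q ^ (-cartan i j) • Fu j := by
    simpa [Ku, Lu, Fu] using toUq_rel (Rel.K_F i j)
  rw [← smul_mul_assoc, ← h, mul_assoc _ (Lu i), Lu_Ku, mul_one]

theorem inv_move {A : Type*} [Ring A] [Algebra Kq A] {K L x : A} {n : ℤ} (hKL : K * L = 1)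
    (hLK : L * K = 1) (h : K * x = q ^ n • (x * K)) : L * x = q ^ (-n) • (x * L) := by
  have : x * L = q ^ n • (L * x) := by
    calc x * L = L * (K * x) * L := by rw [← mul_assoc, hLK, one_mul]
      _ = q ^ n • (L * x) := by
        rw [h, mul_smul_comm, smul_mul_assoc, mul_assoc, mul_assoc, hKL, mul_one]
  rw [this, smul_smul, ← zpow_add₀ q_ne_zero, neg_add_cancel, zpow_zero, one_smul]

theorem inv_comm {A : Type*} [Ring A] {K L x : A} (hKL : K * L = 1)
    (hLK : L * K = 1) (h : K * x = x * K) : L * x = x * L := by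
  calc L * x = L * (x * K) * L := by rw [mul_assoc, mul_assoc, hKL, mul_one]
    _ = x * L := by rw [← h, ← mul_assoc, hLK, one_mul]

theorem q_zpow_two : q ^ (2 : ℤ) = q ^ 2 := by norm_cast
theorem q_zpow_neg_two : q ^ (-2 : ℤ) = (q ^ 2)⁻¹ := by rw [zpow_neg, q_zpow_two]

theorem Eu_Fu (i : Fin 2) : Eu i * Fu i - Fu i * Eu i = (q - q⁻¹)⁻¹ • (Ku i - Lu i) := by
  have h := toUq_rel (Rel.E_F i i)
  rw [if_pos rfl, map_sub, map_mul, map_mul, map_smul, map_sub] at h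
  exact h

theorem Eu_Fu_of_ne {i j : Fin 2} (hij : i ≠ j) : Eu i * Fu j = Fu j * Eu i := by
  have h := toUq_rel (Rel.E_F i j)
  rw [if_neg hij, map_sub, map_mul, map_mul, map_zero] at h
  exact sub_eq_zero.mp h

theorem isChevalley : IsChevalley q Eu Fu Ku Lu where
  ke00 := by simpa [cartan, q_zpow_two, q_zpow_neg_two] using Ku_Eu 0 0
  ke01 := by simpa [cartan, q_zpow_two, q_zpow_neg_two] using Ku_Eu 0 1
  ke10 := by simpa [cartan, q_zpow_two, q_zpow_neg_two] using Ku_Eu 1 0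
  ke11 := by simpa [cartan, q_zpow_two, q_zpow_neg_two] using Ku_Eu 1 1
  kf00 := by simpa [cartan, q_zpow_two, q_zpow_neg_two] using Ku_Fu 0 0
  kf01 := by simpa [cartan, q_zpow_two, q_zpow_neg_two] using Ku_Fu 0 1
  kf10 := by simpa [cartan, q_zpow_two, q_zpow_neg_two] using Ku_Fu 1 0
  kf11 := by simpa [cartan, q_zpow_two, q_zpow_neg_two] using Ku_Fu 1 1
  le00 := by simpa [cartan, q_zpow_two, q_zpow_neg_two] using inv_move (Ku_Lu 0) (Lu_Ku 0) (Ku_Eu 0 0)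
  le01 := by simpa [cartan, q_zpow_two, q_zpow_neg_two] using inv_move (Ku_Lu 0) (Lu_Ku 0) (Ku_Eu 0 1)
  le10 := by simpa [cartan, q_zpow_two, q_zpow_neg_two] using inv_move (Ku_Lu 1) (Lu_Ku 1) (Ku_Eu 1 0)
  le11 := by simpa [cartan, q_zpow_two, q_zpow_neg_two] using inv_move (Ku_Lu 1) (Lu_Ku 1) (Ku_Eu 1 1)
  lf00 := by simpa [cartan, q_zpow_two, q_zpow_neg_two] using inv_move (Ku_Lu 0) (Lu_Ku 0) (Ku_Fu 0 0)
  lf01 := by simpa [cartan, q_zpow_two, q_zpow_neg_two] using inv_move (Ku_Lu 0) (Lu_Ku 0) (Ku_Fu 0 1)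
  lf10 := by simpa [cartan, q_zpow_two, q_zpow_neg_two] using inv_move (Ku_Lu 1) (Lu_Ku 1) (Ku_Fu 1 0)
  lf11 := by simpa [cartan, q_zpow_two, q_zpow_neg_two] using inv_move (Ku_Lu 1) (Lu_Ku 1) (Ku_Fu 1 1)
  kk := Ku_comm 1 0
  kl := (inv_comm (Ku_Lu 0) (Lu_Ku 0) (Ku_comm 0 1)).symm
  lk := inv_comm (Ku_Lu 1) (Lu_Ku 1) (Ku_comm 1 0)
  ll := inv_comm (Ku_Lu 1) (Lu_Ku 1) (inv_comm (Ku_Lu 0) (Lu_Ku 0) (Ku_comm 0 1)).symm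
  kl0 := Ku_Lu 0
  lk0 := Lu_Ku 0
  kl1 := Ku_Lu 1
  lk1 := Lu_Ku 1
  ef00 := Eu_Fu 0
  ef11 := Eu_Fu 1
  ef01 := Eu_Fu_of_ne (by decide)
  ef10 := Eu_Fu_of_ne (by decide)

theorem Eu_serre {i j : Fin 2} (hij : i ≠ j) :
    Eu i ^ 3 * Eu j - (q ^ 2 + 1 + (q ^ 2)⁻¹) • (Eu i ^ 2 * Eu j * Eu i)
      + (q ^ 2 + 1 + (q ^ 2)⁻¹) • (Eu i * Eu j * Eu i ^ 2) - Eu j * Eu i ^ 3 = 0 := by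
  have h := toUq_rel (Rel.serre_E i j hij)
  rw [serre, qInt_three] at h
  simpa only [map_sub, map_add, map_smul, map_mul, map_pow, map_zero, Eu] using h

/-- The imaginary root vector `E₂E₁ - q⁻²E₁E₂` in the free algebra. -/
def imagFree : Free := fE 1 * fE 0 - (q ^ 2)⁻¹ • (fE 0 * fE 1)

/-- The imaginary root vector `E₂E₁ - q⁻²E₁E₂`. -/
def imag : Uq := Eu 1 * Eu 0 - (q ^ 2)⁻¹ • (Eu 0 * Eu 1)

theorem toUq_imagFree : toUq imagFree = imag := by
  simp only [imagFree, map_sub, map_mul, map_smul]; rfl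

theorem divPow_zero {A : Type} [Ring A] [Algebra Kq A] (x : A) : divPow x 0 = 1 := by
  simp [divPow, qFact_zero]
theorem divPow_one {A : Type} [Ring A] [Algebra Kq A] (x : A) : divPow x 1 = x := by
  simp [divPow, qFact_one]
theorem divPow_two {A : Type} [Ring A] [Algebra Kq A] (x : A) :
    divPow x 2 = (q + q⁻¹)⁻¹ • (x * x) := by
  simp [divPow, qFact_two, pow_two]

theorem antidiagonal_sum {M : Type*} [AddCommMonoid M] (φ : ℕ × ℕ → M) :
    ∑ p ∈ Finset.HasAntidiagonal.antidiagonal (2 : ℕ), φ p = φ (0, 2) + φ (1, 1) + φ (2, 0) := by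
  have : (Finset.HasAntidiagonal.antidiagonal (2 : ℕ)) = {(0, 2), (1, 1), (2, 0)} := rfl
  rw [this, Finset.sum_insert (by decide), Finset.sum_insert (by decide), Finset.sum_singleton,
    add_assoc]

theorem braid_E_of_ne {i j : Fin 2} (hij : j ≠ i) :
    braid i (fE j) = (q + q⁻¹)⁻¹ • (fE j * (fE i * fE i)) - q⁻¹ • (fE i * fE j * fE i)
      + ((q ^ 2)⁻¹ * (q + q⁻¹)⁻¹) • (fE i * fE i * fE j) := by
  rw [braid, fE, FreeAlgebra.lift_ι_apply, braidGen, if_neg hij, antidiagonal_sum]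
  simp only [divPow_zero, divPow_one, divPow_two]
  simp [smul_smul, sub_eq_add_neg]
  rfl

theorem braid_F_of_ne {i j : Fin 2} (hij : j ≠ i) :
    braid i (fF j) = (q + q⁻¹)⁻¹ • (fF i * fF i * fF j) - q • (fF i * fF j * fF i)
      + (q ^ 2 * (q + q⁻¹)⁻¹) • (fF j * (fF i * fF i)) := by
  rw [braid, fF, FreeAlgebra.lift_ι_apply, braidGen, if_neg hij, antidiagonal_sum]
  simp only [divPow_zero, divPow_one, divPow_two]
  simp [smul_smul, sub_eq_add_neg]
  rfl

theorem braid_E_self (i : Fin 2) : braid i (fE i) = -(fKinv i * fF i) := by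
  rw [braid, fE, FreeAlgebra.lift_ι_apply, braidGen, if_pos rfl]

theorem braid_Kinv_of_ne {i j : Fin 2} (h : cartan i j = -2) :
    braid i (fKinv j) = fKinv i ^ 2 * fKinv j := by
  rw [braid, fKinv, FreeAlgebra.lift_ι_apply, braidGen, h]
  rfl

section

variable {k A : Type*} [Field k] [Ring A] [Algebra k A] {t : k} {e f D : A}

theorem bracket_eq_divPow (ht : t ≠ 0) (hc : t ^ 2 + 1 ≠ 0)
    (hD : D = f * e - (t ^ 2)⁻¹ • (e * f)) :
    D * e - e * D = (t + t⁻¹) • ((t + t⁻¹)⁻¹ • (f * (e * e)) - t⁻¹ • (e * f * e)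
      + ((t ^ 2)⁻¹ * (t + t⁻¹)⁻¹) • (e * e * f)) := by
  rw [hD]
  simp only [mul_sub, sub_mul, mul_smul_comm, smul_mul_assoc, mul_assoc]
  match_scalars <;> field_simp <;> ring

theorem bracket_eq_divPow_neg (ht : t ≠ 0) (hc : t ^ 2 + 1 ≠ 0)
    (hD : D = e * f - t ^ 2 • (f * e)) :
    e * D - D * e = (t + t⁻¹) • ((t + t⁻¹)⁻¹ • (e * e * f) - t • (e * f * e)
      + (t ^ 2 * (t + t⁻¹)⁻¹) • (f * (e * e))) := by
  rw [hD]
  simp only [mul_sub, sub_mul, mul_smul_comm, smul_mul_assoc, mul_assoc]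
  match_scalars <;> field_simp <;> ring

end

/-- This holds already in the free algebra, so `braid` can be applied to it without knowing that
`braid` respects the relations of U_q(𝔤). -/
theorem bracket_imagFree : imagFree * fE 0 - fE 0 * imagFree
    = (q + q⁻¹) • braid 0 (fE 1) := by
  rw [braid_E_of_ne (by decide)]
  exact bracket_eq_divPow q_ne_zero q_sq_add_one_ne_zero rfl

theorem v_zero : v 0 = Eu 0 := rfl
theorem v_two : v 2 = toUq (braid 0 (braid 1 (fE 0))) := rfl
theorem bracket_imag_v0 : imag * v 0 - v 0 * imag = (q + q⁻¹) • v 1 := by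
  have h := congrArg toUq bracket_imagFree
  simp only [map_sub, map_mul, map_smul, toUq_imagFree] at h
  exact h

theorem bracket_imag_v1 : imag * v 1 - v 1 * imag = (q + q⁻¹) • v 2 := by
  rw [v_two, braid_E_of_ne (by decide), map_add, map_sub, map_smul, map_smul, map_smul,
    map_add, map_sub, map_smul, map_smul, map_smul]
  simp only [map_mul, braid_E_self]
  exact isChevalley.braid_root_two q_ne_zero q_sq_sub_one_ne_zero q_add_inv_ne_zero rfl
    bracket_imag_v0 (by rw [map_neg, map_mul]; rfl)

theorem toUq_braid_imagFree : toUq (braid 0 (braid 1 imagFree)) = imag := by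
  simp only [imagFree, map_sub, map_mul, map_smul]
  rw [← v_two]
  refine isChevalley.braid_imaginary (g := toUq (braid 0 (fF 1))) q_ne_zero q_sq_sub_one_ne_zero
    q_add_inv_ne_zero rfl rfl ?_ bracket_imag_v0 bracket_imag_v1 ?_
  · rw [braid_F_of_ne (by decide)]
    simp only [map_add, map_sub, map_mul, map_smul]
    exact bracket_eq_divPow_neg q_ne_zero q_sq_add_one_ne_zero rfl
  · rw [braid_E_self, map_neg, map_mul, braid_Kinv_of_ne rfl]
    simp only [map_neg, map_mul, map_pow, pow_two, mul_assoc]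
    rfl

/-- The image of `bracket_imagFree` under T₁T₂, which fixes D. -/
theorem bracket_imag_v2 : imag * v 2 - v 2 * imag = (q + q⁻¹) • v 3 := by
  have h := congrArg (fun x => toUq (braid 0 (braid 1 x))) bracket_imagFree
  simp only [map_sub, map_mul, map_smul, toUq_braid_imagFree] at h
  exact h

/-- The relations are homogeneous when `x i` is given degree i. -/
theorem IsLadder.rescale {k A : Type*} [Field k] [Ring A] [Algebra k A] {t c : k} {x : Fin 4 → A}
    (hc : c ≠ 0) {y : Fin 4 → A} (hx : IsLadder t x) (h : ∀ i, x i = c ^ (i : ℕ) • y i) :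
    IsLadder t y := by
  have h0 : x 0 = y 0 := by simpa using h 0
  have h1 : x 1 = c • y 1 := by simpa using h 1
  have h2 : x 2 = c ^ 2 • y 2 := by simpa using h 2
  have h3 : x 3 = c ^ 3 • y 3 := by simpa using h 3
  obtain ⟨r10, r21, r32, r20, r31, r30⟩ := hx
  rw [h0, h1] at r10
  rw [h1, h2] at r21
  rw [h2, h3] at r32
  rw [h0, h1, h2] at r20
  rw [h1, h2, h3] at r31
  rw [h0, h1, h2, h3] at r30
  simp only [mul_smul_comm, smul_mul_assoc] at r10 r21 r32 r20 r31 r30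
  refine ⟨smul_right_injective A hc ?_, smul_right_injective A (pow_ne_zero 3 hc) ?_,
    smul_right_injective A (pow_ne_zero 5 hc) ?_, smul_right_injective A (pow_ne_zero 2 hc) ?_,
    smul_right_injective A (pow_ne_zero 4 hc) ?_, smul_right_injective A (pow_ne_zero 3 hc) ?_⟩
  · linear_combination (norm := module) r10
  · linear_combination (norm := module) r21
  · linear_combination (norm := module) r32
  · linear_combination (norm := module) r20
  · linear_combination (norm := module) r31
  · linear_combination (norm := module) r30

theorem bracket_smul_pow {k A : Type*} [Field k] [Ring A] [Algebra k A] {c : k} {D x y : A}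
    (h : D * x - x * D = c • y) (n : ℕ) :
    D * (c ^ n • x) - (c ^ n • x) * D = c ^ (n + 1) • y := by
  rw [mul_smul_comm, smul_mul_assoc, ← smul_sub, h, smul_smul, ← pow_succ]

/-- Scaling `v i` by [2]^i removes the factor [2] from the brackets with D, as `isLadder_of_serre`
requires. -/
theorem isLadder_v : IsLadder q v := by
  refine IsLadder.rescale (x := fun i => (q + q⁻¹) ^ (i : ℕ) • v i) q_add_inv_ne_zero ?_
    (fun _ => rfl)
  refine isLadder_of_serre (e := Eu 0) (f := Eu 1) (D := imag) q_ne_zero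
    q_four_add_sq_add_one_ne_zero q_four_add_one_ne_zero (Eu_serre (by decide))
    (Eu_serre (by decide)) rfl (by simp [v_zero]) ?_ ?_ ?_
  · simp [bracket_imag_v0]
  · have := bracket_imag_v1
    exact bracket_smul_pow this _
  · have := bracket_imag_v2
    exact bracket_smul_pow this _

theorem one_sub_q_neg_two_ne_zero : 1 - q ^ (-2 : ℤ) ≠ 0 := by
  have hq := q_ne_zero
  have : 1 - q ^ (-2 : ℤ) = (q ^ 2 - 1) * (q ^ 2)⁻¹ := by
    rw [q_zpow_neg_two]; field_simp
  rw [this]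
  exact mul_ne_zero q_sq_sub_one_ne_zero (inv_ne_zero (pow_ne_zero _ hq))

theorem coe_u (i : Fin 4) :
    (u i : Uq) = ((1 - q ^ (-2 : ℤ)) ^ (2 * (i : ℕ)))⁻¹ • v i := rfl

theorem isLadder_u : IsLadder q u := by
  have h : IsLadder q (fun i => (u i : Uq)) := by
    refine isLadder_v.rescale (c := (1 - q ^ (-2 : ℤ)) ^ 2)
      (pow_ne_zero _ one_sub_q_neg_two_ne_zero) fun i => ?_
    rw [coe_u, ← pow_mul, smul_smul,
      mul_inv_cancel₀ (pow_ne_zero _ one_sub_q_neg_two_ne_zero), one_smul]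
  exact ⟨Subtype.ext h.r10, Subtype.ext h.r21, Subtype.ext h.r32, Subtype.ext h.r20,
    Subtype.ext h.r31, Subtype.ext h.r30⟩

end KroneckerQuantum

end

section
namespace KroneckerQuantum

/-! ### A representation by difference operators -/

section Difference

variable {k L : Type*} [Field k] [Field L] [Algebra k L]

/-- The operator on functions on the lattice which translates by `s` and multiplies by `c`. -/
def hop (k : Type*) {L : Type*} [Field k] [Field L] [Algebra k L] (s : ℤ × ℤ × ℤ)
    (c : ℤ → ℤ → L) : Module.End k (ℤ × ℤ × ℤ → L) where
  toFun f p := c p.1 p.2.1 * f (p - s)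
  map_add' f g := by ext p; simp [mul_add]
  map_smul' r f := by ext p; simp

theorem hop_apply (s : ℤ × ℤ × ℤ) (c : ℤ → ℤ → L) (f : ℤ × ℤ × ℤ → L) (p : ℤ × ℤ × ℤ) :
    hop k s c f p = c p.1 p.2.1 * f (p - s) := rfl

theorem hop_mul (s s' : ℤ × ℤ × ℤ) (c c' : ℤ → ℤ → L) :
    hop k s c * hop k s' c' = hop k (s + s') (fun m n => c m n * c' (m - s.1) (n - s.2.1)) := by
  ext f p
  simp [hop_apply, Module.End.mul_apply, sub_sub, mul_assoc]

theorem hop_smul (r : k) (s : ℤ × ℤ × ℤ) (c : ℤ → ℤ → L) :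
    r • hop k s c = hop k s (fun m n => algebraMap k L r * c m n) := by
  ext f p
  simp [hop_apply, Algebra.smul_def, mul_assoc]

theorem hop_one : hop k 0 (fun _ _ => (1 : L)) = 1 := by
  ext f p
  simp [hop_apply]

/-- Two spectral coordinates, in general position. -/
structure IsSpectral (τ : L) (X Z : ℤ → L) : Prop where
  X_succ : ∀ m, X (m + 1) = τ ^ 2 * X m
  Z_succ : ∀ n, Z (n + 1) = τ ^ 2 * Z n
  X_ne : ∀ m, X m ≠ 0
  Z_ne : ∀ n, Z n ≠ 0
  X_ne_Z : ∀ m n, X m - Z n ≠ 0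

variable (k) in
/-- The current `e_j`. -/
def currentE (g : L) (X Z : ℤ → L) (j : ℕ) : Module.End k (ℤ × ℤ × ℤ → L) :=
  hop k (1, 0, (j : ℤ)) (fun m n => X (m - 1) ^ j / (X (m - 1) - Z n)) +
    hop k (0, 1, (j : ℤ)) (fun m n => -(g * Z (n - 1) ^ j / (X m - Z (n - 1))))

/-- The rational function which enters the lowering operators. -/
def hFun (τ x : L) : L := (x ^ 4 + τ ^ 4) / (τ * (τ ^ 2 - 1) ^ 2 * x)

variable (k) in
-- `E 0` is the current e₀. The third lattice coordinate counts occurrences of `E 1` minus those of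
-- `F 1`, and `g` is a free parameter to be chosen for the valuation argument.
def repE (τ g : L) (X Z : ℤ → L) : Fin 2 → Module.End k (ℤ × ℤ × ℤ → L) :=
  ![hop k (1, 0, 0) (fun m n => 1 / (X (m - 1) - Z n)) +
      hop k (0, 1, 0) (fun m n => -(g / (X m - Z (n - 1)))),
    hop k (-1, 0, 1) (fun m n => -(hFun τ (X (m + 1)) / (X (m + 1) - Z n))) +
      hop k (0, -1, 1) (fun m n => g⁻¹ * hFun τ (Z (n + 1)) / (X m - Z (n + 1)))]

variable (k) in
def repF (τ g : L) (X Z : ℤ → L) : Fin 2 → Module.End k (ℤ × ℤ × ℤ → L) :=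
  ![hop k (-1, 0, 0) (fun m n => -(hFun τ (X (m + 1)) * Z n / (X (m + 1) - Z n))) +
      hop k (0, -1, 0) (fun m n => g⁻¹ * hFun τ (Z (n + 1)) * X m / (X m - Z (n + 1))),
    hop k (1, 0, -1) (fun m n => Z n / (X (m - 1) - Z n)) +
      hop k (0, 1, -1) (fun m n => -(g * X m / (X m - Z (n - 1))))]

variable (k) in
def repK (X Z : ℤ → L) : Fin 2 → Module.End k (ℤ × ℤ × ℤ → L) :=
  ![hop k 0 (fun m n => X m * Z n), hop k 0 (fun m n => (X m * Z n)⁻¹)]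

variable (k) in
def repL (X Z : ℤ → L) : Fin 2 → Module.End k (ℤ × ℤ × ℤ → L) :=
  ![hop k 0 (fun m n => (X m * Z n)⁻¹), hop k 0 (fun m n => X m * Z n)]

variable {t : k} {τ g : L} {X Z : ℤ → L}

namespace IsSpectral

theorem X_pred (h : IsSpectral τ X Z) (hτ : τ ≠ 0) (m : ℤ) : X (m - 1) = (τ ^ 2)⁻¹ * X m := by
  have := h.X_succ (m - 1)
  rw [sub_add_cancel] at this
  rw [this, inv_mul_cancel_left₀ (pow_ne_zero _ hτ)]

theorem Z_pred (h : IsSpectral τ X Z) (hτ : τ ≠ 0) (m : ℤ) : Z (m - 1) = (τ ^ 2)⁻¹ * Z m := by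
  have := h.Z_succ (m - 1)
  rw [sub_add_cancel] at this
  rw [this, inv_mul_cancel_left₀ (pow_ne_zero _ hτ)]

theorem ne_all (h : IsSpectral τ X Z) (m n : ℤ) :
    X m ≠ 0 ∧ Z n ≠ 0 ∧ X m - Z n ≠ 0 ∧ τ ^ 2 * X m - Z n ≠ 0 ∧ X m - τ ^ 2 * Z n ≠ 0 ∧
      τ ^ 4 * X m - Z n ≠ 0 ∧ X m - τ ^ 4 * Z n ≠ 0 ∧
      X m - Z n * τ ^ 2 ≠ 0 ∧ X m - Z n * τ ^ 4 ≠ 0 := by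
  have h1 := h.X_ne_Z m n
  have h2 := h.X_ne_Z (m + 1) n
  have h3 := h.X_ne_Z m (n + 1)
  have h4 := h.X_ne_Z (m + 1 + 1) n
  have h5 := h.X_ne_Z m (n + 1 + 1)
  simp only [h.X_succ, h.Z_succ, ← mul_assoc, ← pow_add] at h2 h3 h4 h5
  exact ⟨h.X_ne m, h.Z_ne n, h1, h2, h3, h4, h5, by rwa [mul_comm], by rwa [mul_comm]⟩

/-- The mixed shifts cancel, so D acts as multiplication by a multiple of X + Z followed by a shift
in the third coordinate only. This makes the Serre relations accessible. -/
theorem imaginary_E (h : IsSpectral τ X Z) (hτ : τ ≠ 0) (hτ' : τ ^ 2 - 1 ≠ 0) (hg : g ≠ 0)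
    (ht : algebraMap k L t = τ) :
    repE k τ g X Z 1 * repE k τ g X Z 0 - (t ^ 2)⁻¹ • (repE k τ g X Z 0 * repE k τ g X Z 1)
      = hop k (0, 0, 1) (fun m n => -((τ ^ 2 + 1) / (τ * (τ ^ 2 - 1))) * (X m + Z n)) := by
  simp only [repE, Matrix.cons_val_zero, Matrix.cons_val_one, mul_add, add_mul, mul_sub, sub_mul, hop_mul, mul_neg, neg_mul,
    smul_add, smul_sub, hop_smul, map_inv₀, map_pow, ht, sub_zero, sub_neg_eq_add,
    add_sub_cancel_right, sub_add_cancel, Prod.mk_add_mk, add_zero, zero_add, neg_add_cancel,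
    add_neg_cancel]
  ext f ⟨m, n, l⟩
  simp only [hop_apply, LinearMap.add_apply, LinearMap.sub_apply, Pi.add_apply, Pi.sub_apply,
    Prod.mk_sub_mk, hFun, sub_zero, h.X_succ, h.Z_succ, h.X_pred hτ, h.Z_pred hτ]
  obtain ⟨h1, h2, h3, h4, h5, h6, h7, h8, h9⟩ := h.ne_all m n
  generalize f _ = f0
  generalize f _ = f1
  generalize f _ = f2
  generalize X m = x at *
  generalize Z n = z at *
  clear h
  field_simp
  ring

theorem imaginary_F (h : IsSpectral τ X Z) (hτ : τ ≠ 0) (hτ' : τ ^ 2 - 1 ≠ 0) (hg : g ≠ 0)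
    (ht : algebraMap k L t = τ) :
    repF k τ g X Z 1 * repF k τ g X Z 0 - (t ^ 2)⁻¹ • (repF k τ g X Z 0 * repF k τ g X Z 1)
      = hop k (0, 0, -1) (fun m n => -((τ ^ 2 + 1) / (τ * (τ ^ 2 - 1))) * ((X m)⁻¹ + (Z n)⁻¹)) := by
  simp only [repF, Matrix.cons_val_zero, Matrix.cons_val_one, mul_add, add_mul, mul_sub, sub_mul, hop_mul, mul_neg, neg_mul,
    smul_add, smul_sub, hop_smul, map_inv₀, map_pow, ht, sub_zero, sub_neg_eq_add,
    add_sub_cancel_right, sub_add_cancel, Prod.mk_add_mk, add_zero, zero_add, neg_add_cancel,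
    add_neg_cancel]
  ext f ⟨m, n, l⟩
  simp only [hop_apply, LinearMap.add_apply, LinearMap.sub_apply, Pi.add_apply, Pi.sub_apply,
    Prod.mk_sub_mk, hFun, sub_zero, h.X_succ, h.Z_succ, h.X_pred hτ, h.Z_pred hτ]
  obtain ⟨h1, h2, h3, h4, h5, h6, h7, h8, h9⟩ := h.ne_all m n
  generalize f _ = f0
  generalize f _ = f1
  generalize f _ = f2
  generalize X m = x at *
  generalize Z n = z at *
  clear h
  field_simp
  ring

set_option maxRecDepth 4000 in
-- The Serre relation in the bracket form of `serre_left_of_bracket`. With D explicit, only three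
-- lattice shifts contribute, and each gives an identity of rational functions.
theorem serre_E0 (h : IsSpectral τ X Z) (hτ : τ ≠ 0) (hτ' : τ ^ 2 - 1 ≠ 0) (hg : g ≠ 0)
    (ht : algebraMap k L t = τ) {D}
    (hD : D = hop k (0, 0, 1) (fun m n => -((τ ^ 2 + 1) / (τ * (τ ^ 2 - 1))) * (X m + Z n))) :
    (D * repE k τ g X Z 0 - repE k τ g X Z 0 * D) * repE k τ g X Z 0
      = t ^ 2 • (repE k τ g X Z 0 * (D * repE k τ g X Z 0 - repE k τ g X Z 0 * D)) := by
  simp only [hD, repE, Matrix.cons_val_zero, Matrix.cons_val_one, mul_add, add_mul, mul_sub, sub_mul, hop_mul, mul_neg, neg_mul,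
    smul_add, smul_sub, hop_smul, map_inv₀, map_pow, ht, sub_zero, sub_neg_eq_add,
    add_sub_cancel_right, sub_add_cancel, Prod.mk_add_mk, add_zero, zero_add, neg_add_cancel,
    add_neg_cancel]
  ext f ⟨m, n, l⟩
  simp only [hop_apply, LinearMap.add_apply, LinearMap.sub_apply, Pi.add_apply, Pi.sub_apply,
    Prod.mk_sub_mk, hFun, sub_zero, h.X_succ, h.Z_succ, h.X_pred hτ, h.Z_pred hτ]
  obtain ⟨h1, h2, h3, h4, h5, h6, h7, h8, h9⟩ := h.ne_all m n
  generalize f _ = f0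
  generalize f _ = f1
  generalize f _ = f2
  generalize X m = x at *
  generalize Z n = z at *
  clear h
  field_simp
  ring

set_option maxRecDepth 4000 in
theorem serre_E1 (h : IsSpectral τ X Z) (hτ : τ ≠ 0) (hτ' : τ ^ 2 - 1 ≠ 0) (hg : g ≠ 0)
    (ht : algebraMap k L t = τ) {D}
    (hD : D = hop k (0, 0, 1) (fun m n => -((τ ^ 2 + 1) / (τ * (τ ^ 2 - 1))) * (X m + Z n))) :
    repE k τ g X Z 1 * (D * repE k τ g X Z 1 - repE k τ g X Z 1 * D)
      = t ^ 2 • ((D * repE k τ g X Z 1 - repE k τ g X Z 1 * D) * repE k τ g X Z 1) := by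
  simp only [hD, repE, Matrix.cons_val_zero, Matrix.cons_val_one, mul_add, add_mul, mul_sub, sub_mul, hop_mul, mul_neg, neg_mul,
    smul_add, smul_sub, hop_smul, map_inv₀, map_pow, ht, sub_zero, sub_neg_eq_add,
    add_sub_cancel_right, sub_add_cancel, Prod.mk_add_mk, add_zero, zero_add, neg_add_cancel,
    add_neg_cancel]
  ext f ⟨m, n, l⟩
  simp only [hop_apply, LinearMap.add_apply, LinearMap.sub_apply, Pi.add_apply, Pi.sub_apply,
    Prod.mk_sub_mk, hFun, sub_zero, h.X_succ, h.Z_succ, h.X_pred hτ, h.Z_pred hτ]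
  -- The two bracketings of the shift in the third coordinate are aligned, so that equal values of f
  -- are generalized together.
  simp only [show (1 + 1 + 1 : ℤ) = 1 + (1 + 1) from rfl]
  obtain ⟨h1, h2, h3, h4, h5, h6, h7, h8, h9⟩ := h.ne_all m n
  generalize f _ = f0
  generalize f _ = f1
  generalize f _ = f2
  generalize X m = x at *
  generalize Z n = z at *
  clear h
  field_simp
  ring

set_option maxRecDepth 4000 in
theorem serre_F0 (h : IsSpectral τ X Z) (hτ : τ ≠ 0) (hτ' : τ ^ 2 - 1 ≠ 0) (hg : g ≠ 0)
    (ht : algebraMap k L t = τ) {D}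
    (hD : D = hop k (0, 0, -1) (fun m n => -((τ ^ 2 + 1) / (τ * (τ ^ 2 - 1))) * ((X m)⁻¹ + (Z n)⁻¹))) :
    (D * repF k τ g X Z 0 - repF k τ g X Z 0 * D) * repF k τ g X Z 0
      = t ^ 2 • (repF k τ g X Z 0 * (D * repF k τ g X Z 0 - repF k τ g X Z 0 * D)) := by
  simp only [hD, repF, Matrix.cons_val_zero, Matrix.cons_val_one, mul_add, add_mul, mul_sub, sub_mul, hop_mul, mul_neg, neg_mul,
    smul_add, smul_sub, hop_smul, map_inv₀, map_pow, ht, sub_zero, sub_neg_eq_add,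
    add_sub_cancel_right, sub_add_cancel, Prod.mk_add_mk, add_zero, zero_add, neg_add_cancel,
    add_neg_cancel]
  ext f ⟨m, n, l⟩
  simp only [hop_apply, LinearMap.add_apply, LinearMap.sub_apply, Pi.add_apply, Pi.sub_apply,
    Prod.mk_sub_mk, hFun, sub_zero, h.X_succ, h.Z_succ, h.X_pred hτ, h.Z_pred hτ]
  obtain ⟨h1, h2, h3, h4, h5, h6, h7, h8, h9⟩ := h.ne_all m n
  generalize f _ = f0
  generalize f _ = f1
  generalize f _ = f2
  generalize X m = x at *
  generalize Z n = z at *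
  clear h
  field_simp
  ring

set_option maxRecDepth 4000 in
theorem serre_F1 (h : IsSpectral τ X Z) (hτ : τ ≠ 0) (hτ' : τ ^ 2 - 1 ≠ 0) (hg : g ≠ 0)
    (ht : algebraMap k L t = τ) {D}
    (hD : D = hop k (0, 0, -1) (fun m n => -((τ ^ 2 + 1) / (τ * (τ ^ 2 - 1))) * ((X m)⁻¹ + (Z n)⁻¹))) :
    repF k τ g X Z 1 * (D * repF k τ g X Z 1 - repF k τ g X Z 1 * D)
      = t ^ 2 • ((D * repF k τ g X Z 1 - repF k τ g X Z 1 * D) * repF k τ g X Z 1) := by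
  simp only [hD, repF, Matrix.cons_val_zero, Matrix.cons_val_one, mul_add, add_mul, mul_sub, sub_mul, hop_mul, mul_neg, neg_mul,
    smul_add, smul_sub, hop_smul, map_inv₀, map_pow, ht, sub_zero, sub_neg_eq_add,
    add_sub_cancel_right, sub_add_cancel, Prod.mk_add_mk, add_zero, zero_add, neg_add_cancel,
    add_neg_cancel]
  ext f ⟨m, n, l⟩
  simp only [hop_apply, LinearMap.add_apply, LinearMap.sub_apply, Pi.add_apply, Pi.sub_apply,
    Prod.mk_sub_mk, hFun, sub_zero, h.X_succ, h.Z_succ, h.X_pred hτ, h.Z_pred hτ]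
  simp only [show (-1 + -1 + -1 : ℤ) = -1 + (-1 + -1) from rfl]
  obtain ⟨h1, h2, h3, h4, h5, h6, h7, h8, h9⟩ := h.ne_all m n
  generalize f _ = f0
  generalize f _ = f1
  generalize f _ = f2
  generalize X m = x at *
  generalize Z n = z at *
  clear h
  field_simp
  ring

/-- The identity is linear in `hFun`. By homogeneity in X and Z its x³ term accounts for K and its
x⁻¹ term for L. -/
theorem E_F_self_zero (h : IsSpectral τ X Z) (hτ : τ ≠ 0) (hτ' : τ ^ 2 - 1 ≠ 0) (hg : g ≠ 0)
    (ht : algebraMap k L t = τ) :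
    repE k τ g X Z 0 * repF k τ g X Z 0 - repF k τ g X Z 0 * repE k τ g X Z 0
      = (t - t⁻¹)⁻¹ • (repK k X Z 0 - repL k X Z 0) := by
  simp only [repE, repF, repK, repL, map_sub, Matrix.cons_val_zero, Matrix.cons_val_one, mul_add, add_mul, mul_sub, sub_mul, hop_mul, mul_neg, neg_mul,
    smul_add, smul_sub, hop_smul, map_inv₀, map_pow, ht, sub_zero, sub_neg_eq_add,
    add_sub_cancel_right, sub_add_cancel, Prod.mk_add_mk, add_zero, zero_add, neg_add_cancel,
    add_neg_cancel]
  ext f ⟨m, n, l⟩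
  simp only [hop_apply, LinearMap.add_apply, LinearMap.sub_apply, Pi.add_apply, Pi.sub_apply,
    Prod.mk_sub_mk, hFun, sub_zero, h.X_succ, h.Z_succ, h.X_pred hτ, h.Z_pred hτ]
  obtain ⟨h1, h2, h3, h4, h5, h6, h7, h8, h9⟩ := h.ne_all m n
  generalize f _ = f0
  generalize f _ = f1
  generalize f _ = f2
  generalize X m = x at *
  generalize Z n = z at *
  clear h
  field_simp
  ring

theorem E_F_self_one (h : IsSpectral τ X Z) (hτ : τ ≠ 0) (hτ' : τ ^ 2 - 1 ≠ 0) (hg : g ≠ 0)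
    (ht : algebraMap k L t = τ) :
    repE k τ g X Z 1 * repF k τ g X Z 1 - repF k τ g X Z 1 * repE k τ g X Z 1
      = (t - t⁻¹)⁻¹ • (repK k X Z 1 - repL k X Z 1) := by
  simp only [repE, repF, repK, repL, map_sub, Matrix.cons_val_zero, Matrix.cons_val_one, mul_add, add_mul, mul_sub, sub_mul, hop_mul, mul_neg, neg_mul,
    smul_add, smul_sub, hop_smul, map_inv₀, map_pow, ht, sub_zero, sub_neg_eq_add,
    add_sub_cancel_right, sub_add_cancel, Prod.mk_add_mk, add_zero, zero_add, neg_add_cancel,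
    add_neg_cancel]
  ext f ⟨m, n, l⟩
  simp only [hop_apply, LinearMap.add_apply, LinearMap.sub_apply, Pi.add_apply, Pi.sub_apply,
    Prod.mk_sub_mk, hFun, sub_zero, h.X_succ, h.Z_succ, h.X_pred hτ, h.Z_pred hτ]
  obtain ⟨h1, h2, h3, h4, h5, h6, h7, h8, h9⟩ := h.ne_all m n
  generalize f _ = f0
  generalize f _ = f1
  generalize f _ = f2
  generalize X m = x at *
  generalize Z n = z at *
  clear h
  field_simp
  ring

theorem E_F_zero_one (h : IsSpectral τ X Z) (hτ : τ ≠ 0) (hτ' : τ ^ 2 - 1 ≠ 0) (hg : g ≠ 0)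
    (ht : algebraMap k L t = τ) :
    repE k τ g X Z 0 * repF k τ g X Z 1 = repF k τ g X Z 1 * repE k τ g X Z 0 := by
  simp only [repE, repF, Matrix.cons_val_zero, Matrix.cons_val_one, mul_add, add_mul, mul_sub, sub_mul, hop_mul, mul_neg, neg_mul,
    smul_add, smul_sub, hop_smul, map_inv₀, map_pow, ht, sub_zero, sub_neg_eq_add,
    add_sub_cancel_right, sub_add_cancel, Prod.mk_add_mk, add_zero, zero_add, neg_add_cancel,
    add_neg_cancel]
  ext f ⟨m, n, l⟩
  simp only [hop_apply, LinearMap.add_apply, LinearMap.sub_apply, Pi.add_apply, Pi.sub_apply,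
    Prod.mk_sub_mk, hFun, sub_zero, h.X_succ, h.Z_succ, h.X_pred hτ, h.Z_pred hτ]
  obtain ⟨h1, h2, h3, h4, h5, h6, h7, h8, h9⟩ := h.ne_all m n
  generalize f _ = f0
  generalize f _ = f1
  generalize f _ = f2
  generalize X m = x at *
  generalize Z n = z at *
  clear h
  field_simp
  ring

theorem E_F_one_zero (h : IsSpectral τ X Z) (hτ : τ ≠ 0) (hτ' : τ ^ 2 - 1 ≠ 0) (hg : g ≠ 0)
    (ht : algebraMap k L t = τ) :
    repE k τ g X Z 1 * repF k τ g X Z 0 = repF k τ g X Z 0 * repE k τ g X Z 1 := by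
  simp only [repE, repF, Matrix.cons_val_zero, Matrix.cons_val_one, mul_add, add_mul, mul_sub, sub_mul, hop_mul, mul_neg, neg_mul,
    smul_add, smul_sub, hop_smul, map_inv₀, map_pow, ht, sub_zero, sub_neg_eq_add,
    add_sub_cancel_right, sub_add_cancel, Prod.mk_add_mk, add_zero, zero_add, neg_add_cancel,
    add_neg_cancel]
  ext f ⟨m, n, l⟩
  simp only [hop_apply, LinearMap.add_apply, LinearMap.sub_apply, Pi.add_apply, Pi.sub_apply,
    Prod.mk_sub_mk, hFun, sub_zero, h.X_succ, h.Z_succ, h.X_pred hτ, h.Z_pred hτ]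
  obtain ⟨h1, h2, h3, h4, h5, h6, h7, h8, h9⟩ := h.ne_all m n
  generalize f _ = f0
  generalize f _ = f1
  generalize f _ = f2
  generalize X m = x at *
  generalize Z n = z at *
  clear h
  field_simp
  ring

/-- A step in X changes X + Z by (τ² − 1)X, hence raises the exponent of X by one; likewise for Z.
The sign is the origin of the factor (−1)^j in `rep_v`. -/
theorem bracket_current (h : IsSpectral τ X Z) (hτ : τ ≠ 0)
    (ht : algebraMap k L t = τ) (hτ' : τ ^ 2 - 1 ≠ 0) (j : ℕ) {D}
    (hD : D = hop k (0, 0, 1) (fun m n => -((τ ^ 2 + 1) / (τ * (τ ^ 2 - 1))) * (X m + Z n))) :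
    D * currentE k g X Z j - currentE k g X Z j * D = (-(t + t⁻¹)) • currentE k g X Z (j + 1) := by
  simp only [hD, currentE, map_neg, map_add, Nat.cast_add, Nat.cast_one, add_comm (1 : ℤ), mul_add, add_mul, mul_sub, sub_mul, hop_mul, mul_neg, neg_mul,
    smul_add, smul_sub, hop_smul, map_inv₀, map_pow, ht, sub_zero, sub_neg_eq_add,
    add_sub_cancel_right, sub_add_cancel, Prod.mk_add_mk, add_zero, zero_add, neg_add_cancel,
    add_neg_cancel]
  ext f ⟨m, n, l⟩
  simp only [hop_apply, LinearMap.add_apply, LinearMap.sub_apply, Pi.add_apply, Pi.sub_apply,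
    Prod.mk_sub_mk, sub_zero]
  have h1 := h.X_ne_Z (m - 1) n
  have h2 := h.X_ne_Z m (n - 1)
  have hX : X m = τ ^ 2 * X (m - 1) := by rw [← h.X_succ, sub_add_cancel]
  have hZ : Z n = τ ^ 2 * Z (n - 1) := by rw [← h.Z_succ, sub_add_cancel]
  generalize f _ = f0
  generalize f _ = f1
  generalize X (m - 1) = x at *
  generalize Z (n - 1) = z at *
  rw [hZ] at h1
  rw [hX] at h2
  simp only [hX, hZ, ← neg_sub (τ ^ 2 * x) z]
  field_simp
  ring

end IsSpectral
end Difference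
end KroneckerQuantum

end

section
namespace KroneckerQuantum

/-! ### The representation of `U_q(𝔤)` -/

section Serre

variable {k A : Type*} [Field k] [Ring A] [Algebra k A] {t : k} {e f D : A}

theorem serre_left_of_bracket (ht : t ≠ 0) (hD : D = f * e - (t ^ 2)⁻¹ • (e * f))
    (h : (D * e - e * D) * e = t ^ 2 • (e * (D * e - e * D))) :
    e ^ 3 * f - (t ^ 2 + 1 + (t ^ 2)⁻¹) • (e ^ 2 * f * e)
      + (t ^ 2 + 1 + (t ^ 2)⁻¹) • (e * f * e ^ 2) - f * e ^ 3 = 0 := by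
  rw [hD] at h
  linear_combination (norm := skip) -h
  simp only [mul_sub, sub_mul, mul_smul_comm, smul_mul_assoc, mul_assoc, smul_sub, pow_succ,
    pow_zero, one_mul]
  match_scalars <;> field_simp <;> ring

theorem serre_right_of_bracket (ht : t ≠ 0) (hD : D = f * e - (t ^ 2)⁻¹ • (e * f))
    (h : f * (D * f - f * D) = t ^ 2 • ((D * f - f * D) * f)) :
    f ^ 3 * e - (t ^ 2 + 1 + (t ^ 2)⁻¹) • (f ^ 2 * e * f)
      + (t ^ 2 + 1 + (t ^ 2)⁻¹) • (f * e * f ^ 2) - e * f ^ 3 = 0 := by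
  rw [hD] at h
  linear_combination (norm := skip) -h
  simp only [mul_sub, sub_mul, mul_smul_comm, smul_mul_assoc, mul_assoc, smul_sub, pow_succ,
    pow_zero, one_mul]
  match_scalars <;> field_simp <;> ring

end Serre

namespace IsSpectral

variable {k L : Type*} [Field k] [Field L] [Algebra k L] {t : k} {τ g : L} {X Z : ℤ → L}

theorem repK_comm (i j : Fin 2) : repK k X Z i * repK k X Z j = repK k X Z j * repK k X Z i := by
  fin_cases i <;> fin_cases j <;> simp [repK, hop_mul, mul_comm]

theorem repK_repL (h : IsSpectral τ X Z) (i : Fin 2) : repK k X Z i * repL k X Z i = 1 := by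
  have hX := h.X_ne
  have hZ := h.Z_ne
  have h1 : ∀ m n, (Z n)⁻¹ * (X m)⁻¹ * (X m * Z n) = 1 := fun m n => by
    have := hX m; have := hZ n; field_simp
  have h2 : ∀ m n, X m * Z n * ((Z n)⁻¹ * (X m)⁻¹) = 1 := fun m n => by
    have := hX m; have := hZ n; field_simp
  fin_cases i <;> simp [repK, repL, hop_mul, ← hop_one, h1, h2]

theorem repL_repK (h : IsSpectral τ X Z) (i : Fin 2) : repL k X Z i * repK k X Z i = 1 := by
  have hX := h.X_ne
  have hZ := h.Z_ne
  have h1 : ∀ m n, (Z n)⁻¹ * (X m)⁻¹ * (X m * Z n) = 1 := fun m n => by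
    have := hX m; have := hZ n; field_simp
  have h2 : ∀ m n, X m * Z n * ((Z n)⁻¹ * (X m)⁻¹) = 1 := fun m n => by
    have := hX m; have := hZ n; field_simp
  fin_cases i <;> simp [repK, repL, hop_mul, ← hop_one, h1, h2]

theorem repK_conj_repE (h : IsSpectral τ X Z) (hτ : τ ≠ 0) (ht : algebraMap k L t = τ)
    (i j : Fin 2) : repK k X Z i * repE k τ g X Z j * repL k X Z i
      = (if i = j then t ^ 2 else (t ^ 2)⁻¹) • repE k τ g X Z j := by
  ext f ⟨m, n, l⟩
  have h1 := h.X_ne m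
  have h2 := h.Z_ne n
  fin_cases i <;> fin_cases j <;>
  · simp [repK, repL, repE, mul_add, add_mul, hop_mul, hop_smul, hop_apply, ht, h.X_succ, h.Z_succ,
      h.X_pred hτ, h.Z_pred hτ]
    generalize f _ = f₀
    generalize f _ = f₁
    field_simp

theorem repK_conj_repF (h : IsSpectral τ X Z) (hτ : τ ≠ 0) (ht : algebraMap k L t = τ)
    (i j : Fin 2) : repK k X Z i * repF k τ g X Z j * repL k X Z i
      = (if i = j then (t ^ 2)⁻¹ else t ^ 2) • repF k τ g X Z j := by
  ext f ⟨m, n, l⟩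
  have h1 := h.X_ne m
  have h2 := h.Z_ne n
  fin_cases i <;> fin_cases j <;>
  · simp [repK, repL, repF, mul_add, add_mul, hop_mul, hop_smul, hop_apply, ht, h.X_succ, h.Z_succ,
      h.X_pred hτ, h.Z_pred hτ]
    generalize f _ = f₀
    generalize f _ = f₁
    field_simp

end IsSpectral
end KroneckerQuantum

end

/-! ### The representation on U_q(𝔤) and the leading-term criterion -/

section
namespace KroneckerQuantum

section Lift

variable {L : Type} [Field L] [Algebra Kq L] {τ g : L} {X Z : ℤ → L}

variable (τ g X Z) in
def repGen : Gen → Module.End Kq (ℤ × ℤ × ℤ → L)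
  | Gen.E i => repE Kq τ g X Z i
  | Gen.F i => repF Kq τ g X Z i
  | Gen.K i => repK Kq X Z i
  | Gen.Kinv i => repL Kq X Z i

theorem serre_of_bracket {A : Type*} [Ring A] [Algebra Kq A] {x : Fin 2 → A} {D : A}
    (hD : D = x 1 * x 0 - (q ^ 2)⁻¹ • (x 0 * x 1))
    (h₀ : (D * x 0 - x 0 * D) * x 0 = q ^ 2 • (x 0 * (D * x 0 - x 0 * D)))
    (h₁ : x 1 * (D * x 1 - x 1 * D) = q ^ 2 • ((D * x 1 - x 1 * D) * x 1))
    {i j : Fin 2} (hij : i ≠ j) :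
    x i ^ 3 * x j - qInt 3 • (x i ^ 2 * x j * x i) + qInt 3 • (x i * x j * x i ^ 2)
      - x j * x i ^ 3 = 0 := by
  rw [qInt_three]
  fin_cases i <;> fin_cases j
  · exact absurd rfl hij
  · exact serre_left_of_bracket q_ne_zero hD h₀
  · exact serre_right_of_bracket q_ne_zero hD h₁
  · exact absurd rfl hij

theorem bracket_smul {k A : Type*} [Field k] [Ring A] [Algebra k A] {c : k} {D x y : A}
    (h : D * x - x * D = y) : D * (c • x) - (c • x) * D = c • y := by
  rw [← h, mul_smul_comm, smul_mul_assoc, smul_sub]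

theorem cartan_zpow (i j : Fin 2) : q ^ cartan i j = if i = j then q ^ 2 else (q ^ 2)⁻¹ := by
  fin_cases i <;> fin_cases j <;> simp [cartan, q_zpow_two, q_zpow_neg_two]

theorem neg_cartan_zpow (i j : Fin 2) :
    q ^ (-cartan i j) = if i = j then (q ^ 2)⁻¹ else q ^ 2 := by
  fin_cases i <;> fin_cases j <;> simp [cartan, q_zpow_two, q_zpow_neg_two]

theorem repGen_rel (h : IsSpectral τ X Z) (hτ : τ ≠ 0) (hτ' : τ ^ 2 - 1 ≠ 0) (hg : g ≠ 0)
    (ht : algebraMap Kq L q = τ) ⦃x y : Free⦄ (hxy : Rel x y) :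
    FreeAlgebra.lift Kq (repGen τ g X Z) x = FreeAlgebra.lift Kq (repGen τ g X Z) y := by
  cases hxy with
  | K_comm i j =>
    simp only [map_mul, fK, FreeAlgebra.lift_ι_apply, repGen]
    exact IsSpectral.repK_comm i j
  | K_Kinv i =>
    simp only [map_mul, map_one, fK, fKinv, FreeAlgebra.lift_ι_apply, repGen]
    exact h.repK_repL i
  | Kinv_K i =>
    simp only [map_mul, map_one, fK, fKinv, FreeAlgebra.lift_ι_apply, repGen]
    exact h.repL_repK i
  | K_E i j =>
    simp only [map_mul, map_smul, fK, fE, fKinv, FreeAlgebra.lift_ι_apply, repGen, cartan_zpow]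
    exact h.repK_conj_repE hτ ht i j
  | K_F i j =>
    simp only [map_mul, map_smul, fK, fF, fKinv, FreeAlgebra.lift_ι_apply, repGen,
      neg_cartan_zpow]
    exact h.repK_conj_repF hτ ht i j
  | E_F i j =>
    split_ifs with hij
    · subst hij
      simp only [map_mul, map_smul, map_sub, fK, fE, fF, fKinv, FreeAlgebra.lift_ι_apply, repGen]
      fin_cases i
      · exact h.E_F_self_zero hτ hτ' hg ht
      · exact h.E_F_self_one hτ hτ' hg ht
    · simp only [map_mul, map_sub, map_zero, fE, fF, FreeAlgebra.lift_ι_apply, repGen]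
      rw [sub_eq_zero]
      fin_cases i <;> fin_cases j
      · exact absurd rfl hij
      · exact h.E_F_zero_one hτ hτ' hg ht
      · exact h.E_F_one_zero hτ hτ' hg ht
      · exact absurd rfl hij
  | serre_E i j hij =>
    simp only [serre, map_mul, map_smul, map_sub, map_add, map_pow, map_zero, fE,
      FreeAlgebra.lift_ι_apply, repGen]
    have hD := h.imaginary_E hτ hτ' hg ht
    exact serre_of_bracket (x := repE Kq τ g X Z) rfl (h.serre_E0 hτ hτ' hg ht hD)
      (h.serre_E1 hτ hτ' hg ht hD) hij
  | serre_F i j hij =>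
    simp only [serre, map_mul, map_smul, map_sub, map_add, map_pow, map_zero, fF,
      FreeAlgebra.lift_ι_apply, repGen]
    have hD := h.imaginary_F hτ hτ' hg ht
    exact serre_of_bracket (x := repF Kq τ g X Z) rfl (h.serre_F0 hτ hτ' hg ht hD)
      (h.serre_F1 hτ hτ' hg ht hD) hij

/-- The representation of `U_q(𝔤)` by difference operators. -/
def rep (h : IsSpectral τ X Z) (hτ : τ ≠ 0) (hτ' : τ ^ 2 - 1 ≠ 0) (hg : g ≠ 0)
    (ht : algebraMap Kq L q = τ) : Uq →ₐ[Kq] Module.End Kq (ℤ × ℤ × ℤ → L) :=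
  RingQuot.liftAlgHom Kq ⟨FreeAlgebra.lift Kq (repGen τ g X Z), repGen_rel h hτ hτ' hg ht⟩

theorem rep_Eu (h : IsSpectral τ X Z) (hτ : τ ≠ 0) (hτ' : τ ^ 2 - 1 ≠ 0) (hg : g ≠ 0)
    (ht : algebraMap Kq L q = τ) (i : Fin 2) :
    rep h hτ hτ' hg ht (Eu i) = repE Kq τ g X Z i := by
  rw [Eu, toUq, rep, RingQuot.liftAlgHom_mkAlgHom_apply, fE, FreeAlgebra.lift_ι_apply, repGen]

theorem rep_v (h : IsSpectral τ X Z) (hτ : τ ≠ 0) (hτ' : τ ^ 2 - 1 ≠ 0) (hg : g ≠ 0)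
    (ht : algebraMap Kq L q = τ) (j : Fin 4) :
    rep h hτ hτ' hg ht (v j) = (-1 : Kq) ^ (j : ℕ) • currentE Kq g X Z j := by
  set φ := rep h hτ hτ' hg ht
  have hD : φ imag = hop Kq (0, 0, 1)
      (fun m n => -((τ ^ 2 + 1) / (τ * (τ ^ 2 - 1))) * (X m + Z n)) := by
    rw [← h.imaginary_E hτ hτ' hg ht, imag, map_sub, map_smul, map_mul, map_mul, rep_Eu, rep_Eu]
  have step : ∀ (a b : Uq) (j : ℕ), imag * a - a * imag = (q + q⁻¹) • b →
      φ a = (-1 : Kq) ^ j • currentE Kq g X Z j →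
      φ b = (-1 : Kq) ^ (j + 1) • currentE Kq g X Z (j + 1) := by
    intro a b j hab ha
    have h2 := congrArg φ hab
    rw [map_sub, map_mul, map_mul, map_smul, ha] at h2
    have h4 := bracket_smul (c := (-1 : Kq) ^ j) (h.bracket_current (g := g) hτ ht hτ' j hD)
    have h3 : (q + q⁻¹) • φ b = (q + q⁻¹) • ((-1 : Kq) ^ (j + 1) • currentE Kq g X Z (j + 1)) := by
      refine h2.symm.trans (h4.trans ?_)
      rw [smul_smul, smul_smul]
      congr 1
      ring
    exact smul_right_injective _ q_add_inv_ne_zero h3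
  have h0 : φ (v 0) = (-1 : Kq) ^ 0 • currentE Kq g X Z 0 := by
    rw [v_zero, rep_Eu, pow_zero, one_smul]
    simp [repE, currentE]
  have h1 := step _ _ 0 bracket_imag_v0 h0
  have h2 := step _ _ 1 bracket_imag_v1 h1
  have h3 := step _ _ 2 bracket_imag_v2 h2
  fin_cases j
  exacts [h0, h1, h2, h3]

end Lift

/-! ### Leading terms -/

section Leading

variable {k L Γ : Type*} [Field k] [Field L] [Algebra k L] [LinearOrderedCommGroupWithZero Γ]

/-- The function `φ` attains its largest valuation `d` at the point `p` and only there. -/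
def Leading (w : Valuation L Γ) (φ : ℤ × ℤ × ℤ → L) (p : ℤ × ℤ × ℤ) (d : Γ) : Prop :=
  w (φ p) = d ∧ ∀ p', p' ≠ p → w (φ p') < d

variable {w : Valuation L Γ} {φ : ℤ × ℤ × ℤ → L} {p : ℤ × ℤ × ℤ} {d : Γ}

theorem Leading.le (h : Leading w φ p d) (p' : ℤ × ℤ × ℤ) : w (φ p') ≤ d := by
  by_cases hp : p' = p
  · rw [hp, h.1]
  · exact (h.2 p' hp).le

/-- The coefficients have constant valuation, so the dominant hop translates the unique maximum and
the other one stays below it everywhere. -/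
theorem Leading.add_hop (h : Leading w φ p d) (hd : d ≠ 0) {s s' : ℤ × ℤ × ℤ} {c c' : ℤ → ℤ → L}
    {γ γ' : Γ} (hc : ∀ m n, w (c m n) = γ) (hc' : ∀ m n, w (c' m n) = γ') (hγ : γ' < γ) :
    Leading w ((hop k s c + hop k s' c') φ) (p + s) (γ * d) := by
  have hd' : 0 < d := zero_lt_iff.mpr hd
  have hγ0 : 0 < γ := lt_of_le_of_lt zero_le hγ
  have hlow : ∀ p', w (hop k s' c' φ p') < γ * d := fun p' => by
    rw [hop_apply, map_mul, hc']
    exact lt_of_le_of_lt (mul_le_mul_right (h.le _) _) (mul_lt_mul_of_pos_right hγ hd')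
  constructor
  · have h1 : w (hop k s c φ (p + s)) = γ * d := by
      rw [hop_apply, map_mul, hc, add_sub_cancel_right, h.1]
    rw [LinearMap.add_apply, Pi.add_apply, Valuation.map_add_eq_of_lt_left, h1]
    rw [h1]
    exact hlow _
  · intro p' hp'
    refine lt_of_le_of_lt (w.map_add _ _) (max_lt ?_ (hlow p'))
    rw [hop_apply, map_mul, hc]
    refine mul_lt_mul_of_pos_left (h.2 _ ?_) hγ0
    rintro rfl
    exact hp' (sub_add_cancel _ _).symm

theorem Leading.smul (h : Leading w φ p d) {r : k} (hr : w (algebraMap k L r) = 1) :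
    Leading w (r • φ) p d := by
  constructor
  · rw [Pi.smul_apply, Algebra.smul_def, map_mul, hr, one_mul, h.1]
  · intro p' hp'
    rw [Pi.smul_apply, Algebra.smul_def, map_mul, hr, one_mul]
    exact h.2 p' hp'

/-- In a vanishing combination, take an index with maximal `d` among the nonzero coefficients and
evaluate at its leading point. All other terms are strictly smaller there, because nonzero scalars
have valuation 1. -/
theorem linearIndependent_of_leading {ι : Type*} {φ : ι → ℤ × ℤ × ℤ → L} {p : ι → ℤ × ℤ × ℤ}
    {d : ι → Γ} (hd : ∀ i, d i ≠ 0) (h : ∀ i, Leading w (φ i) (p i) (d i))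
    (hpd : ∀ i j, p i = p j → d i = d j → i = j)
    (hw : ∀ r : k, r ≠ 0 → w (algebraMap k L r) = 1) : LinearIndependent k φ := by
  classical
  rw [linearIndependent_iff']
  intro s r hs
  by_contra! hne
  obtain ⟨i, hi, hri⟩ := hne
  obtain ⟨j, hj, hmax⟩ := (s.filter (fun i => r i ≠ 0)).exists_max_image d
    ⟨i, Finset.mem_filter.mpr ⟨hi, hri⟩⟩
  obtain ⟨hjs, hrj⟩ := Finset.mem_filter.mp hj
  have h0 := congrFun hs (p j)
  rw [Finset.sum_apply, ← Finset.add_sum_erase _ _ hjs, Pi.zero_apply] at h0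
  have h1 : w (∑ i ∈ s.erase j, (r i • φ i) (p j)) < d j := by
    refine w.map_sum_lt (hd j) fun i hi => ?_
    obtain ⟨hij, his⟩ := Finset.mem_erase.mp hi
    by_cases hr : r i = 0
    · rw [hr, zero_smul, Pi.zero_apply, map_zero]
      exact zero_lt_iff.mpr (hd j)
    · have hle := hmax i (Finset.mem_filter.mpr ⟨his, hr⟩)
      rw [Pi.smul_apply, Algebra.smul_def, map_mul, hw _ hr, one_mul]
      by_cases hp : p j = p i
      · refine lt_of_le_of_ne ((h i).le _ |>.trans hle) fun he => hij ?_
        refine hpd i j hp.symm (le_antisymm hle ?_)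
        rw [← he]
        exact (h i).le _
      · exact lt_of_lt_of_le ((h i).2 _ hp) hle
  have h2 : w ((r j • φ j) (p j)) = d j := by
    rw [Pi.smul_apply, Algebra.smul_def, map_mul, hw _ hrj, one_mul, (h j).1]
  rw [eq_neg_of_add_eq_zero_left h0, Valuation.map_neg] at h2
  exact h1.ne h2

end Leading

end KroneckerQuantum

end

section
namespace KroneckerQuantum

/-! ### Linear independence of the ordered monomials -/

/-- The image of the deformation parameter in `ℚ(q)(Y)`. -/
def qY : RatFunc Kq := algebraMap Kq (RatFunc Kq) q

theorem qY_eq : algebraMap Kq (RatFunc Kq) q = qY := rfl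

/-- Write Y for the variable. With X of degree 2, Z of degree 0 and g = Y³, the two summands of the
current e_j have degrees 2j − 2 and 1. The second dominates for j ≤ 1 and the first for j ≥ 2, never
with a tie. -/
def spectralX (m : ℤ) : RatFunc Kq := RatFunc.X ^ 2 * qY ^ (2 * m)

def spectralZ (n : ℤ) : RatFunc Kq := qY ^ (2 * n)

open Classical in
/-- The degree valuation of `ℚ(q)(Y)`. -/
def degY : Valuation (RatFunc Kq) (WithZero (Multiplicative ℤ)) :=
  RatFunc.inftyValuation Kq

theorem degY_algebraMap {r : Kq} (hr : r ≠ 0) : degY (algebraMap Kq (RatFunc Kq) r) = 1 := by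
  classical
  rw [RatFunc.algebraMap_eq_C]
  exact RatFunc.inftyValuation.C Kq hr

theorem one_lt_degY_X : 1 < degY RatFunc.X := by
  classical
  have : degY RatFunc.X = WithZero.exp 1 := RatFunc.inftyValuation.X Kq
  rw [this, ← WithZero.exp_zero, WithZero.exp_lt_exp]
  exact one_pos

theorem qY_ne_zero : qY ≠ 0 := by
  rw [qY, Ne, map_eq_zero]
  exact q_ne_zero

theorem degY_qY_zpow (n : ℤ) : degY (qY ^ n) = 1 := by
  rw [map_zpow₀, qY, degY_algebraMap q_ne_zero, one_zpow]

theorem degY_spectralX (m : ℤ) : degY (spectralX m) = degY RatFunc.X ^ 2 := by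
  rw [spectralX, map_mul, map_pow, degY_qY_zpow, mul_one]

theorem degY_spectralZ (n : ℤ) : degY (spectralZ n) = 1 := degY_qY_zpow _

theorem degY_sub (m n : ℤ) : degY (spectralX m - spectralZ n) = degY RatFunc.X ^ 2 := by
  rw [Valuation.map_sub_eq_of_lt_left, degY_spectralX]
  rw [degY_spectralX, degY_spectralZ]
  exact one_lt_pow₀ one_lt_degY_X two_ne_zero

theorem degY_X_ne_zero : degY RatFunc.X ≠ 0 := (zero_lt_one.trans one_lt_degY_X).ne'

theorem isSpectral : IsSpectral qY spectralX spectralZ where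
  X_succ m := by
    rw [spectralX, spectralX, mul_add, zpow_add₀ qY_ne_zero, mul_one, ← zpow_natCast qY]
    push_cast
    ring
  Z_succ m := by
    rw [spectralZ, spectralZ, mul_add, zpow_add₀ qY_ne_zero, mul_one, ← zpow_natCast qY]
    push_cast
    ring
  X_ne m := mul_ne_zero (pow_ne_zero _ RatFunc.X_ne_zero) (zpow_ne_zero _ qY_ne_zero)
  Z_ne n := zpow_ne_zero _ qY_ne_zero
  X_ne_Z m n h := by
    have := degY_sub m n
    rw [h, map_zero] at this
    exact pow_ne_zero 2 degY_X_ne_zero this.symm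

theorem qY_sq_sub_one_ne_zero : qY ^ 2 - 1 ≠ 0 := by
  rw [qY, ← map_pow, ← map_one (algebraMap Kq (RatFunc Kq)), ← map_sub, Ne, map_eq_zero]
  exact q_sq_sub_one_ne_zero

/-- The representation of `U_q(𝔤)` by difference operators over `ℚ(q)(Y)`. -/
def repY : Uq →ₐ[Kq] Module.End Kq (ℤ × ℤ × ℤ → RatFunc Kq) :=
  rep (g := RatFunc.X ^ 3) isSpectral qY_ne_zero qY_sq_sub_one_ne_zero
    (pow_ne_zero 3 RatFunc.X_ne_zero) qY_eq

abbrev currentY (j : ℕ) : Module.End Kq (ℤ × ℤ × ℤ → RatFunc Kq) :=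
  currentE Kq (RatFunc.X ^ 3) spectralX spectralZ j

theorem repY_u (j : Fin 4) : ∃ c : Kq, c ≠ 0 ∧ repY (u j) = c • currentY j := by
  refine ⟨((1 - q ^ (-2 : ℤ)) ^ (2 * (j : ℕ)))⁻¹ * (-1) ^ (j : ℕ), ?_, ?_⟩
  · exact mul_ne_zero (inv_ne_zero (pow_ne_zero _ one_sub_q_neg_two_ne_zero))
      (pow_ne_zero _ (neg_ne_zero.mpr one_ne_zero))
  · rw [coe_u, map_smul, repY, rep_v, smul_smul]

variable {φ : ℤ × ℤ × ℤ → RatFunc Kq} {p : ℤ × ℤ × ℤ} {d : WithZero (Multiplicative ℤ)}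

theorem degY_coeff_X (j : ℕ) (m n : ℤ) :
    degY (spectralX (m - 1) ^ j / (spectralX (m - 1) - spectralZ n))
      = degY RatFunc.X ^ (2 * j) / degY RatFunc.X ^ 2 := by
  rw [map_div₀, map_pow, degY_sub, degY_spectralX, pow_mul]

theorem degY_coeff_Z (j : ℕ) (m n : ℤ) :
    degY (-(RatFunc.X ^ 3 * spectralZ (n - 1) ^ j / (spectralX m - spectralZ (n - 1))))
      = degY RatFunc.X := by
  rw [Valuation.map_neg, map_div₀, map_mul, map_pow, map_pow, degY_sub, degY_spectralZ, one_pow,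
    mul_one, pow_succ', mul_div_assoc, div_self (pow_ne_zero _ degY_X_ne_zero), mul_one]

theorem leading_low {j : ℕ} (hj : j ≤ 1) (h : Leading degY φ p d) (hd : d ≠ 0) :
    Leading degY (currentY j φ) (p + (0, 1, (j : ℤ))) (degY RatFunc.X * d) := by
  rw [currentY, currentE, add_comm (hop Kq _ _)]
  refine h.add_hop hd (degY_coeff_Z j) (degY_coeff_X j) ?_
  rw [div_lt_iff₀ (pow_pos (zero_lt_iff.mpr degY_X_ne_zero) _), ← pow_succ']
  exact pow_lt_pow_right₀ one_lt_degY_X (by omega)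

theorem leading_high {j : ℕ} (hj : 2 ≤ j) (h : Leading degY φ p d) (hd : d ≠ 0) :
    Leading degY (currentY j φ) (p + (1, 0, (j : ℤ)))
      (degY RatFunc.X ^ (2 * j - 2) * d) := by
  have h2 : degY RatFunc.X ^ (2 * j) / degY RatFunc.X ^ 2 = degY RatFunc.X ^ (2 * j - 2) := by
    rw [div_eq_iff (pow_ne_zero _ degY_X_ne_zero), ← pow_add]
    congr 1
    omega
  rw [currentY, currentE]
  refine h.add_hop hd (fun m n => (degY_coeff_X j m n).trans h2) (degY_coeff_Z j) ?_
  exact lt_self_pow₀ one_lt_degY_X (by omega)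

theorem leading_pow {T : Module.End Kq (ℤ × ℤ × ℤ → RatFunc Kq)} {s : ℤ × ℤ × ℤ}
    {r : ℕ}
    (hT : ∀ {φ p d}, Leading degY φ p d → d ≠ 0 →
      Leading degY (T φ) (p + s) (degY RatFunc.X ^ r * d))
    {e : ℕ} (h : Leading degY φ p (degY RatFunc.X ^ e)) (n : ℕ) :
    Leading degY ((T ^ n) φ) (p + n • s) (degY RatFunc.X ^ (r * n + e)) := by
  induction n with
  | zero => simpa using h
  | succ n ih =>
    have := hT ih (pow_ne_zero _ degY_X_ne_zero)
    rw [← pow_add] at this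
    rw [pow_succ', Module.End.mul_apply, succ_nsmul, ← add_assoc, mul_add, mul_one,
      add_comm (r * n) r, add_assoc r]
    exact this

/-- The ordered monomial `x₃^{a₃} x₂^{a₂} x₁^{a₁} x₀^{a₀}`. -/
def mono {A : Type*} [Ring A] (x : Fin 4 → A) (a : Idx) : A :=
  x 3 ^ a.1 * x 2 ^ a.2.1 * x 1 ^ a.2.2.1 * x 0 ^ a.2.2.2

theorem leading_currentY (a : Idx) :
    Leading degY ((currentY 3 ^ a.1 * currentY 2 ^ a.2.1 * currentY 1 ^ a.2.2.1 *
      currentY 0 ^ a.2.2.2) (Pi.single 0 1))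
      ((a.1 : ℤ) + a.2.1, (a.2.2.1 : ℤ) + a.2.2.2, 3 * (a.1 : ℤ) + 2 * a.2.1 + a.2.2.1)
      (degY RatFunc.X ^ (4 * a.1 + 2 * a.2.1 + a.2.2.1 + a.2.2.2)) := by
  have h : Leading degY (Pi.single 0 1) 0 (degY RatFunc.X ^ 0) := by
    refine ⟨by simp, fun p' hp' => ?_⟩
    rw [Pi.single_eq_of_ne hp', map_zero, pow_zero]
    exact zero_lt_one
  have h0 := leading_pow (r := 1) (fun h hd => by
    rw [pow_one]; exact leading_low (j := 0) (by omega) h hd) h a.2.2.2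
  have h1 := leading_pow (r := 1) (fun h hd => by
    rw [pow_one]; exact leading_low (j := 1) (by omega) h hd) h0 a.2.2.1
  have h2 := leading_pow (r := 2) (fun h hd => leading_high (j := 2) (by omega) h hd) h1 a.2.1
  have h3 := leading_pow (r := 4) (fun h hd => leading_high (j := 3) (by omega) h hd) h2 a.1
  simp only [Module.End.mul_apply]
  convert h3 using 1
  · simp
    refine ⟨by ring, by ring, by ring⟩
  · congr 1
    ring

theorem repY_mono (a : Idx) : ∃ c : Kq, c ≠ 0 ∧ repY (mono u a : Uplus) = c •
    (currentY 3 ^ a.1 * currentY 2 ^ a.2.1 * currentY 1 ^ a.2.2.1 * currentY 0 ^ a.2.2.2) := by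
  obtain ⟨c0, hc0, h0⟩ := repY_u 0
  obtain ⟨c1, hc1, h1⟩ := repY_u 1
  obtain ⟨c2, hc2, h2⟩ := repY_u 2
  obtain ⟨c3, hc3, h3⟩ := repY_u 3
  refine ⟨c3 ^ a.1 * c2 ^ a.2.1 * c1 ^ a.2.2.1 * c0 ^ a.2.2.2, ?_, ?_⟩
  · positivity
  · rw [mono]
    push_cast
    rw [map_mul, map_mul, map_mul, map_pow, map_pow, map_pow, map_pow, h0, h1, h2, h3, smul_pow,
      smul_pow, smul_pow, smul_pow, smul_mul_smul_comm, smul_mul_smul_comm, smul_mul_smul_comm]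
    rfl

/-- The monomials act on the delta function at the origin. The leading point and the leading degree
together determine the exponents. -/
theorem linearIndependent_mono : LinearIndependent Kq (mono u) := by
  let ψ : Uplus →ₗ[Kq] (ℤ × ℤ × ℤ → RatFunc Kq) :=
    (LinearMap.applyₗ (Pi.single 0 1)).comp (repY.toLinearMap.comp Uplus.val.toLinearMap)
  refine LinearIndependent.of_comp ψ ?_
  refine linearIndependent_of_leading (w := degY)
    (p := fun a : Idx => ((a.1 : ℤ) + a.2.1, (a.2.2.1 : ℤ) + a.2.2.2,
      3 * (a.1 : ℤ) + 2 * a.2.1 + a.2.2.1))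
    (d := fun a : Idx => degY RatFunc.X ^ (4 * a.1 + 2 * a.2.1 + a.2.2.1 + a.2.2.2))
    (fun a => pow_ne_zero _ degY_X_ne_zero) ?_ ?_ (fun r hr => degY_algebraMap hr)
  · intro a
    obtain ⟨c, hc, h⟩ := repY_mono a
    have : (ψ ∘ mono u) a = c • ((currentY 3 ^ a.1 * currentY 2 ^ a.2.1 * currentY 1 ^ a.2.2.1 *
      currentY 0 ^ a.2.2.2) (Pi.single 0 1)) := congrArg (fun T => T (Pi.single 0 1)) h
    rw [this]
    exact (leading_currentY a).smul (degY_algebraMap hc)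
  -- The degree minus the second coordinate minus twice the first coordinate equals 2a₃; the point
  -- then gives a₂, a₁ and a₀.
  · rintro ⟨a3, a2, a1, a0⟩ ⟨b3, b2, b1, b0⟩ hp hd
    have hd' := (pow_right_injective₀ (zero_lt_one.trans one_lt_degY_X) one_lt_degY_X.ne') hd
    simp only [Prod.mk.injEq] at hp ⊢
    dsimp only at hd'
    omega

end KroneckerQuantum

end

section
namespace KroneckerQuantum

/-! ### The anti-automorphism `σ` -/

/-- The opposite algebra of `U_q(𝔤)`, on which scalars act through the bar involution. -/
def Twist : Type := Uqᵐᵒᵖ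

instance : Ring Twist := inferInstanceAs (Ring Uqᵐᵒᵖ)

instance : Algebra Kq Twist :=
  RingHom.toAlgebra' (((algebraMap Kq Uqᵐᵒᵖ).comp bar : Kq →+* Uqᵐᵒᵖ) : Kq →+* Twist)
    (fun c x => Algebra.commutes (A := Uqᵐᵒᵖ) (bar c) x)

def tw (x : Uq) : Twist := MulOpposite.op x

theorem tw_mul (x y : Uq) : tw x * tw y = tw (y * x) := rfl
theorem tw_sub (x y : Uq) : tw x - tw y = tw (x - y) := rfl
theorem tw_add (x y : Uq) : tw x + tw y = tw (x + y) := rfl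
theorem tw_zero : (0 : Twist) = tw 0 := rfl

theorem smul_tw (c : Kq) (x : Uq) : c • tw x = tw (bar c • x) := by
  rw [Algebra.smul_def, Algebra.smul_def (bar c), Algebra.commutes (bar c) x]
  rfl

theorem tw_pow (x : Uq) (n : ℕ) : tw x ^ n = tw (x ^ n) := rfl

/-- The scalars by which `σ` rescales the generators `E_i`. -/
def sigmaScalar : Fin 2 → Kq := ![1, q ^ 4]

theorem sigmaScalar_ne_zero (i : Fin 2) : sigmaScalar i ≠ 0 := by
  fin_cases i
  · exact one_ne_zero
  · exact pow_ne_zero 4 q_ne_zero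

/-- The K's are fixed: passing to the opposite algebra inverts conjugation, which matches q ↦ q⁻¹.
The F's are rescaled inversely to the E's, and in the commutator relation the sign from reversal
matches the sign of the bar of q − q⁻¹. -/
def sigmaGen : Gen → Twist
  | Gen.E i => tw (sigmaScalar i • Eu i)
  | Gen.F i => tw ((sigmaScalar i)⁻¹ • Fu i)
  | Gen.K i => tw (Ku i)
  | Gen.Kinv i => tw (Lu i)

theorem Lu_conj {x : Uq} {i : Fin 2} {n : ℤ} (h : Ku i * x = q ^ n • (x * Ku i)) :
    Lu i * (x * Ku i) = q ^ (-n) • x := by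
  rw [← mul_assoc, inv_move (Ku_Lu i) (Lu_Ku i) h, smul_mul_assoc, mul_assoc, Lu_Ku, mul_one]

theorem bar_qInt (n : ℤ) : bar (qInt n) = qInt n := by
  have h := q_sub_inv_ne_zero
  have h' : q⁻¹ - q ≠ 0 := by rw [← neg_sub]; exact neg_ne_zero.mpr h
  rw [qInt, map_div₀, map_sub, map_sub, bar_zpow, bar_zpow, map_inv₀, bar_q, inv_inv, neg_neg,
    div_eq_div_iff h' h]
  ring

theorem serre_smul {k A : Type*} [Field k] [Ring A] [Algebra k A] {c d r : k} {x y : A}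
    (h : x ^ 3 * y - r • (x ^ 2 * y * x) + r • (x * y * x ^ 2) - y * x ^ 3 = 0) :
    (d • y) * (c • x) ^ 3 - r • ((c • x) * ((d • y) * (c • x) ^ 2))
      + r • ((c • x) ^ 2 * ((d • y) * (c • x))) - (c • x) ^ 3 * (d • y) = 0 := by
  linear_combination (norm := skip) (-(c ^ 3 * d)) • h
  simp only [smul_pow, mul_smul_comm, smul_mul_assoc, mul_assoc, smul_sub, smul_add, smul_smul]
  match_scalars <;> ring

theorem Fu_serre {i j : Fin 2} (hij : i ≠ j) :
    Fu i ^ 3 * Fu j - qInt 3 • (Fu i ^ 2 * Fu j * Fu i)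
      + qInt 3 • (Fu i * Fu j * Fu i ^ 2) - Fu j * Fu i ^ 3 = 0 := by
  have h := toUq_rel (Rel.serre_F i j hij)
  rw [serre] at h
  simpa only [map_sub, map_add, map_smul, map_mul, map_pow, map_zero, Fu] using h

theorem smul_bracket_inv {k A : Type*} [Field k] [Ring A] [Algebra k A] {c r : k} {x y z : A}
    (hc : c ≠ 0) (h : x * y - y * x = r • z) :
    (c⁻¹ • y) * (c • x) - (c • x) * (c⁻¹ • y) = (-r) • z := by
  rw [neg_smul, ← h, smul_mul_smul_comm, smul_mul_smul_comm, inv_mul_cancel₀ hc,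
    mul_inv_cancel₀ hc, one_smul, one_smul, neg_sub]

theorem sigmaGen_rel ⦃x y : Free⦄ (hxy : Rel x y) :
    FreeAlgebra.lift Kq sigmaGen x = FreeAlgebra.lift Kq sigmaGen y := by
  cases hxy with
  | K_comm i j =>
    simp only [map_mul, fK, FreeAlgebra.lift_ι_apply, sigmaGen, tw_mul, Ku_comm j i]
  | K_Kinv i =>
    simp only [map_mul, map_one, fK, fKinv, FreeAlgebra.lift_ι_apply, sigmaGen, tw_mul, Lu_Ku]
    rfl
  | Kinv_K i =>
    simp only [map_mul, map_one, fK, fKinv, FreeAlgebra.lift_ι_apply, sigmaGen, tw_mul, Ku_Lu]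
    rfl
  | K_E i j =>
    simp only [map_mul, map_smul, fK, fE, fKinv, FreeAlgebra.lift_ι_apply, sigmaGen, tw_mul,
      smul_tw, bar_zpow]
    rw [smul_mul_assoc, mul_smul_comm, Lu_conj (Ku_Eu i j), smul_comm]
  | K_F i j =>
    simp only [map_mul, map_smul, fK, fF, fKinv, FreeAlgebra.lift_ι_apply, sigmaGen, tw_mul,
      smul_tw, bar_zpow]
    rw [smul_mul_assoc, mul_smul_comm, Lu_conj (Ku_Fu i j), smul_comm]
  | E_F i j =>
    split_ifs with hij
    · subst hij
      simp only [map_mul, map_smul, map_sub, fK, fE, fF, fKinv, FreeAlgebra.lift_ι_apply,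
        sigmaGen, tw_mul, tw_sub, smul_tw]
      rw [smul_bracket_inv (sigmaScalar_ne_zero i) (Eu_Fu i)]
      congr 2
      rw [map_inv₀, map_sub, map_inv₀, bar_q, inv_inv, ← neg_sub q, inv_neg]
    · simp only [map_mul, map_sub, map_zero, fE, fF, FreeAlgebra.lift_ι_apply, sigmaGen, tw_mul,
        tw_sub, tw_zero]
      rw [smul_mul_smul_comm, smul_mul_smul_comm, Eu_Fu_of_ne hij, mul_comm (sigmaScalar i),
        sub_self]
  | serre_E i j hij =>
    have h := toUq_rel (Rel.serre_E i j hij)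
    simp only [serre, map_mul, map_smul, map_sub, map_add, map_pow, map_zero] at h
    simp only [serre, map_mul, map_smul, map_sub, map_add, map_pow, map_zero, fE,
      FreeAlgebra.lift_ι_apply, sigmaGen, tw_mul, tw_pow, tw_sub, tw_add, smul_tw, bar_qInt,
      tw_zero]
    exact congrArg tw (serre_smul h)
  | serre_F i j hij =>
    simp only [serre, map_mul, map_smul, map_sub, map_add, map_pow, map_zero, fF,
      FreeAlgebra.lift_ι_apply, sigmaGen, tw_mul, tw_pow, tw_sub, tw_add, smul_tw, bar_qInt,
      tw_zero]
    exact congrArg tw (serre_smul (Fu_serre hij))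

def sigmaTwist : Uq →ₐ[Kq] Twist :=
  RingQuot.liftAlgHom Kq ⟨FreeAlgebra.lift Kq sigmaGen, sigmaGen_rel⟩

/-- `σ` on `U_q(𝔤)`, as a map. -/
def sigmaFun (x : Uq) : Uq := MulOpposite.unop (sigmaTwist x : Uqᵐᵒᵖ)

theorem tw_sigmaFun (x : Uq) : tw (sigmaFun x) = sigmaTwist x := rfl

theorem tw_injective : Function.Injective tw := MulOpposite.op_injective

theorem sigmaFun_mul (x y : Uq) : sigmaFun (x * y) = sigmaFun y * sigmaFun x :=
  tw_injective (by rw [tw_sigmaFun, map_mul, ← tw_sigmaFun, ← tw_sigmaFun, tw_mul])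

theorem sigmaFun_add (x y : Uq) : sigmaFun (x + y) = sigmaFun x + sigmaFun y :=
  tw_injective (by rw [tw_sigmaFun, map_add]; rfl)

theorem sigmaFun_sub (x y : Uq) : sigmaFun (x - y) = sigmaFun x - sigmaFun y :=
  tw_injective (by rw [tw_sigmaFun, map_sub]; rfl)

theorem sigmaFun_smul (c : Kq) (x : Uq) : sigmaFun (c • x) = bar c • sigmaFun x :=
  tw_injective (by rw [tw_sigmaFun, map_smul, ← tw_sigmaFun, smul_tw])

theorem sigmaFun_one : sigmaFun 1 = 1 := tw_injective (by rw [tw_sigmaFun, map_one]; rfl)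

theorem sigmaFun_Eu (i : Fin 2) : sigmaFun (Eu i) = sigmaScalar i • Eu i := by
  apply tw_injective
  rw [tw_sigmaFun, sigmaTwist, Eu, toUq, RingQuot.liftAlgHom_mkAlgHom_apply, fE,
    FreeAlgebra.lift_ι_apply]
  rfl

theorem sigmaFun_algebraMap (c : Kq) :
    sigmaFun (algebraMap Kq Uq c) = algebraMap Kq Uq (bar c) := by
  rw [Algebra.algebraMap_eq_smul_one, sigmaFun_smul, sigmaFun_one,
    Algebra.algebraMap_eq_smul_one]

theorem flip_imag {k A : Type*} [Field k] [Ring A] [Algebra k A] {t : k} (ht : t ≠ 0) {x y : A} :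
    x * (t ^ 4 • y) - t ^ 2 • ((t ^ 4 • y) * x) = (-t ^ 6) • (y * x - (t ^ 2)⁻¹ • (x * y)) := by
  simp only [mul_smul_comm, smul_mul_assoc, smul_sub]
  match_scalars <;> field_simp

theorem sigmaFun_imag : sigmaFun imag = (-q ^ 6) • imag := by
  rw [imag, sigmaFun_sub, sigmaFun_mul, sigmaFun_smul, sigmaFun_mul, sigmaFun_Eu, sigmaFun_Eu,
    map_inv₀, bar_pow, inv_inv]
  change (1 : Kq) • Eu 0 * q ^ 4 • Eu 1 - q ^ 2 • (q ^ 4 • Eu 1 * (1 : Kq) • Eu 0) = _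
  rw [one_smul]
  exact flip_imag q_ne_zero

theorem flip_bracket {k A : Type*} [Field k] [Ring A] [Algebra k A] {c r s : k} {D x y z : A}
    (hs : s ≠ 0) (h : D * x - x * D = s • y) (hz : s • z = (c • x) * ((-r) • D) - ((-r) • D) * (c • x)) :
    z = (r * c) • y := by
  refine smul_right_injective A hs ?_
  change s • z = s • ((r * c) • y)
  rw [hz, smul_comm, ← h]
  simp only [mul_smul_comm, smul_mul_assoc, smul_sub]
  match_scalars <;> ring

theorem bar_q_add_inv : bar (q + q⁻¹) = q + q⁻¹ := by
  rw [map_add, map_inv₀, bar_q, inv_inv, add_comm]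

/-- σ multiplies D by −q⁶, and the minus sign is absorbed by the reversal of the commutator. -/
theorem sigmaFun_step {x y : Uq} {c : Kq} (h : imag * x - x * imag = (q + q⁻¹) • y)
    (hx : sigmaFun x = c • x) : sigmaFun y = (q ^ 6 * c) • y := by
  refine flip_bracket q_add_inv_ne_zero h ?_
  have h2 := congrArg sigmaFun h
  rw [sigmaFun_sub, sigmaFun_mul, sigmaFun_mul, sigmaFun_smul, bar_q_add_inv, hx,
    sigmaFun_imag] at h2
  exact h2.symm

theorem sigmaFun_v (k : Fin 4) : sigmaFun (v k) = q ^ (6 * (k : ℕ)) • v k := by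
  have h0 : sigmaFun (v 0) = (1 : Kq) • v 0 := sigmaFun_Eu 0
  have h1 := sigmaFun_step bracket_imag_v0 h0
  have h2 := sigmaFun_step bracket_imag_v1 h1
  have h3 := sigmaFun_step bracket_imag_v2 h2
  rw [mul_one] at h1 h2 h3
  rw [← pow_add] at h2 h3
  rw [← pow_add] at h3
  fin_cases k
  · simpa using h0
  · exact h1
  · exact h2
  · exact h3

theorem bar_one_sub : bar (1 - q ^ (-2 : ℤ)) = -(q ^ 2 * (1 - q ^ (-2 : ℤ))) := by
  rw [map_sub, map_one, bar_zpow, neg_neg, q_zpow_two, q_zpow_neg_two]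
  have := q_ne_zero
  field_simp
  ring

/-- The factor q^{6k} of `v k` is corrected by q^{−4k}, which the bar involution produces from the
normalization (1 − q⁻²)^{−2k}. The scalar q⁴ in `sigmaScalar` is chosen for this outcome. -/
theorem sigmaFun_u (k : Fin 4) : sigmaFun (u k) = q ^ (2 * (k : ℕ)) • (u k : Uq) := by
  have hq := q_ne_zero
  have h1 := one_sub_q_neg_two_ne_zero
  rw [coe_u, sigmaFun_smul, sigmaFun_v, smul_smul, smul_smul, map_inv₀, map_pow, bar_one_sub,
    (even_two_mul _).neg_pow, mul_pow]
  congr 1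
  field_simp
  rw [← pow_mul, ← pow_add]
  congr 1
  ring

/-! ### Restriction to the subalgebra -/

theorem Uplus_induction {P : Uplus → Prop} (hc : ∀ c : Kq, P (algebraMap Kq Uplus c))
    (hu : ∀ i, P (u i)) (hadd : ∀ x y, P x → P y → P (x + y))
    (hmul : ∀ x y, P x → P y → P (x * y)) (x : Uplus) : P x := by
  obtain ⟨x, hx⟩ := x
  refine Algebra.adjoin_induction (p := fun x hx => P ⟨x, hx⟩) ?_ (fun c => hc c) ?_ ?_ hx
  · rintro _ ⟨i, rfl⟩
    have : (⟨v i, Algebra.subset_adjoin ⟨i, rfl⟩⟩ : Uplus)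
        = algebraMap Kq Uplus ((1 - q ^ (-2 : ℤ)) ^ (2 * (i : ℕ))) * u i := by
      rw [← Algebra.smul_def, u, smul_smul, mul_inv_cancel₀
        (pow_ne_zero _ one_sub_q_neg_two_ne_zero), one_smul]
    rw [this]
    exact hmul _ _ (hc _) (hu i)
  · exact fun x y hx hy => hadd ⟨x, hx⟩ ⟨y, hy⟩
  · exact fun x y hx hy => hmul ⟨x, hx⟩ ⟨y, hy⟩

theorem sigmaFun_mem (x : Uplus) : sigmaFun x ∈ Uplus := by
  induction x using Uplus_induction with
  | hc c => exact (sigmaFun_algebraMap c) ▸ Uplus.algebraMap_mem _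
  | hu i => exact (sigmaFun_u i) ▸ Uplus.smul_mem (u i).2 _
  | hadd x y hx hy =>
    have : sigmaFun ((x + y : Uplus) : Uq) = sigmaFun x + sigmaFun y := sigmaFun_add _ _
    exact this ▸ add_mem hx hy
  | hmul x y hx hy =>
    have : sigmaFun ((x * y : Uplus) : Uq) = sigmaFun y * sigmaFun x := sigmaFun_mul _ _
    exact this ▸ mul_mem hy hx

/-- `σ` on `U_q⁺(w)`, as a map. -/
def sigmaPlus (x : Uplus) : Uplus := ⟨sigmaFun x, sigmaFun_mem x⟩

theorem sigmaPlus_mul (x y : Uplus) : sigmaPlus (x * y) = sigmaPlus y * sigmaPlus x :=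
  Subtype.ext (sigmaFun_mul _ _)

theorem sigmaPlus_add (x y : Uplus) : sigmaPlus (x + y) = sigmaPlus x + sigmaPlus y :=
  Subtype.ext (sigmaFun_add _ _)

theorem sigmaPlus_smul (c : Kq) (x : Uplus) : sigmaPlus (c • x) = bar c • sigmaPlus x :=
  Subtype.ext (sigmaFun_smul _ _)

theorem sigmaPlus_u (i : Fin 4) : sigmaPlus (u i) = q ^ (2 * (i : ℕ)) • u i :=
  Subtype.ext (sigmaFun_u i)

theorem sigmaPlus_algebraMap (c : Kq) :
    sigmaPlus (algebraMap Kq Uplus c) = algebraMap Kq Uplus (bar c) :=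
  Subtype.ext (sigmaFun_algebraMap c)

theorem sigmaPlus_sigmaPlus (x : Uplus) : sigmaPlus (sigmaPlus x) = x := by
  induction x using Uplus_induction with
  | hc c => rw [sigmaPlus_algebraMap, sigmaPlus_algebraMap, bar_bar]
  | hu i =>
    rw [sigmaPlus_u, sigmaPlus_smul, sigmaPlus_u, smul_smul, bar_pow,
      inv_mul_cancel₀ (pow_ne_zero _ q_ne_zero), one_smul]
  | hadd x y hx hy => rw [sigmaPlus_add, sigmaPlus_add, hx, hy]
  | hmul x y hx hy => rw [sigmaPlus_mul, sigmaPlus_mul, hx, hy]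

def sigmaEquiv : Uplus ≃+* Uplusᵐᵒᵖ where
  toFun x := MulOpposite.op (sigmaPlus x)
  invFun x := sigmaPlus x.unop
  left_inv x := sigmaPlus_sigmaPlus x
  right_inv x := by
    change MulOpposite.op (sigmaPlus (sigmaPlus x.unop)) = x
    rw [sigmaPlus_sigmaPlus, MulOpposite.op_unop]
  map_mul' x y := by
    rw [sigmaPlus_mul, MulOpposite.op_mul]
  map_add' x y := by
    rw [sigmaPlus_add, MulOpposite.op_add]

theorem isSigma_sigmaEquiv : IsSigma sigmaEquiv where
  map_q := by
    change MulOpposite.op (sigmaPlus _) = _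
    rw [sigmaPlus_algebraMap, bar_q]
  map_u i := by
    change MulOpposite.op (sigmaPlus _) = _
    rw [sigmaPlus_u]

/-- A map with these properties is determined on scalars by its value at q and then on generators,
so the existential over σ in `IsDualCanonicalBasis` leaves no choice. -/
theorem IsSigma.eq_sigmaPlus {σ : Uplus ≃+* Uplusᵐᵒᵖ} (h : IsSigma σ) (x : Uplus) :
    σ x = MulOpposite.op (sigmaPlus x) := by
  induction x using Uplus_induction with
  | hc c =>
    have hq : (σ.toRingHom.comp (algebraMap Kq Uplus)) q
        = ((algebraMap Kq Uplusᵐᵒᵖ).comp bar) q := by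
      change σ (algebraMap Kq Uplus q) = algebraMap Kq Uplusᵐᵒᵖ (bar q)
      rw [bar_q]
      exact h.map_q
    have this : σ.toRingHom.comp (algebraMap Kq Uplus)
      = (algebraMap Kq Uplusᵐᵒᵖ).comp bar := ringHom_ext_q (R := Uplusᵐᵒᵖ) hq
    have h2 := RingHom.congr_fun this c
    rw [sigmaPlus_algebraMap]
    exact h2
  | hu i => rw [h.map_u, sigmaPlus_u]
  | hadd x y hx hy => rw [map_add, hx, hy, sigmaPlus_add, MulOpposite.op_add]
  | hmul x y hx hy => rw [map_mul, hx, hy, sigmaPlus_mul, MulOpposite.op_mul]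

end KroneckerQuantum

end

section
namespace KroneckerQuantum

/-! ### The partial order on the index set -/

theorem Below.refl (a : Idx) : Below a a := ⟨0, 0, by simp⟩

theorem Below.trans {a b c : Idx} (h : Below a b) (h' : Below b c) : Below a c := by
  obtain ⟨a₃, a₂, a₁, a₀⟩ := a
  obtain ⟨b₃, b₂, b₁, b₀⟩ := b
  obtain ⟨c₃, c₂, c₁, c₀⟩ := c
  obtain ⟨r, s, h₃, h₂, h₁, h₀⟩ := h
  obtain ⟨r', s', h₃', h₂', h₁', h₀'⟩ := h'
  refine ⟨r + r', s + s', ?_, ?_, ?_, ?_⟩ <;> push_cast <;> omega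

theorem Below.add {a b : Idx} (h : Below a b) (c : Idx) : Below (a + c) (b + c) := by
  obtain ⟨a₃, a₂, a₁, a₀⟩ := a
  obtain ⟨b₃, b₂, b₁, b₀⟩ := b
  obtain ⟨c₃, c₂, c₁, c₀⟩ := c
  obtain ⟨r, s, h₃, h₂, h₁, h₀⟩ := h
  refine ⟨r, s, ?_, ?_, ?_, ?_⟩ <;> push_cast <;> omega

/-- Both generators of the order have coordinate sum zero and are orthogonal to (7, 5, 3, 1). One
twist q^{N(a)} therefore serves all indices above a. -/
theorem Below.normN_eq {a b : Idx} (h : Below a b) : normN b = normN a := by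
  obtain ⟨a₃, a₂, a₁, a₀⟩ := a
  obtain ⟨b₃, b₂, b₁, b₀⟩ := b
  obtain ⟨r, s, h₃, h₂, h₁, h₀⟩ := h
  have h : (b₃ : ℤ) + b₂ + b₁ + b₀ = a₃ + a₂ + a₁ + a₀ := by omega
  simp only [normN, h]
  omega

/-- The indices strictly above `a`. -/
def above (a : Idx) : Set Idx := {b | Below a b ∧ b ≠ a}

/-- The height of an index, which decreases along the order. -/
def height (a : Idx) : ℕ := a.1 + a.2.2.2

theorem height_lt_of_mem_above {a b : Idx} (h : b ∈ above a) : height b < height a := by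
  obtain ⟨a₃, a₂, a₁, a₀⟩ := a
  obtain ⟨b₃, b₂, b₁, b₀⟩ := b
  obtain ⟨⟨r, s, h₃, h₂, h₁, h₀⟩, hne⟩ := h
  simp only [ne_eq, Prod.mk.injEq, not_and] at hne
  simp only [height]
  omega

theorem mem_above_of_below {a b c : Idx} (h : b ∈ above a) (h' : Below b c) : c ∈ above a := by
  refine ⟨h.1.trans h', ?_⟩
  rintro rfl
  have h1 := height_lt_of_mem_above h
  rcases eq_or_ne c b with rfl | hne
  · exact lt_irrefl _ h1
  · exact lt_asymm h1 (height_lt_of_mem_above ⟨h', hne⟩)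

theorem add_mem_above {a b : Idx} (h : b ∈ above a) (c : Idx) : b + c ∈ above (a + c) :=
  ⟨h.1.add c, fun he => h.2 (add_right_cancel he)⟩

/-! ### Lattices spanned by dual PBW elements -/

/-- The exponent of the scalar which relates `E[a]` to the ordered monomial. -/
def pbwExp (a : Idx) : ℕ :=
  a.1.choose 2 + a.2.1.choose 2 + a.2.2.1.choose 2 + a.2.2.2.choose 2

section Lattice

variable {A : Type*} [Ring A] [Algebra Kq A] {u : Fin 4 → A}

variable (u) in
/-- The dual PBW elements attached to `u`. -/
def pbw (a : Idx) : A := q ^ pbwExp a • mono u a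

variable (u) in
/-- The combinations of the `E[b]`, `b ∈ T`, with coefficients in `R`. -/
def lattice (R : AddSubgroup Kq) (T : Set Idx) : AddSubgroup A :=
  AddSubgroup.closure {x | ∃ b c, b ∈ T ∧ c ∈ R ∧ x = c • pbw u b}

theorem smul_pbw_mem {R : AddSubgroup Kq} {T : Set Idx} {b : Idx} {c : Kq} (hb : b ∈ T)
    (hc : c ∈ R) : c • pbw u b ∈ lattice u R T :=
  AddSubgroup.subset_closure ⟨b, c, hb, hc, rfl⟩

theorem lattice_map {R : AddSubgroup Kq} {T : Set Idx} {M : AddSubgroup A}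
    (φ : A →+ A) (h : ∀ b ∈ T, ∀ c ∈ R, φ (c • pbw u b) ∈ M) {x : A}
    (hx : x ∈ lattice u R T) : φ x ∈ M := by
  induction hx using AddSubgroup.closure_induction with
  | mem x hx =>
    obtain ⟨b, c, hb, hc, rfl⟩ := hx
    exact h b hb c hc
  | zero => rw [map_zero]; exact M.zero_mem
  | add x y _ _ hx hy => rw [map_add]; exact M.add_mem hx hy
  | neg x _ hx => rw [map_neg]; exact M.neg_mem hx

theorem lattice_mono {R R' : AddSubgroup Kq} {T T' : Set Idx} (hR : R ≤ R') (hT : T ⊆ T') :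
    lattice u R T ≤ lattice u R' T' := fun _ hx =>
  lattice_map (AddMonoidHom.id _) (fun _ hb _ hc => smul_pbw_mem (hT hb) (hR hc)) hx

variable (u) in
/-- The combinations of the `E[b]`, `b ∈ T`, with coefficients in `ℤ[q, q⁻¹]`. -/
abbrev laurentLattice (T : Set Idx) : AddSubgroup A := lattice u laurent.toAddSubgroup T

theorem smul_mem_laurentLattice {T : Set Idx} {c : Kq} (hc : c ∈ laurent) {x : A}
    (hx : x ∈ laurentLattice u T) : c • x ∈ laurentLattice u T :=
  lattice_map (DistribSMul.toAddMonoidHom A c) (fun b hb d hd => by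
    change c • d • pbw u b ∈ _
    rw [smul_smul]
    exact smul_pbw_mem hb (mul_mem (S := Subring Kq) hc hd)) hx

theorem pbw_eq (a : Idx) : pbw u a = q ^ pbwExp a • mono u a := rfl

theorem mono_eq (a : Idx) : mono u a = q ^ (-(pbwExp a : ℤ)) • pbw u a := by
  rw [pbw_eq, smul_smul, ← zpow_natCast q (pbwExp a), ← zpow_add₀ q_ne_zero, neg_add_cancel,
    zpow_zero, one_smul]

theorem smul_mono_mem {T : Set Idx} {b : Idx} {c : Kq} (hb : b ∈ T)
    (hc : c ∈ laurent) : c • mono u b ∈ laurentLattice u T := by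
  rw [mono_eq, smul_smul]
  exact smul_pbw_mem hb (mul_mem (S := Subring Kq) hc (zpow_mem_laurent _))

theorem mul_mem_laurentLattice {y : A} {T T' : Set Idx}
    (h : ∀ b ∈ T, y * mono u b ∈ laurentLattice u T') {x : A} (hx : x ∈ laurentLattice u T) :
    y * x ∈ laurentLattice u T' :=
  lattice_map (AddMonoidHom.mulLeft y) (fun b hb c hc => by
    change y * c • pbw u b ∈ _
    rw [pbw_eq, mul_smul_comm, mul_smul_comm]
    exact smul_mem_laurentLattice hc
      (smul_mem_laurentLattice (by exact_mod_cast zpow_mem_laurent (pbwExp b : ℤ)) (h b hb))) hx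

variable (u) in
/-- `x` is `q^n` times the ordered monomial `mono u a`, up to a combination of higher monomials. -/
def HasLead (n : ℤ) (x : A) (a : Idx) : Prop :=
  x - q ^ n • mono u a ∈ laurentLattice u (above a)

theorem HasLead.mem {n : ℤ} {x : A} {a : Idx} (h : HasLead u n x a) :
    x ∈ laurentLattice u {b | Below a b} := by
  rw [← sub_add_cancel x (q ^ n • mono u a)]
  exact add_mem (lattice_mono le_rfl (fun _ hb => hb.1) h)
    (smul_mono_mem (Below.refl a) (zpow_mem_laurent n))

theorem hasLead_of_eq {n : ℤ} {x : A} {a : Idx} (h : x = q ^ n • mono u a) : HasLead u n x a := by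
  rw [HasLead, h, sub_self]
  exact zero_mem _

theorem HasLead.add {n : ℤ} {x y : A} {a : Idx} (h : HasLead u n x a)
    (hy : y ∈ laurentLattice u (above a)) : HasLead u n (x + y) a := by
  have := add_mem h hy
  rwa [sub_add_eq_add_sub] at this

theorem HasLead.smul {m n r : ℤ} {x : A} {a : Idx} (h : HasLead u n x a) (hr : m + n = r) :
    HasLead u r (q ^ m • x) a := by
  have := smul_mem_laurentLattice (zpow_mem_laurent m) h
  rwa [smul_sub, smul_smul, ← zpow_add₀ q_ne_zero, hr] at this

theorem upper_mul {y : A} {f : Idx → ℤ} {e : Idx} (hy : ∀ b, HasLead u (f b) (y * mono u b) (b + e))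
    {x : A} {a : Idx} (hx : x ∈ laurentLattice u {b | Below a b}) :
    y * x ∈ laurentLattice u {b | Below (a + e) b} :=
  mul_mem_laurentLattice (fun b hb =>
    lattice_mono le_rfl (fun _ hc => (Below.add hb e).trans hc) (hy b).mem) hx

theorem above_mul {y : A} {f : Idx → ℤ} {e : Idx} (hy : ∀ b, HasLead u (f b) (y * mono u b) (b + e))
    {x : A} {a : Idx} (hx : x ∈ laurentLattice u (above a)) :
    y * x ∈ laurentLattice u (above (a + e)) :=
  mul_mem_laurentLattice (fun _ hb =>
    lattice_mono le_rfl (fun _ hc => mem_above_of_below (add_mem_above hb e) hc) (hy _).mem) hx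

theorem HasLead.mul {y : A} {f : Idx → ℤ} {e : Idx}
    (hy : ∀ b, HasLead u (f b) (y * mono u b) (b + e)) {n : ℤ} {x : A} {a : Idx}
    (hx : HasLead u n x a) : HasLead u (n + f a) (y * x) (a + e) := by
  have h1 := above_mul hy hx
  have h2 := smul_mem_laurentLattice (zpow_mem_laurent n) (hy a)
  have h3 := add_mem h1 h2
  rwa [mul_sub, mul_smul_comm, smul_sub, smul_smul, ← zpow_add₀ q_ne_zero,
    sub_add_sub_cancel] at h3

end Lattice

/-! ### Straightening -/

section

variable {k A : Type*} [Field k] [Ring A] [Algebra k A] {t : k}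

theorem mul_pow_of_skew {x y : A} {c : k} (h : y * x = c • (x * y)) (n : ℕ) :
    y * x ^ n = c ^ n • (x ^ n * y) := by
  induction n with
  | zero => simp
  | succ n ih =>
    rw [pow_succ, ← mul_assoc, ih, smul_mul_assoc, mul_assoc, h, mul_smul_comm, smul_smul,
      ← mul_assoc, ← pow_succ, ← pow_succ]

namespace IsLadder

variable {x : Fin 4 → A}

theorem r01 (h : IsLadder t x) (ht : t ≠ 0) : x 0 * x 1 = (t ^ 2)⁻¹ • (x 1 * x 0) := by
  rw [h.r10, smul_smul, inv_mul_cancel₀ (pow_ne_zero 2 ht), one_smul]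

theorem r12 (h : IsLadder t x) (ht : t ≠ 0) : x 1 * x 2 = (t ^ 2)⁻¹ • (x 2 * x 1) := by
  rw [h.r21, smul_smul, inv_mul_cancel₀ (pow_ne_zero 2 ht), one_smul]

theorem r23 (h : IsLadder t x) (ht : t ≠ 0) : x 2 * x 3 = (t ^ 2)⁻¹ • (x 3 * x 2) := by
  rw [h.r32, smul_smul, inv_mul_cancel₀ (pow_ne_zero 2 ht), one_smul]

theorem r02 (h : IsLadder t x) (ht : t ≠ 0) :
    x 0 * x 2 = (t ^ 2)⁻¹ • (x 2 * x 0) + ((t ^ 2)⁻¹ - 1) • (x 1 * x 1) := by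
  rw [h.r20]
  match_scalars <;> field_simp <;> ring

theorem r13 (h : IsLadder t x) (ht : t ≠ 0) :
    x 1 * x 3 = (t ^ 2)⁻¹ • (x 3 * x 1) + ((t ^ 2)⁻¹ - 1) • (x 2 * x 2) := by
  rw [h.r31]
  match_scalars <;> field_simp <;> ring

theorem r03 (h : IsLadder t x) (ht : t ≠ 0) :
    x 0 * x 3 = (t ^ 2)⁻¹ • (x 3 * x 0) + ((t ^ 4)⁻¹ - 1) • (x 2 * x 1) := by
  rw [h.r30]
  match_scalars <;> field_simp <;> ring

end IsLadder

end

theorem q_neg_two_pow (n : ℕ) : ((q ^ 2)⁻¹) ^ n = q ^ (-2 * (n : ℤ)) := by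
  rw [← q_zpow_neg_two, ← zpow_natCast, ← zpow_mul]

section Lattice

variable {A : Type*} [Ring A] [Algebra Kq A] {u : Fin 4 → A}

theorem mul_mono_three (b : Idx) : HasLead u 0 (u 3 * mono u b) (b + (1, 0, 0, 0)) := by
  apply hasLead_of_eq
  obtain ⟨b₃, b₂, b₁, b₀⟩ := b
  change u 3 * (u 3 ^ b₃ * u 2 ^ b₂ * u 1 ^ b₁ * u 0 ^ b₀) =
    q ^ (0 : ℤ) • (u 3 ^ (b₃ + 1) * u 2 ^ b₂ * u 1 ^ b₁ * u 0 ^ b₀)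
  rw [zpow_zero, one_smul, pow_succ']
  simp only [mul_assoc]

theorem mul_mono_two (hu : IsLadder q u) (b : Idx) : HasLead u (-2 * b.1) (u 2 * mono u b) (b + (0, 1, 0, 0)) := by
  apply hasLead_of_eq
  obtain ⟨b₃, b₂, b₁, b₀⟩ := b
  change u 2 * (u 3 ^ b₃ * u 2 ^ b₂ * u 1 ^ b₁ * u 0 ^ b₀) =
    q ^ (-2 * (b₃ : ℤ)) • (u 3 ^ b₃ * u 2 ^ (b₂ + 1) * u 1 ^ b₁ * u 0 ^ b₀)
  rw [← q_neg_two_pow, pow_succ' (u 2)]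
  simp only [← mul_assoc]
  rw [mul_pow_of_skew (hu.r23 q_ne_zero)]
  simp only [smul_mul_assoc, mul_assoc]

theorem mono_succ_three (b₃ b₂ b₁ b₀ : ℕ) :
    mono u (b₃ + 1, b₂, b₁, b₀) = u 3 * mono u (b₃, b₂, b₁, b₀) := by
  simp only [mono, pow_succ', mul_assoc]

theorem mono_succ_two (b₂ b₁ b₀ : ℕ) :
    mono u (0, b₂ + 1, b₁, b₀) = u 2 * mono u (0, b₂, b₁, b₀) := by
  simp only [mono, pow_succ', mul_assoc, pow_zero, one_mul]

theorem q_neg_two_sub_one_mem : (q ^ 2)⁻¹ - 1 ∈ laurent :=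
  sub_mem (q_zpow_neg_two ▸ zpow_mem_laurent _) (one_mem _)

theorem q_neg_four_sub_one_mem : (q ^ 4)⁻¹ - 1 ∈ laurent := by
  refine sub_mem ?_ (one_mem _)
  rw [show (q ^ 4)⁻¹ = q ^ (-4 : ℤ) by rw [zpow_neg]; norm_cast]
  exact zpow_mem_laurent _

/-- Passing u₁ across a factor u₃ costs q⁻² and leaves a multiple of u₂². The replacement of u₃u₁ by
u₂² is the order generator (−1, 2, −1, 0). -/
theorem mul_mono_one (hu : IsLadder q u) (b : Idx) :
    HasLead u (-2 * b.1 - 2 * b.2.1) (u 1 * mono u b) (b + (0, 0, 1, 0)) := by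
  obtain ⟨b₃, b₂, b₁, b₀⟩ := b
  induction b₃ with
  | zero =>
    apply hasLead_of_eq
    change u 1 * (u 3 ^ 0 * u 2 ^ b₂ * u 1 ^ b₁ * u 0 ^ b₀) =
      q ^ (-2 * ((0 : ℕ) : ℤ) - 2 * (b₂ : ℤ)) • (u 3 ^ 0 * u 2 ^ b₂ * u 1 ^ (b₁ + 1) * u 0 ^ b₀)
    have : -2 * ((0 : ℕ) : ℤ) - 2 * (b₂ : ℤ) = -2 * b₂ := by push_cast; ring
    rw [this, ← q_neg_two_pow, pow_zero, one_mul, pow_succ' (u 1)]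
    simp only [← mul_assoc]
    rw [mul_pow_of_skew (hu.r12 q_ne_zero)]
    simp only [smul_mul_assoc, mul_assoc]
  | succ b₃ ih =>
    rw [mono_succ_three, ← mul_assoc, hu.r13 q_ne_zero, add_mul, smul_mul_assoc,
      smul_mul_assoc, mul_assoc, mul_assoc, ← q_zpow_neg_two]
    refine HasLead.add ?_ ?_
    · exact (ih.mul mul_mono_three).smul (by push_cast; ring)
    · rw [q_zpow_neg_two]
      refine smul_mem_laurentLattice q_neg_two_sub_one_mem ?_
      refine lattice_mono le_rfl ?_ (upper_mul (mul_mono_two hu) (mul_mono_two hu _).mem)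
      intro c hc
      refine mem_above_of_below (b := _) ⟨⟨1, 0, ?_⟩, ?_⟩ (Set.mem_ofPred.mp hc)
      · simp
        omega
      · simp

/-- The error terms are u₁² when crossing u₂ and u₂u₁ when crossing u₃. In the order these are the
generator (0, −1, 2, −1) and the sum of both generators. -/
theorem mul_mono_zero (hu : IsLadder q u) (b : Idx) :
    HasLead u (-2 * b.1 - 2 * b.2.1 - 2 * b.2.2.1) (u 0 * mono u b) (b + (0, 0, 0, 1)) := by
  obtain ⟨b₃, b₂, b₁, b₀⟩ := b
  induction b₃ with
  | zero =>
    induction b₂ with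
    | zero =>
      apply hasLead_of_eq
      change u 0 * (u 3 ^ 0 * u 2 ^ 0 * u 1 ^ b₁ * u 0 ^ b₀) =
        q ^ (-2 * ((0 : ℕ) : ℤ) - 2 * ((0 : ℕ) : ℤ) - 2 * (b₁ : ℤ)) •
          (u 3 ^ 0 * u 2 ^ 0 * u 1 ^ b₁ * u 0 ^ (b₀ + 1))
      have : -2 * ((0 : ℕ) : ℤ) - 2 * ((0 : ℕ) : ℤ) - 2 * (b₁ : ℤ) = -2 * b₁ := by push_cast; ring
      rw [this, ← q_neg_two_pow, pow_zero, one_mul, pow_zero, one_mul, pow_succ' (u 0)]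
      simp only [← mul_assoc]
      rw [mul_pow_of_skew (hu.r01 q_ne_zero)]
      simp only [smul_mul_assoc, mul_assoc]
    | succ b₂ ih =>
      rw [mono_succ_two, ← mul_assoc, hu.r02 q_ne_zero, add_mul, smul_mul_assoc,
        smul_mul_assoc, mul_assoc, mul_assoc, ← q_zpow_neg_two]
      refine HasLead.add ?_ ?_
      · exact (ih.mul (mul_mono_two hu)).smul (by push_cast; simp; ring)
      · rw [q_zpow_neg_two]
        refine smul_mem_laurentLattice q_neg_two_sub_one_mem ?_
        refine lattice_mono le_rfl ?_ (upper_mul (mul_mono_one hu) (mul_mono_one hu _).mem)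
        intro c hc
        refine mem_above_of_below (b := _) ⟨⟨0, 1, ?_⟩, ?_⟩ (Set.mem_ofPred.mp hc)
        · simp
          omega
        · simp
  | succ b₃ ih =>
    rw [mono_succ_three, ← mul_assoc, hu.r03 q_ne_zero, add_mul, smul_mul_assoc,
      smul_mul_assoc, mul_assoc, mul_assoc, ← q_zpow_neg_two]
    refine HasLead.add ?_ ?_
    · exact (ih.mul mul_mono_three).smul (by push_cast; ring)
    · refine smul_mem_laurentLattice q_neg_four_sub_one_mem ?_
      refine lattice_mono le_rfl ?_ (upper_mul (mul_mono_two hu) (mul_mono_one hu _).mem)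
      intro c hc
      refine mem_above_of_below (b := _) ⟨⟨1, 1, ?_⟩, ?_⟩ (Set.mem_ofPred.mp hc)
      · simp
      · simp

end Lattice

end KroneckerQuantum

end

/-! ### Triangularity of the involution and the Kazhdan–Lusztig argument -/

section
namespace KroneckerQuantum

section Lattice

variable {A : Type*} [Ring A] [Algebra Kq A] {u : Fin 4 → A}

/-- The generators `u i` and the involution `σ` satisfy the relations of `U_q⁺(w)`. -/
structure IsBarLadder (u : Fin 4 → A) (σ : A →+ A) : Prop where
  ladder : IsLadder q u
  linearIndependent : LinearIndependent Kq (mono u)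
  induction : ∀ P : A → Prop, (∀ c : Kq, P (algebraMap Kq A c)) → (∀ i, P (u i)) →
    (∀ x y, P x → P y → P (x + y)) → (∀ x y, P x → P y → P (x * y)) → ∀ x, P x
  map_mul : ∀ x y, σ (x * y) = σ y * σ x
  map_smul : ∀ (c : Kq) x, σ (c • x) = bar c • σ x
  map_u : ∀ i : Fin 4, σ (u i) = q ^ (2 * (i : ℕ)) • u i
  involutive : ∀ x, σ (σ x) = x

theorem hasLead_pow {y : A} {f : Idx → ℤ} {e : Idx}
    (hy : ∀ b, HasLead u (f b) (y * mono u b) (b + e)) (hf : ∀ b, f (b + e) = f b) {n : ℤ} {x : A}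
    {a : Idx} (hx : HasLead u n x a) (m : ℕ) :
    HasLead u (n + m * f a) (y ^ m * x) (a + m • e) := by
  have hf' : ∀ m : ℕ, f (a + m • e) = f a := fun m => by
    induction m with
    | zero => simp
    | succ m ih => rw [succ_nsmul, ← add_assoc, hf, ih]
  induction m with
  | zero => simpa using hx
  | succ m ih =>
    have := ih.mul hy
    rw [hf'] at this
    rw [pow_succ', mul_assoc, succ_nsmul, ← add_assoc]
    convert this using 1
    push_cast
    ring

theorem two_mul_choose_two (n : ℕ) : 2 * ((n.choose 2 : ℕ) : ℤ) = n * (n - 1) := by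
  induction n with
  | zero => simp
  | succ n ih =>
    rw [Nat.choose_succ_succ, Nat.choose_one_right]
    push_cast
    linarith

namespace IsBarLadder

variable {σ : A →+ A}

theorem pbw_zero : pbw u 0 = 1 := by simp [pbw, pbwExp, mono]

/-- By straightening, the span is stable under left multiplication by the generators; it contains 1.
-/
theorem span_pbw (h : IsBarLadder u σ) : Submodule.span Kq (Set.range (pbw u)) = ⊤ := by
  have hmono : ∀ b, mono u b ∈ Submodule.span Kq (Set.range (pbw u)) := fun b => by
    rw [mono_eq]
    exact Submodule.smul_mem _ _ (Submodule.subset_span ⟨b, rfl⟩)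
  have hlat : ∀ {T x}, x ∈ laurentLattice u T → x ∈ Submodule.span Kq (Set.range (pbw u)) :=
    fun hx => lattice_map (M := (Submodule.span Kq (Set.range (pbw u))).toAddSubgroup)
      (AddMonoidHom.id A)
      (fun b _ c _ => Submodule.smul_mem _ _ (Submodule.subset_span ⟨b, rfl⟩)) hx
  have hu : ∀ i b, u i * mono u b ∈ Submodule.span Kq (Set.range (pbw u)) := by
    intro i b
    fin_cases i
    exacts [hlat (mul_mono_zero h.ladder b).mem, hlat (mul_mono_one h.ladder b).mem,
      hlat (mul_mono_two h.ladder b).mem, hlat (mul_mono_three b).mem]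
  have key : ∀ x y, y ∈ Submodule.span Kq (Set.range (pbw u)) →
      x * y ∈ Submodule.span Kq (Set.range (pbw u)) := by
    refine h.induction _ ?_ ?_ ?_ ?_
    · intro c y hy
      rw [← Algebra.smul_def]
      exact Submodule.smul_mem _ _ hy
    · intro i y hy
      induction hy using Submodule.span_induction with
      | mem y hy =>
        obtain ⟨b, rfl⟩ := hy
        rw [pbw_eq, mul_smul_comm]
        exact Submodule.smul_mem _ _ (hu i b)
      | zero => rw [mul_zero]; exact Submodule.zero_mem _
      | add y z _ _ hy hz => rw [mul_add]; exact Submodule.add_mem _ hy hz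
      | smul c y _ hy => rw [mul_smul_comm]; exact Submodule.smul_mem _ _ hy
    · intro x y hx hy z hz
      rw [add_mul]
      exact Submodule.add_mem _ (hx z hz) (hy z hz)
    · intro x y hx hy z hz
      rw [mul_assoc]
      exact hx _ (hy z hz)
  rw [Submodule.eq_top_iff']
  intro x
  have := key x 1 (pbw_zero (u := u) ▸ Submodule.subset_span ⟨0, rfl⟩)
  rwa [mul_one] at this

theorem linearIndependent_pbw (h : IsBarLadder u σ) : LinearIndependent Kq (pbw u) :=
  h.linearIndependent.units_smul (fun a => Units.mk0 (q ^ pbwExp a) (pow_ne_zero _ q_ne_zero))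

/-- The dual PBW basis. -/
def basis (h : IsBarLadder u σ) : Module.Basis Idx Kq A :=
  Module.Basis.mk h.linearIndependent_pbw h.span_pbw.ge

theorem basis_apply (h : IsBarLadder u σ) (a : Idx) : h.basis a = pbw u a :=
  Module.Basis.mk_apply _ _ a

/-- The coordinate of `x` at the dual PBW element `E[b]`. -/
def coord (h : IsBarLadder u σ) (b : Idx) : A →ₗ[Kq] Kq := h.basis.coord b

theorem coord_pbw (h : IsBarLadder u σ) (a b : Idx) :
    h.coord b (pbw u a) = if a = b then 1 else 0 := by
  rw [coord, ← h.basis_apply, Module.Basis.coord_apply, Module.Basis.repr_self,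
    Finsupp.single_apply]

theorem ext_coord (h : IsBarLadder u σ) {x y : A} (hxy : ∀ b, h.coord b x = h.coord b y) :
    x = y := h.basis.ext_elem hxy

theorem mem_lattice_iff (h : IsBarLadder u σ) {R : AddSubgroup Kq} {T : Set Idx} {x : A} :
    x ∈ lattice u R T ↔ ∀ b, h.coord b x ∈ R ∧ (b ∉ T → h.coord b x = 0) := by
  constructor
  · intro hx b
    constructor
    · refine lattice_map (M := R.comap (h.coord b).toAddMonoidHom) (AddMonoidHom.id A) ?_ hx
      intro c hc r hr
      change h.coord b (r • pbw u c) ∈ R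
      rw [_root_.map_smul, coord_pbw]
      split_ifs
      · simpa using hr
      · simp
    · intro hb
      refine lattice_map (M := (h.coord b).toAddMonoidHom.ker) (AddMonoidHom.id A) ?_ hx
      intro c hc r hr
      change h.coord b (r • pbw u c) = 0
      rw [_root_.map_smul, coord_pbw, if_neg (by rintro rfl; exact hb hc), smul_zero]
  · intro hx
    rw [← h.basis.linearCombination_repr x, Finsupp.linearCombination_apply]
    refine sum_mem fun b hb => ?_
    have h0 : h.coord b x ≠ 0 := Finsupp.mem_support_iff.mp hb
    beta_reduce
    rw [h.basis_apply]
    exact smul_pbw_mem (by_contra fun hT => h0 ((hx b).2 hT)) (hx b).1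

theorem hasLead_reverse (h : IsBarLadder u σ) (a : Idx) :
    HasLead u (-2 * (a.1 * a.2.1 + (a.1 + a.2.1) * a.2.2.1 + (a.1 + a.2.1 + a.2.2.1) * a.2.2.2))
      (u 0 ^ a.2.2.2 * (u 1 ^ a.2.2.1 * (u 2 ^ a.2.1 * u 3 ^ a.1))) a := by
  obtain ⟨a₃, a₂, a₁, a₀⟩ := a
  have h3 : HasLead u 0 (u 3 ^ a₃) (a₃, 0, 0, 0) := hasLead_of_eq (by simp [mono])
  have h2 := hasLead_pow (mul_mono_two h.ladder) (fun b => by simp) h3 a₂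
  have h1 := hasLead_pow (mul_mono_one h.ladder) (fun b => by simp) h2 a₁
  have h0 := hasLead_pow (mul_mono_zero h.ladder) (fun b => by simp) h1 a₀
  convert h0 using 1
  · simp
    ring
  · simp

theorem map_pow (h : IsBarLadder u σ) (x : A) (n : ℕ) : σ (x ^ n) = σ x ^ n := by
  have h1 : σ 1 = 1 := by
    have := h.map_mul (σ 1) 1
    rwa [mul_one, h.involutive, mul_one, eq_comm] at this
  induction n with
  | zero => rw [pow_zero, pow_zero, h1]
  | succ n ih => rw [pow_succ, h.map_mul, ih, pow_succ']

theorem map_mono (h : IsBarLadder u σ) (a : Idx) :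
    σ (mono u a) = q ^ (6 * (a.1 : ℤ) + 4 * a.2.1 + 2 * a.2.2.1) •
      (u 0 ^ a.2.2.2 * (u 1 ^ a.2.2.1 * (u 2 ^ a.2.1 * u 3 ^ a.1))) := by
  have e0 := h.map_u 0
  have e1 := h.map_u 1
  have e2 := h.map_u 2
  have e3 := h.map_u 3
  rw [mono, h.map_mul, h.map_mul, h.map_mul, h.map_pow, h.map_pow, h.map_pow, h.map_pow, e0, e1,
    e2, e3]
  simp only [smul_pow, smul_mul_assoc, mul_smul_comm, smul_smul]
  congr 1
  simp only [← pow_mul, ← pow_add, ← zpow_natCast, ← zpow_mul, ← zpow_add₀ q_ne_zero]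
  congr 1
  simp

/-- σ reverses the monomial, and straightening it back yields q to the power −2 Σ a_i a_j over pairs
i < j. N(a) is exactly the exponent that restores the leading coefficient of E[a], in view of
2·binom(n, 2) = n² − n. -/
theorem hasLead_map_pbw (h : IsBarLadder u σ) (a : Idx) :
    HasLead u (pbwExp a) (q ^ normN a • σ (pbw u a)) a := by
  rw [pbw_eq, h.map_smul, h.map_mono, bar_pow, ← zpow_natCast, ← zpow_neg, smul_smul, smul_smul,
    ← zpow_add₀ q_ne_zero, ← zpow_add₀ q_ne_zero]
  refine (h.hasLead_reverse a).smul ?_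
  obtain ⟨a₃, a₂, a₁, a₀⟩ := a
  have h3 := two_mul_choose_two a₃
  have h2 := two_mul_choose_two a₂
  have h1 := two_mul_choose_two a₁
  have h0 := two_mul_choose_two a₀
  simp only [normN, pbwExp]
  push_cast
  linear_combination -h3 - h2 - h1 - h0

theorem map_pbw_sub_mem (h : IsBarLadder u σ) (a : Idx) :
    q ^ normN a • σ (pbw u a) - pbw u a ∈ laurentLattice u (above a) := by
  have := h.hasLead_map_pbw a
  rwa [HasLead, zpow_natCast, ← pbw_eq] at this

/-- The indices above `a` of height less than `n`. -/
def _root_.KroneckerQuantum.aboveLT (a : Idx) (n : ℕ) : Set Idx := {b ∈ above a | height b < n}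

theorem map_mem_aboveLT (h : IsBarLadder u σ) {a : Idx} {n : ℕ} {x : A}
    (hx : x ∈ laurentLattice u (aboveLT a n)) :
    q ^ normN a • σ x ∈ laurentLattice u (aboveLT a n) := by
  refine lattice_map ((DistribSMul.toAddMonoidHom A (q ^ normN a)).comp σ) ?_ hx
  intro b hb c hc
  change q ^ normN a • σ (c • pbw u b) ∈ _
  rw [h.map_smul, smul_comm, ← hb.1.1.normN_eq]
  refine smul_mem_laurentLattice (bar_mem_laurent hc) ?_
  have h1 := add_mem (lattice_mono le_rfl (fun d hd => ?_) (h.map_pbw_sub_mem b))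
    (smul_pbw_mem hb (one_mem laurent))
  · rwa [one_smul, sub_add_cancel] at h1
  · exact ⟨mem_above_of_below hb.1 hd.1, (height_lt_of_mem_above hd).trans hb.2⟩

/-- At the largest height present, the twisted involution acts on coordinates by the bar involution
alone, because its correction terms have smaller height. -/
theorem coord_map (h : IsBarLadder u σ) {a b : Idx} {n : ℕ} {x : A}
    (hx : x ∈ laurentLattice u (aboveLT a (n + 1))) (hb : height b = n) :
    h.coord b (q ^ normN a • σ x) = bar (h.coord b x) := by
  let φ : A →+ Kq := (h.coord b).toAddMonoidHom.comp
      ((DistribSMul.toAddMonoidHom A (q ^ normN a)).comp σ)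
  let ψ : A →+ Kq := bar.toAddMonoidHom.comp (h.coord b).toAddMonoidHom
  have : (AddMonoidHom.id A) x ∈ (φ - ψ).ker := by
    refine lattice_map _ ?_ hx
    intro c hc r hr
    change h.coord b (q ^ normN a • σ (r • pbw u c)) - bar (h.coord b (r • pbw u c)) = 0
    rw [h.map_smul, smul_comm, ← hc.1.1.normN_eq, _root_.map_smul (h.coord b) (bar r),
      _root_.map_smul (h.coord b) r, smul_eq_mul, smul_eq_mul, _root_.map_mul]
    have h1 := ((h.mem_lattice_iff.mp (h.map_pbw_sub_mem c)) b).2 (fun hbc => by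
      have := height_lt_of_mem_above hbc
      have := hc.2
      omega)
    rw [map_sub, sub_eq_zero] at h1
    rw [h1, coord_pbw]
    split_ifs <;> simp
  exact sub_eq_zero.mp this

theorem map_map (h : IsBarLadder u σ) (n : ℤ) (x : A) : q ^ n • σ (q ^ n • σ x) = x := by
  rw [h.map_smul, h.involutive, smul_smul, bar_zpow, ← zpow_add₀ q_ne_zero, add_neg_cancel,
    zpow_zero, one_smul]

theorem aboveLT_subset (a : Idx) (n : ℕ) : aboveLT a n ⊆ above a := fun _ hb => hb.1

theorem aboveLT_height (a : Idx) : aboveLT a (height a) = above a :=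
  Set.Subset.antisymm (aboveLT_subset a _) fun _ hb => ⟨hb, height_lt_of_mem_above hb⟩

theorem qZq_le : qZq ≤ laurent.toAddSubgroup := fun _ hx => qZq_le_laurent hx

theorem eq_zero_of_aboveLT_zero (h : IsBarLadder u σ) {R : AddSubgroup Kq} {a : Idx} {x : A}
    (hx : x ∈ lattice u R (aboveLT a 0)) : x = 0 := by
  refine h.ext_coord fun b => ?_
  rw [map_zero]
  exact ((h.mem_lattice_iff.mp hx) b).2 fun hb => Nat.not_lt_zero _ hb.2

theorem mem_aboveLT_of_succ (h : IsBarLadder u σ) {R : AddSubgroup Kq} {a : Idx} {n : ℕ} {x : A}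
    (hx : x ∈ lattice u R (aboveLT a (n + 1))) (h0 : ∀ b, height b = n → h.coord b x = 0) :
    x ∈ lattice u R (aboveLT a n) := by
  rw [h.mem_lattice_iff] at hx ⊢
  refine fun b => ⟨(hx b).1, fun hb => ?_⟩
  by_cases hn : height b = n
  · exact h0 b hn
  · refine (hx b).2 fun hb' => hb ⟨hb'.1, ?_⟩
    have := hb'.2
    omega

/-- The coordinates at the largest remaining height are bar-invariant in qℤ[q], hence zero; descent
on the height finishes. -/
theorem eq_zero_of_map_eq (h : IsBarLadder u σ) {a : Idx} {x : A}
    (hx : x ∈ lattice u qZq (above a)) (hσ : q ^ normN a • σ x = x) : x = 0 := by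
  rw [← aboveLT_height] at hx
  generalize height a = n at hx
  induction n with
  | zero => exact h.eq_zero_of_aboveLT_zero hx
  | succ n ih =>
    refine ih (h.mem_aboveLT_of_succ hx fun b hb => ?_)
    have h1 := h.coord_map (lattice_mono qZq_le subset_rfl hx) hb
    rw [hσ] at h1
    exact eq_zero_of_bar_eq (h.mem_lattice_iff.mp hx b).1 h1.symm

/-- At the largest remaining height each coordinate is negated by the bar involution, hence of the
form c − c̄. Subtracting the contribution of those c lowers the height and preserves
anti-invariance. -/
theorem exists_sub_map (h : IsBarLadder u σ) {a : Idx} {n : ℕ} {y : A}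
    (hy : y ∈ laurentLattice u (aboveLT a n)) (hσ : q ^ normN a • σ y = -y) :
    ∃ p ∈ lattice u qZq (above a), y = p - q ^ normN a • σ p := by
  classical
  induction n generalizing y with
  | zero =>
    refine ⟨0, zero_mem _, ?_⟩
    rw [h.eq_zero_of_aboveLT_zero hy, map_zero, smul_zero, sub_zero]
  | succ n ih =>
    have hex : ∀ b, ∃ c ∈ qZq, (height b = n → h.coord b y = c - bar c) ∧
        (h.coord b y = 0 → c = 0) := fun b => by
      by_cases hb : height b = n ∧ h.coord b y ≠ 0
      · have h1 := h.coord_map hy hb.1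
        rw [hσ, map_neg] at h1
        obtain ⟨c, hc, hc'⟩ := exists_sub_bar (h.mem_lattice_iff.mp hy b).1 h1.symm
        exact ⟨c, hc, fun _ => hc', fun h0 => absurd h0 hb.2⟩
      · refine ⟨0, zero_mem _, fun hb' => ?_, fun _ => rfl⟩
        rw [map_zero, sub_zero]
        exact by_contra fun h0 => hb ⟨hb', h0⟩
    choose c hc hc' hc0 using hex
    set p : A := ∑ b ∈ (h.basis.repr y).support.filter (fun b => height b = n), c b • pbw u b
      with hp
    have hpc : ∀ b, height b = n → h.coord b p = c b := fun b hb => by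
      rw [hp, map_sum]
      simp only [_root_.map_smul, coord_pbw, smul_eq_mul, mul_ite, mul_one, mul_zero]
      rw [Finset.sum_ite_eq']
      split_ifs with hmem
      · rfl
      · refine (hc0 b (by_contra fun hne => hmem ?_)).symm
        exact Finset.mem_filter.mpr ⟨Finsupp.mem_support_iff.mpr hne, hb⟩
    have hpm : p ∈ lattice u qZq (aboveLT a (n + 1)) := by
      refine sum_mem fun b hb => smul_pbw_mem ?_ (hc b)
      obtain ⟨hb1, hb2⟩ := Finset.mem_filter.mp hb
      by_contra hT
      exact Finsupp.mem_support_iff.mp hb1 ((h.mem_lattice_iff.mp hy b).2 hT)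
    have hpl := lattice_mono (u := u) qZq_le subset_rfl hpm
    have hy' : y - (p - q ^ normN a • σ p) ∈ laurentLattice u (aboveLT a n) := by
      refine h.mem_aboveLT_of_succ (sub_mem hy (sub_mem hpl (h.map_mem_aboveLT hpl))) ?_
      intro b hb
      rw [map_sub, map_sub, h.coord_map hpl hb, hpc b hb, hc' b hb, sub_self]
    obtain ⟨p', hp', he⟩ := ih hy' (by
      rw [map_sub, map_sub, smul_sub, smul_sub, h.map_map, hσ]
      abel)
    refine ⟨p + p', add_mem (lattice_mono le_rfl (aboveLT_subset a _) hpm) hp', ?_⟩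
    rw [map_add, smul_add, sub_eq_iff_eq_add.mp he]
    abel

/-- The dual canonical basis element attached to `a`. -/
theorem exists_canonical (h : IsBarLadder u σ) (a : Idx) :
    ∃ x, x - pbw u a ∈ lattice u qZq (above a) ∧ σ x = q ^ (-normN a) • x := by
  have h1 := h.map_pbw_sub_mem a
  rw [← aboveLT_height] at h1
  -- The defect of E[a] is anti-invariant, because the twisted σ is an involution. Adding p to E[a]
  -- repairs it.
  obtain ⟨p, hp, he⟩ := h.exists_sub_map h1 (by rw [map_sub, smul_sub, h.map_map]; abel)
  refine ⟨pbw u a + p, by rwa [add_sub_cancel_left], ?_⟩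
  have h2 : q ^ normN a • σ (pbw u a + p) = pbw u a + p := by
    rw [map_add, smul_add, sub_eq_iff_eq_add.mp he]
    abel
  conv_rhs => rw [← h2, smul_smul, ← zpow_add₀ q_ne_zero, neg_add_cancel, zpow_zero, one_smul]

theorem canonical_unique (h : IsBarLadder u σ) {a : Idx} {x y : A}
    (hx : x - pbw u a ∈ lattice u qZq (above a)) (hx' : σ x = q ^ (-normN a) • x)
    (hy : y - pbw u a ∈ lattice u qZq (above a)) (hy' : σ y = q ^ (-normN a) • y) : x = y := by
  have hm := sub_mem hx hy
  rw [sub_sub_sub_cancel_right] at hm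
  refine sub_eq_zero.mp (h.eq_zero_of_map_eq hm ?_)
  rw [map_sub, hx', hy', ← smul_sub, smul_smul, ← zpow_add₀ q_ne_zero, add_neg_cancel, zpow_zero,
    one_smul]

theorem coord_unitriangular (h : IsBarLadder u σ) {B : Idx → A}
    (hB : ∀ a, B a - pbw u a ∈ lattice u qZq (above a)) {a b : Idx} (hab : height a ≤ height b) :
    h.coord b (B a) = if a = b then 1 else 0 := by
  have h1 := (h.mem_lattice_iff.mp (hB a) b).2 (fun hb => by
    have := height_lt_of_mem_above hb
    omega)
  rw [map_sub, sub_eq_zero] at h1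
  rw [h1, coord_pbw]

theorem linearIndependent_unitriangular (h : IsBarLadder u σ) {B : Idx → A}
    (hB : ∀ a, B a - pbw u a ∈ lattice u qZq (above a)) : LinearIndependent Kq B := by
  classical
  rw [linearIndependent_iff']
  intro s r hs
  by_contra! hne
  obtain ⟨i, hi, hri⟩ := hne
  obtain ⟨j, hj, hmax⟩ := (s.filter (fun i => r i ≠ 0)).exists_max_image height
    ⟨i, Finset.mem_filter.mpr ⟨hi, hri⟩⟩
  obtain ⟨hjs, hrj⟩ := Finset.mem_filter.mp hj
  have h0 := congrArg (h.coord j) hs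
  rw [map_sum, map_zero, Finset.sum_eq_single_of_mem j hjs] at h0
  · rw [_root_.map_smul, h.coord_unitriangular hB le_rfl, if_pos rfl, smul_eq_mul, mul_one] at h0
    exact hrj h0
  · intro i his hij
    by_cases hr : r i = 0
    · rw [hr, zero_smul, map_zero]
    · rw [_root_.map_smul, h.coord_unitriangular hB (hmax i (Finset.mem_filter.mpr ⟨his, hr⟩)),
        if_neg hij, smul_zero]

theorem span_unitriangular (h : IsBarLadder u σ) {B : Idx → A}
    (hB : ∀ a, B a - pbw u a ∈ lattice u qZq (above a)) :
    Submodule.span Kq (Set.range B) = ⊤ := by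
  have key : ∀ n a, height a = n → pbw u a ∈ Submodule.span Kq (Set.range B) := by
    intro n
    induction n using Nat.strong_induction_on with
    | _ n ih =>
      intro a ha
      have h1 : B a - pbw u a ∈ Submodule.span Kq (Set.range B) :=
        lattice_map (M := (Submodule.span Kq (Set.range B)).toAddSubgroup) (AddMonoidHom.id A)
          (fun b hb c _ => Submodule.smul_mem _ c
            (ih _ (ha ▸ height_lt_of_mem_above hb) b rfl)) (hB a)
      have h2 := Submodule.sub_mem _ (Submodule.subset_span (Set.mem_range_self a)) h1
      rwa [sub_sub_cancel] at h2
  rw [← top_le_iff, ← h.span_pbw, Submodule.span_le]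
  rintro _ ⟨a, rfl⟩
  exact key _ a rfl

end IsBarLadder

end Lattice

end KroneckerQuantum

end

section
namespace KroneckerQuantum

/-! ### Quantum minors -/

section Minors

variable {k A : Type*} [Field k] [Ring A] [Algebra k A] {t : k} {x : Fin 4 → A}

variable (t x) in
/-- The quantum minor `Δ₁ = u₃ u₁ - q² u₂²`. -/
def minorOne : A := x 3 * x 1 - t ^ 2 • (x 2 * x 2)

variable (t x) in
/-- The quantum minor `Δ₀ = u₂ u₀ - q² u₁²`. -/
def minorZero : A := x 2 * x 0 - t ^ 2 • (x 1 * x 1)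

variable (t x) in
/-- The element `u₃ u₀ - q² u₂ u₁`. -/
def minorMid : A := x 3 * x 0 - t ^ 2 • (x 2 * x 1)

variable (t x) in
/-- The normalized product of the quantum minors. -/
def minorProd : A := (t ^ 2)⁻¹ • (minorOne t x * minorZero t x)

namespace IsLadder

theorem r10' (h : IsLadder t x) (y : A) : x 1 * (x 0 * y) = t ^ 2 • (x 0 * (x 1 * y)) := by
  rw [← mul_assoc, h.r10, smul_mul_assoc, mul_assoc]

theorem r21' (h : IsLadder t x) (y : A) : x 2 * (x 1 * y) = t ^ 2 • (x 1 * (x 2 * y)) := by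
  rw [← mul_assoc, h.r21, smul_mul_assoc, mul_assoc]

theorem r32' (h : IsLadder t x) (y : A) : x 3 * (x 2 * y) = t ^ 2 • (x 2 * (x 3 * y)) := by
  rw [← mul_assoc, h.r32, smul_mul_assoc, mul_assoc]

theorem r20' (h : IsLadder t x) (y : A) :
    x 2 * (x 0 * y) = t ^ 2 • (x 0 * (x 2 * y)) + (t ^ 2 - 1) • (x 1 * (x 1 * y)) := by
  rw [← mul_assoc, h.r20, add_mul, smul_mul_assoc, smul_mul_assoc, mul_assoc, mul_assoc]

theorem r31' (h : IsLadder t x) (y : A) :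
    x 3 * (x 1 * y) = t ^ 2 • (x 1 * (x 3 * y)) + (t ^ 2 - 1) • (x 2 * (x 2 * y)) := by
  rw [← mul_assoc, h.r31, add_mul, smul_mul_assoc, smul_mul_assoc, mul_assoc, mul_assoc]

theorem r30_low (h : IsLadder t x) (ht : t ≠ 0) :
    x 3 * x 0 = t ^ 2 • (x 0 * x 3) + (t ^ 4 - 1) • (x 1 * x 2) := by
  rw [h.r30, h.r21]
  match_scalars <;> field_simp

theorem r30' (h : IsLadder t x) (ht : t ≠ 0) (y : A) :
    x 3 * (x 0 * y) = t ^ 2 • (x 0 * (x 3 * y)) + (t ^ 4 - 1) • (x 1 * (x 2 * y)) := by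
  rw [← mul_assoc, h.r30_low ht, add_mul, smul_mul_assoc, smul_mul_assoc, mul_assoc, mul_assoc]

/-- This and the identities up to `minor_relation` are verified by rewriting both sides into
monomials with increasing indices, for which `r30_low` is the suitable form of the last relation. -/
theorem minorOne_three (h : IsLadder t x) (ht : t ≠ 0) :
    minorOne t x * x 3 = (t ^ 2)⁻¹ • (x 3 * minorOne t x) := by
  simp only [minorOne, mul_sub, sub_mul, mul_add, add_mul, mul_smul_comm, smul_mul_assoc, mul_assoc,
    h.r10, h.r21, h.r32, h.r20, h.r31, h.r30_low ht, h.r10', h.r21', h.r32', h.r20', h.r31',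
    h.r30' ht]
  match_scalars <;> field_simp <;> ring

theorem minorOne_two (h : IsLadder t x) (ht : t ≠ 0) :
    minorOne t x * x 2 = x 2 * minorOne t x := by
  simp only [minorOne, mul_sub, sub_mul, mul_add, add_mul, mul_smul_comm, smul_mul_assoc, mul_assoc,
    h.r10, h.r21, h.r32, h.r20, h.r31, h.r30_low ht, h.r10', h.r21', h.r32', h.r20', h.r31',
    h.r30' ht]

theorem minorOne_one (h : IsLadder t x) (ht : t ≠ 0) :
    minorOne t x * x 1 = t ^ 2 • (x 1 * minorOne t x) := by
  simp only [minorOne, mul_sub, sub_mul, mul_add, add_mul, mul_smul_comm, smul_mul_assoc, mul_assoc,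
    h.r10, h.r21, h.r32, h.r20, h.r31, h.r30_low ht, h.r10', h.r21', h.r32', h.r20', h.r31',
    h.r30' ht]
  match_scalars <;> field_simp <;> ring

theorem minorOne_zero (h : IsLadder t x) (ht : t ≠ 0) :
    minorOne t x * x 0 = t ^ 4 • (x 0 * minorOne t x) := by
  simp only [minorOne, mul_sub, sub_mul, mul_add, add_mul, mul_smul_comm, smul_mul_assoc, mul_assoc,
    h.r10, h.r21, h.r32, h.r20, h.r31, h.r30_low ht, h.r10', h.r21', h.r32', h.r20', h.r31',
    h.r30' ht]
  match_scalars <;> field_simp <;> ring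

theorem three_minorMid (h : IsLadder t x) (ht : t ≠ 0) :
    x 3 * minorMid t x - t ^ 2 • (minorMid t x * x 3)
      = (t ^ 2 - 1) • (minorOne t x * x 2) := by
  simp only [minorOne, minorMid, mul_sub, sub_mul, mul_add, add_mul, mul_smul_comm, smul_mul_assoc,
    mul_assoc, h.r10, h.r21, h.r32, h.r20, h.r31, h.r30_low ht, h.r10', h.r21', h.r32', h.r20',
    h.r31', h.r30' ht]
  match_scalars <;> field_simp <;> ring

theorem minorMid_two (h : IsLadder t x) (ht : t ≠ 0) :
    t ^ 2 • (minorMid t x * x 2) - x 2 * minorMid t x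
      = (1 - (t ^ 2)⁻¹) • (x 3 * minorZero t x) := by
  simp only [minorZero, minorMid, mul_sub, sub_mul, mul_add, mul_smul_comm, smul_mul_assoc,
    mul_assoc, h.r10, h.r21, h.r32, h.r20, h.r31, h.r30_low ht, h.r10', h.r21', h.r32', h.r20',
    h.r31', h.r30' ht, add_mul]
  match_scalars <;> field_simp <;> ring

/-- This supplies the hypothesis `h3` of `chebRight_last`. -/
theorem minor_relation (h : IsLadder t x) (ht : t ≠ 0) :
    minorProd t x + t ^ 2 • (minorMid t x * (x 2 * x 1))
      - (t ^ 2)⁻¹ • (minorOne t x * (x 2 * x 0)) - x 3 * (minorZero t x * x 1) = 0 := by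
  simp only [minorProd, minorOne, minorZero, minorMid, mul_sub, sub_mul, mul_add, mul_smul_comm,
    smul_mul_assoc, mul_assoc, h.r10, h.r21, h.r32, h.r20, h.r31, h.r30_low ht, h.r10', h.r21',
    h.r32', h.r20', h.r31', h.r30' ht, add_mul]
  match_scalars <;> field_simp <;> ring

/-! The relations are symmetric under reversal of the indices in the opposite algebra. -/

theorem op (h : IsLadder t x) :
    IsLadder t (fun i => MulOpposite.op (x (Fin.rev i))) where
  r10 := congrArg MulOpposite.op h.r32
  r21 := congrArg MulOpposite.op h.r21
  r32 := congrArg MulOpposite.op h.r10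
  r20 := congrArg MulOpposite.op h.r31
  r31 := congrArg MulOpposite.op h.r20
  r30 := congrArg MulOpposite.op h.r30

theorem op_minorOne : minorOne t (fun i => MulOpposite.op (x (Fin.rev i)))
    = MulOpposite.op (minorZero t x) := rfl

end IsLadder

end Minors

end KroneckerQuantum

end

section
namespace KroneckerQuantum

/-! ### Chebyshev-type recursions -/

section Chebyshev

variable {k A : Type*} [Field k] [Ring A] [Algebra k A] {t : k} {z T a b : A}

/-- The sequence `S 0 = 0`, `S 1 = 1`, `S (n + 2) = z S (n + 1) - T S n`. -/
def cheb (z T : A) : ℕ → A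
  | 0 => 0
  | 1 => 1
  | n + 2 => z * cheb z T (n + 1) - T * cheb z T n

theorem cheb_comm (hzT : z * T = T * z) (n : ℕ) :
    cheb z T n * z = z * cheb z T n ∧ cheb z T n * T = T * cheb z T n := by
  induction n using Nat.twoStepInduction with
  | zero => simp [cheb]
  | one => simp [cheb]
  | more n h h' =>
    simp only [cheb, sub_mul, mul_sub, mul_assoc, h.1, h.2, h'.1, h'.2]
    constructor
    · rw [← mul_assoc T z, ← hzT, mul_assoc]
    · rw [← mul_assoc z T, hzT, mul_assoc]

theorem cheb_succ (hzT : z * T = T * z) (n : ℕ) :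
    cheb z T (n + 2) = cheb z T (n + 1) * z - cheb z T n * T := by
  rw [cheb, (cheb_comm hzT _).1, (cheb_comm hzT _).2]

theorem op_cheb (hzT : z * T = T * z) (n : ℕ) :
    cheb (MulOpposite.op z) (MulOpposite.op T) n = MulOpposite.op (cheb z T n) := by
  induction n using Nat.twoStepInduction with
  | zero => rfl
  | one => rfl
  | more n h h' => rw [cheb, h, h', cheb_succ hzT]; rfl

variable (t z T a b) in
/-- The elements `a S (m + 1) - t² b S m`. -/
def chebRight (m : ℕ) : A := a * cheb z T (m + 1) - t ^ 2 • (b * cheb z T m)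

variable (t z T a b) in
/-- The elements `S (m + 1) a - t⁻² S m b`. -/
def chebLeft (m : ℕ) : A := cheb z T (m + 1) * a - (t ^ 2)⁻¹ • (cheb z T m * b)

theorem chebRight_zero : chebRight t z T a b 0 = a := by simp [chebRight, cheb]

theorem chebLeft_zero : chebLeft t z T a b 0 = a := by simp [chebLeft, cheb]

theorem chebRight_one : chebRight t z T a b 1 = a * z - t ^ 2 • b := by simp [chebRight, cheb]

theorem chebLeft_one : chebLeft t z T a b 1 = z * a - (t ^ 2)⁻¹ • b := by simp [chebLeft, cheb]

theorem chebRight_succ (hzT : z * T = T * z) (m : ℕ) :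
    chebRight t z T a b (m + 2) = chebRight t z T a b (m + 1) * z - chebRight t z T a b m * T := by
  simp only [chebRight, cheb_succ hzT, mul_sub, sub_mul, smul_mul_assoc, mul_assoc, smul_sub]
  abel

theorem chebLeft_succ (m : ℕ) :
    chebLeft t z T a b (m + 2) = z * chebLeft t z T a b (m + 1) - T * chebLeft t z T a b m := by
  simp only [chebLeft, cheb, mul_sub, sub_mul, mul_smul_comm, mul_assoc, smul_sub]
  abel

theorem mul_chebRight {c : k} (hzT : z * T = T * z) (ha : T * a = c • (a * T))
    (hb : T * b = c • (b * T)) (m : ℕ) :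
    T * chebRight t z T a b m = c • (chebRight t z T a b m * T) := by
  simp only [chebRight, mul_sub, sub_mul, mul_smul_comm, smul_mul_assoc, mul_assoc, smul_sub,
    (cheb_comm hzT _).2]
  rw [← mul_assoc T a, ← mul_assoc T b, ha, hb]
  simp only [smul_mul_assoc, mul_assoc]
  rw [smul_comm]

/-- Both sides satisfy the same second-order recursion in m, so the first two cases suffice. -/
theorem chebRight_mul (ht : t ≠ 0) (hzT : z * T = T * z)
    (h1 : a * z - t ^ 2 • (z * a) = (t ^ 2 - 1) • b)
    (h2 : t ^ 4 • (z * b) - b * z = (1 - (t ^ 2)⁻¹) • (a * T)) (m : ℕ) :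
    chebRight t z T a b (m + 1) * z - t ^ 2 • (z * chebRight t z T a b (m + 1))
      = (1 - (t ^ 2)⁻¹) • (chebRight t z T a b m * T) := by
  induction m using Nat.twoStepInduction with
  | zero =>
    rw [chebRight_zero, zero_add, chebRight_one]
    linear_combination (norm := skip) h2 + h1 * z
    simp only [mul_sub, sub_mul, mul_smul_comm, smul_mul_assoc, mul_assoc]
    match_scalars <;> field_simp <;> ring
  | one =>
    rw [chebRight_succ hzT, chebRight_zero, chebRight_one]
    linear_combination (norm := skip) (h2 + h1 * z) * z - h1 * T
    simp only [mul_sub, sub_mul, add_mul, mul_smul_comm, smul_mul_assoc, mul_assoc, hzT]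
    match_scalars <;> field_simp <;> ring
  | more m h h' =>
    rw [chebRight_succ hzT (m + 1)]
    linear_combination (norm := skip) h' * z - h * T
    rw [chebRight_succ hzT m]
    simp only [mul_sub, sub_mul, add_mul, mul_smul_comm, smul_mul_assoc, mul_assoc, hzT]
    match_scalars <;> field_simp <;> ring

/-- The right and left forms are exchanged by σ up to scalars, so this identity makes the rows
σ-eigenvectors. In the induction, `chebRight_mul` moves z and `mul_chebRight` moves T to the other
side. -/
theorem chebRight_eq (ht : t ≠ 0) (hzT : z * T = T * z)
    (h1 : a * z - t ^ 2 • (z * a) = (t ^ 2 - 1) • b)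
    (h2 : t ^ 4 • (z * b) - b * z = (1 - (t ^ 2)⁻¹) • (a * T))
    (ha : T * a = (t ^ 6)⁻¹ • (a * T)) (hb : T * b = (t ^ 6)⁻¹ • (b * T)) (m : ℕ) :
    chebRight t z T a b m = t ^ (2 * m) • chebLeft t z T a b m := by
  induction m using Nat.twoStepInduction with
  | zero => rw [chebRight_zero, chebLeft_zero]; simp
  | one =>
    rw [chebRight_one, chebLeft_one]
    linear_combination (norm := skip) h1
    simp only [smul_sub]
    match_scalars <;> field_simp <;> ring
  | more m h h' =>
    have e1 := chebRight_mul ht hzT h1 h2 m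
    have e2 := mul_chebRight (t := t) hzT ha hb m
    have e3 : t ^ (2 * (m + 2)) • chebLeft t z T a b (m + 2)
        = t ^ 2 • (z * chebRight t z T a b (m + 1)) - t ^ 4 • (T * chebRight t z T a b m) := by
      rw [chebLeft_succ, h, h']
      simp only [smul_sub, mul_smul_comm, smul_smul]
      match_scalars <;> ring
    rw [e3, chebRight_succ hzT]
    linear_combination (norm := skip) e1 + t ^ 4 • e2
    match_scalars <;> field_simp <;> ring

/-- In left form the factors S stand in front. Then `hz`, `h3` and `hy` reduce the claim to two
instances of the recursion of S. -/
theorem chebRight_last (ht : t ≠ 0) (hzT : z * T = T * z)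
    (h1 : a * z - t ^ 2 • (z * a) = (t ^ 2 - 1) • b)
    (h2 : t ^ 4 • (z * b) - b * z = (1 - (t ^ 2)⁻¹) • (a * T))
    (ha : T * a = (t ^ 6)⁻¹ • (a * T)) (hb : T * b = (t ^ 6)⁻¹ • (b * T))
    {x₀ w y : A} (hz : a * x₀ - t ^ 2 • y = z)
    (hy : T * y = (t ^ 4)⁻¹ • (b * w))
    (h3 : T + t ^ 2 • (z * y) - (t ^ 2)⁻¹ • (b * x₀) - a * w = 0) (m : ℕ) :
    chebRight t z T a b (m + 1) * x₀ - t ^ 2 • (chebRight t z T a b m * w)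
      = t ^ (2 * (m + 1)) • cheb z T (m + 3) := by
  rw [chebRight_eq ht hzT h1 h2 ha hb, chebRight_eq ht hzT h1 h2 ha hb]
  have e : chebLeft t z T a b (m + 1) * x₀ - chebLeft t z T a b m * w = cheb z T (m + 3) := by
    linear_combination (norm := skip) cheb z T (m + 1) * h3 + cheb z T (m + 2) * hz
      - cheb_succ hzT (m + 1) + t ^ 2 • (cheb_succ hzT m * y) - t ^ 2 • (cheb z T m * hy)
    simp only [chebLeft, mul_sub, sub_mul, mul_add, mul_smul_comm, smul_mul_assoc, mul_assoc,
      mul_zero]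
    match_scalars <;> field_simp <;> ring
  rw [← e]
  simp only [smul_sub, smul_mul_assoc, smul_smul]
  match_scalars <;> ring

end Chebyshev
end KroneckerQuantum

end

/-! ### Commutation of the minors and the rows built from them -/

section
namespace KroneckerQuantum

section Minors

variable {k A : Type*} [Field k] [Ring A] [Algebra k A] {t : k} {x : Fin 4 → A}

namespace IsLadder

/-- Statements on Δ₀ are those on Δ₁ read in the opposite algebra with the indices reversed. -/
theorem one_minorZero (h : IsLadder t x) (ht : t ≠ 0) :
    x 1 * minorZero t x = minorZero t x * x 1 :=
  congrArg MulOpposite.unop (h.op.minorOne_two ht)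

theorem two_minorZero (h : IsLadder t x) (ht : t ≠ 0) :
    x 2 * minorZero t x = t ^ 2 • (minorZero t x * x 2) :=
  congrArg MulOpposite.unop (h.op.minorOne_one ht)

theorem three_minorZero (h : IsLadder t x) (ht : t ≠ 0) :
    x 3 * minorZero t x = t ^ 4 • (minorZero t x * x 3) :=
  congrArg MulOpposite.unop (h.op.minorOne_zero ht)

theorem minorOne_minorMid (h : IsLadder t x) (ht : t ≠ 0) :
    minorOne t x * minorMid t x = t ^ 2 • (minorMid t x * minorOne t x) := by
  have e0 := h.minorOne_zero ht
  have e1 := h.minorOne_one ht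
  have e2 := h.minorOne_two ht
  have e3 := h.minorOne_three ht
  rw [minorMid]
  generalize minorOne t x = p at *
  rw [mul_sub, mul_smul_comm, ← mul_assoc, e3, smul_mul_assoc, mul_assoc, e0, ← mul_assoc, e2,
    mul_assoc, e1, sub_mul]
  simp only [mul_smul_comm, smul_mul_assoc, mul_assoc]
  match_scalars <;> field_simp

theorem minorMid_minorZero (h : IsLadder t x) (ht : t ≠ 0) :
    minorMid t x * minorZero t x = t ^ 2 • (minorZero t x * minorMid t x) :=
  congrArg MulOpposite.unop (h.op.minorOne_minorMid ht)

theorem minorOne_minorZero (h : IsLadder t x) (ht : t ≠ 0) :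
    minorOne t x * minorZero t x = t ^ 4 • (minorZero t x * minorOne t x) := by
  have e0 := h.minorOne_zero ht
  have e1 := h.minorOne_one ht
  have e2 := h.minorOne_two ht
  rw [minorZero]
  generalize minorOne t x = p at *
  rw [mul_sub, mul_smul_comm, ← mul_assoc, e2, mul_assoc, e0, ← mul_assoc, e1, smul_mul_assoc,
    mul_assoc, e1, sub_mul]
  simp only [mul_smul_comm, smul_mul_assoc, mul_assoc]
  match_scalars <;> ring

/-- The factors t² from passing Δ₁ and Δ₀ cancel. This is the commutation of z and T that the
sequence S requires. -/
theorem minorMid_minorProd (h : IsLadder t x) (ht : t ≠ 0) :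
    minorMid t x * minorProd t x = minorProd t x * minorMid t x := by
  rw [minorProd, mul_smul_comm, smul_mul_assoc, mul_assoc,
    show minorZero t x * minorMid t x = (t ^ 2)⁻¹ • (minorMid t x * minorZero t x) by
      rw [h.minorMid_minorZero ht, inv_smul_smul₀ (pow_ne_zero 2 ht)],
    mul_smul_comm, ← mul_assoc, ← mul_assoc, h.minorOne_minorMid ht, smul_mul_assoc,
    inv_smul_smul₀ (pow_ne_zero 2 ht)]

theorem minorProd_mul_of_skew (ht : t ≠ 0) {c d : k} {y : A} (hd : d ≠ 0)
    (h1 : minorOne t x * y = c • (y * minorOne t x))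
    (h0 : y * minorZero t x = d • (minorZero t x * y)) :
    minorProd t x * y = (c / d) • (y * minorProd t x) := by
  have h0' : minorZero t x * y = d⁻¹ • (y * minorZero t x) := by rw [h0, inv_smul_smul₀ hd]
  rw [minorProd, smul_mul_assoc, mul_assoc, h0', mul_smul_comm, ← mul_assoc, h1, smul_mul_assoc,
    mul_assoc, mul_smul_comm, smul_smul, smul_smul, smul_smul]
  congr 1
  field_simp

theorem minorProd_three (h : IsLadder t x) (ht : t ≠ 0) :
    minorProd t x * x 3 = (t ^ 6)⁻¹ • (x 3 * minorProd t x) := by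
  rw [minorProd_mul_of_skew ht (pow_ne_zero 4 ht) (h.minorOne_three ht) (h.three_minorZero ht)]
  congr 1
  field_simp

theorem minorProd_two (h : IsLadder t x) (ht : t ≠ 0) :
    minorProd t x * x 2 = (t ^ 2)⁻¹ • (x 2 * minorProd t x) := by
  rw [minorProd_mul_of_skew (c := 1) ht (pow_ne_zero 2 ht) (by rw [h.minorOne_two ht, one_smul])
    (h.two_minorZero ht), one_div]

theorem minorProd_minorOne (h : IsLadder t x) (ht : t ≠ 0) :
    minorProd t x * minorOne t x = (t ^ 4)⁻¹ • (minorOne t x * minorProd t x) := by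
  rw [minorProd_mul_of_skew (c := 1) ht (pow_ne_zero 4 ht) (by rw [one_smul])
    (h.minorOne_minorZero ht), one_div]

theorem minorProd_minorOne_two (h : IsLadder t x) (ht : t ≠ 0) :
    minorProd t x * (minorOne t x * x 2)
      = (t ^ 6)⁻¹ • (minorOne t x * x 2 * minorProd t x) := by
  rw [← mul_assoc, h.minorProd_minorOne ht, smul_mul_assoc, mul_assoc, h.minorProd_two ht,
    mul_smul_comm, smul_smul, ← mul_assoc]
  congr 1
  field_simp

theorem minorMid_minorOne_two (h : IsLadder t x) (ht : t ≠ 0) :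
    t ^ 4 • (minorMid t x * (minorOne t x * x 2)) - minorOne t x * x 2 * minorMid t x
      = (1 - (t ^ 2)⁻¹) • (x 3 * minorProd t x) := by
  have e1 := h.minorOne_minorMid ht
  have e2 := h.minorMid_two ht
  have e3 := h.minorOne_three ht
  rw [minorProd]
  generalize minorOne t x = p at *
  generalize minorMid t x = z at *
  generalize minorZero t x = p' at *
  linear_combination (norm := skip) p * e2 - t ^ 2 • (e1 * x 2) +(1 - (t ^ 2)⁻¹) • (e3 * p')
  simp only [mul_sub, sub_mul, mul_smul_comm, smul_mul_assoc, mul_assoc]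
  match_scalars <;> field_simp <;> ring

theorem minorProd_two_one (h : IsLadder t x) (ht : t ≠ 0) :
    minorProd t x * (x 2 * x 1)
      = (t ^ 4)⁻¹ • (minorOne t x * x 2 * (minorZero t x * x 1)) := by
  rw [mul_assoc, ← mul_assoc (x 2) (minorZero t x), h.two_minorZero ht, minorProd]
  simp only [mul_smul_comm, smul_mul_assoc, mul_assoc, smul_smul]
  congr 1
  field_simp

end IsLadder

variable (t x) in
/-- The sequence `S n` attached to `u₃ u₀ - q² u₂ u₁`. -/
abbrev minorCheb (n : ℕ) : A := cheb (minorMid t x) (minorProd t x) n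

variable (t x) in
/-- The elements `u₃ S (m + 1) - q² Δ₁ u₂ S m`. -/
def leftRow (m : ℕ) : A :=
  x 3 * minorCheb t x (m + 1) - t ^ 2 • (minorOne t x * x 2 * minorCheb t x m)

variable (t x) in
/-- The elements `S (m + 1) u₀ - q² S m u₁ Δ₀`. -/
def rightRow (m : ℕ) : A :=
  minorCheb t x (m + 1) * x 0 - t ^ 2 • (minorCheb t x m * (x 1 * minorZero t x))

namespace IsLadder

/-- `chebRight_eq` with a = u₃ and b = Δ₁u₂. -/
theorem leftRow_eq (h : IsLadder t x) (ht : t ≠ 0) (m : ℕ) :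
    leftRow t x m = t ^ (2 * m) • (minorCheb t x (m + 1) * x 3
      - (t ^ 2)⁻¹ • (minorCheb t x m * (minorOne t x * x 2))) :=
  chebRight_eq ht (h.minorMid_minorProd ht) (h.three_minorMid ht) (h.minorMid_minorOne_two ht)
    (h.minorProd_three ht) (h.minorProd_minorOne_two ht) m

theorem leftRow_last (h : IsLadder t x) (ht : t ≠ 0) (m : ℕ) :
    leftRow t x (m + 1) * x 0 - t ^ 2 • (leftRow t x m * (minorZero t x * x 1))
      = t ^ (2 * (m + 1)) • minorCheb t x (m + 3) :=
  chebRight_last ht (h.minorMid_minorProd ht) (h.three_minorMid ht) (h.minorMid_minorOne_two ht)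
    (h.minorProd_three ht) (h.minorProd_minorOne_two ht) rfl (h.minorProd_two_one ht)
    (by simpa only [mul_assoc] using h.minor_relation ht) m

theorem op_minorCheb (h : IsLadder t x) (ht : t ≠ 0) (n : ℕ) :
    minorCheb t (fun i => MulOpposite.op (x (Fin.rev i))) n
      = MulOpposite.op (minorCheb t x n) :=
  op_cheb (h.minorMid_minorProd ht) n

theorem op_leftRow (h : IsLadder t x) (ht : t ≠ 0) (m : ℕ) :
    leftRow t (fun i => MulOpposite.op (x (Fin.rev i))) m = MulOpposite.op (rightRow t x m) := by
  rw [leftRow, h.op_minorCheb ht, h.op_minorCheb ht]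
  rfl

theorem rightRow_eq (h : IsLadder t x) (ht : t ≠ 0) (m : ℕ) :
    rightRow t x m = t ^ (2 * m) • (x 0 * minorCheb t x (m + 1)
      - (t ^ 2)⁻¹ • (x 1 * minorZero t x * minorCheb t x m)) := by
  have := h.op.leftRow_eq ht m
  rw [h.op_leftRow ht, h.op_minorCheb ht, h.op_minorCheb ht] at this
  exact congrArg MulOpposite.unop this

theorem rightRow_last (h : IsLadder t x) (ht : t ≠ 0) (m : ℕ) :
    x 3 * rightRow t x (m + 1) - t ^ 2 • (x 2 * minorOne t x * rightRow t x m)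
      = t ^ (2 * (m + 1)) • minorCheb t x (m + 3) := by
  have := h.op.leftRow_last ht m
  rw [h.op_leftRow ht, h.op_leftRow ht, h.op_minorCheb ht] at this
  exact congrArg MulOpposite.unop this

/-! ### Products of quantum minors and ordered monomials -/

theorem pow_mul_of_skew {x y : A} {c : k} (h : x * y = c • (y * x)) (n : ℕ) :
    x ^ n * y = c ^ n • (y * x ^ n) := by
  induction n with
  | zero => simp
  | succ n ih =>
    rw [pow_succ, mul_assoc, h, mul_smul_comm, ← mul_assoc, ih, smul_mul_assoc, smul_smul,
      mul_assoc, ← pow_succ']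

/-- Δ₁ is first carried past the powers of u₃ and u₂ and only then expanded, so each of its two
terms lands in an ordered monomial. -/
theorem minorOne_mono (h : IsLadder t x) (ht : t ≠ 0) (b : Idx) :
    minorOne t x * mono x b
      = ((t ^ 2)⁻¹ ^ b.1 * (t ^ 2)⁻¹ ^ b.2.1) • mono x (b + (1, 0, 1, 0))
        - (t ^ 2 * (t ^ 2)⁻¹ ^ b.1) • mono x (b + (0, 2, 0, 0)) := by
  obtain ⟨b₃, b₂, b₁, b₀⟩ := b
  change minorOne t x * (x 3 ^ b₃ * x 2 ^ b₂ * x 1 ^ b₁ * x 0 ^ b₀)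
    = ((t ^ 2)⁻¹ ^ b₃ * (t ^ 2)⁻¹ ^ b₂) • (x 3 ^ (b₃ + 1) * x 2 ^ b₂ * x 1 ^ (b₁ + 1) * x 0 ^ b₀)
      - (t ^ 2 * (t ^ 2)⁻¹ ^ b₃) • (x 3 ^ b₃ * x 2 ^ (b₂ + 2) * x 1 ^ b₁ * x 0 ^ b₀)
  have e2 : minorOne t x * x 2 ^ b₂ = x 2 ^ b₂ * minorOne t x :=
    (Commute.pow_right (h.minorOne_two ht) b₂ :)
  have e3 : x 2 ^ b₂ * x 3 = (t ^ 2)⁻¹ ^ b₂ • (x 3 * x 2 ^ b₂) := pow_mul_of_skew (h.r23 ht) b₂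
  have e : minorOne t x * (x 3 ^ b₃ * x 2 ^ b₂)
      = (t ^ 2)⁻¹ ^ b₃ • (x 3 ^ b₃ * ((t ^ 2)⁻¹ ^ b₂ • (x 3 * x 2 ^ b₂) * x 1
        - t ^ 2 • (x 2 ^ b₂ * (x 2 * x 2)))) := by
    rw [← mul_assoc, mul_pow_of_skew (h.minorOne_three ht), smul_mul_assoc, mul_assoc, e2,
      minorOne, mul_sub, mul_smul_comm, ← mul_assoc (x 2 ^ b₂), e3]
  rw [mul_assoc _ (x 1 ^ b₁), ← mul_assoc, e]
  simp only [pow_succ (x 3), pow_succ' (x 1), pow_add, mul_sub, sub_mul, mul_smul_comm,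
    smul_mul_assoc, mul_assoc, smul_sub, smul_smul, pow_two (x 2)]
  rw [mul_comm (t ^ 2)]

theorem minorOne_mono_comm (h : IsLadder t x) (ht : t ≠ 0) (b : Idx) :
    minorOne t x * mono x b
      = ((t ^ 2)⁻¹ ^ b.1 * (t ^ 2) ^ b.2.2.1 * (t ^ 4) ^ b.2.2.2) •
        (mono x b * minorOne t x) := by
  obtain ⟨b₃, b₂, b₁, b₀⟩ := b
  change minorOne t x * (x 3 ^ b₃ * x 2 ^ b₂ * x 1 ^ b₁ * x 0 ^ b₀)
    = ((t ^ 2)⁻¹ ^ b₃ * (t ^ 2) ^ b₁ * (t ^ 4) ^ b₀) •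
      (x 3 ^ b₃ * x 2 ^ b₂ * x 1 ^ b₁ * x 0 ^ b₀ * minorOne t x)
  have e2 : minorOne t x * x 2 ^ b₂ = x 2 ^ b₂ * minorOne t x :=
    (Commute.pow_right (h.minorOne_two ht) b₂ :)
  rw [← mul_assoc, ← mul_assoc, ← mul_assoc, mul_pow_of_skew (h.minorOne_three ht),
    smul_mul_assoc, smul_mul_assoc, smul_mul_assoc, mul_assoc (x 3 ^ b₃), e2, ← mul_assoc,
    mul_assoc _ (minorOne t x), mul_pow_of_skew (h.minorOne_one ht), mul_smul_comm,
    smul_mul_assoc, ← mul_assoc, mul_assoc _ (minorOne t x),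
    mul_pow_of_skew (h.minorOne_zero ht), mul_smul_comm, smul_smul, smul_smul, ← mul_assoc,
    mul_assoc ((t ^ 2)⁻¹ ^ b₃)]

theorem op_mono (b₃ b₂ b₁ b₀ : ℕ) :
    mono (fun i => MulOpposite.op (x (Fin.rev i))) (b₀, b₁, b₂, b₃)
      = MulOpposite.op (mono x (b₃, b₂, b₁, b₀)) := by
  refine MulOpposite.unop_injective ?_
  change x 3 ^ b₃ * (x 2 ^ b₂ * (x 1 ^ b₁ * x 0 ^ b₀)) = x 3 ^ b₃ * x 2 ^ b₂ * x 1 ^ b₁ * x 0 ^ b₀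
  simp only [mul_assoc]

end IsLadder

end Minors
end KroneckerQuantum

end

section
namespace KroneckerQuantum

section Lattice

variable {A : Type*} [Ring A] [Algebra Kq A] {u : Fin 4 → A}

/-! ### Products with dual PBW elements -/

theorem smul_mono_eq_pbw {c : Kq} {n : ℤ} {b : Idx} (hc : c = q ^ (n + pbwExp b)) :
    c • mono u b = q ^ n • pbw u b := by
  rw [mono_eq, smul_smul, hc, ← zpow_add₀ q_ne_zero, add_neg_cancel_right]

theorem op_pbw (b₃ b₂ b₁ b₀ : ℕ) :
    pbw (fun i => MulOpposite.op (u (Fin.rev i))) (b₀, b₁, b₂, b₃)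
      = MulOpposite.op (pbw u (b₃, b₂, b₁, b₀)) := by
  rw [pbw_eq, IsLadder.op_mono, pbw_eq, MulOpposite.op_smul]
  congr 2
  simp only [pbwExp]
  omega

theorem choose_two_succ (n : ℕ) : (n + 1).choose 2 = n.choose 2 + n := by
  rw [Nat.choose_succ_succ', Nat.choose_one_right, add_comm]

theorem three_mul_pbw (b : Idx) :
    u 3 * pbw u b = q ^ (-(b.1 : ℤ)) • pbw u (b + (1, 0, 0, 0)) := by
  obtain ⟨b₃, b₂, b₁, b₀⟩ := b
  rw [pbw_eq, mul_smul_comm, ← mono_succ_three]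
  refine smul_mono_eq_pbw ?_
  simp only [Prod.mk_add_mk, pbwExp, choose_two_succ, ← zpow_natCast]
  congr 1
  push_cast
  ring

theorem two_mul_pbw (hu : IsLadder q u) (b : Idx) :
    u 2 * pbw u b = q ^ (-2 * (b.1 : ℤ) - b.2.1) • pbw u (b + (0, 1, 0, 0)) := by
  obtain ⟨b₃, b₂, b₁, b₀⟩ := b
  have : u 2 * mono u (b₃, b₂, b₁, b₀)
      = q ^ (-2 * (b₃ : ℤ)) • mono u ((b₃, b₂, b₁, b₀) + (0, 1, 0, 0)) := by
    change u 2 * (u 3 ^ b₃ * u 2 ^ b₂ * u 1 ^ b₁ * u 0 ^ b₀) =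
      q ^ (-2 * (b₃ : ℤ)) • (u 3 ^ b₃ * u 2 ^ (b₂ + 1) * u 1 ^ b₁ * u 0 ^ b₀)
    rw [← q_neg_two_pow, pow_succ' (u 2)]
    simp only [← mul_assoc]
    rw [mul_pow_of_skew (hu.r23 q_ne_zero)]
    simp only [smul_mul_assoc, mul_assoc]
  rw [pbw_eq, mul_smul_comm, this, smul_smul]
  refine smul_mono_eq_pbw ?_
  simp only [Prod.mk_add_mk, pbwExp, choose_two_succ, ← zpow_natCast, ← zpow_add₀ q_ne_zero]
  congr 1
  push_cast
  ring

theorem pbw_mul_zero (b : Idx) :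
    pbw u b * u 0 = q ^ (-(b.2.2.2 : ℤ)) • pbw u (b + (0, 0, 0, 1)) := by
  obtain ⟨b₃, b₂, b₁, b₀⟩ := b
  have := three_mul_pbw (u := fun i => MulOpposite.op (u (Fin.rev i))) (b₀, b₁, b₂, b₃)
  simp only [Prod.mk_add_mk, op_pbw] at this ⊢
  exact congrArg MulOpposite.unop this

theorem pbw_mul_one (hu : IsLadder q u) (b : Idx) :
    pbw u b * u 1 = q ^ (-2 * (b.2.2.2 : ℤ) - b.2.2.1) • pbw u (b + (0, 0, 1, 0)) := by
  obtain ⟨b₃, b₂, b₁, b₀⟩ := b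
  have := two_mul_pbw hu.op (b₀, b₁, b₂, b₃)
  simp only [Prod.mk_add_mk, op_pbw] at this ⊢
  exact congrArg MulOpposite.unop this

/-- The exponent of `q` in the product of `Δ₁` and a dual canonical basis element. -/
def minorOneExp (b : Idx) : ℤ := 3 * b.1 + 2 * b.2.1 + b.2.2.1

/-- The exponent of `q` in the product of a dual canonical basis element and `Δ₀`. -/
def minorZeroExp (b : Idx) : ℤ := 3 * b.2.2.2 + 2 * b.2.2.1 + b.2.1

/-- The normalization gives leading coefficient 1 and puts the other coefficient in qℤ[q], so that
multiplication by Δ₁ preserves unitriangularity. -/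
theorem minorOne_mul_pbw (hu : IsLadder q u) (b : Idx) :
    q ^ minorOneExp b • (minorOne q u * pbw u b)
      = pbw u (b + (1, 0, 1, 0))
        - q ^ (1 + (b.1 : ℤ) + b.2.2.1) • pbw u (b + (0, 2, 0, 0)) := by
  obtain ⟨b₃, b₂, b₁, b₀⟩ := b
  rw [pbw_eq, mul_smul_comm, hu.minorOne_mono q_ne_zero, smul_sub, smul_sub, smul_smul, smul_smul,
    smul_smul, smul_smul]
  conv_rhs => rw [← one_smul Kq (pbw u ((b₃, b₂, b₁, b₀) + (1, 0, 1, 0))), ← zpow_zero q]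
  congr 1
  all_goals
    refine smul_mono_eq_pbw ?_
    simp only [Prod.mk_add_mk, pbwExp, choose_two_succ, q_neg_two_pow, minorOneExp]
    simp only [← zpow_natCast q, ← zpow_add₀ q_ne_zero]
    congr 1
    push_cast [choose_two_succ]
    ring

theorem minorOne_mul_pbw_comm (hu : IsLadder q u) (b : Idx) :
    minorOne q u * pbw u b
      = q ^ (-2 * (b.1 : ℤ) + 2 * b.2.2.1 + 4 * b.2.2.2) • (pbw u b * minorOne q u) := by
  rw [pbw_eq, mul_smul_comm, hu.minorOne_mono_comm q_ne_zero, smul_mul_assoc, smul_comm]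
  congr 2
  rw [q_neg_two_pow, ← pow_mul, ← pow_mul, ← zpow_natCast q, ← zpow_natCast q,
    ← zpow_add₀ q_ne_zero, ← zpow_add₀ q_ne_zero]
  congr 1

theorem pbw_mul_minorZero (hu : IsLadder q u) (b : Idx) :
    q ^ minorZeroExp b • (pbw u b * minorZero q u)
      = pbw u (b + (0, 1, 0, 1))
        - q ^ (1 + (b.2.2.2 : ℤ) + b.2.1) • pbw u (b + (0, 0, 2, 0)) := by
  obtain ⟨b₃, b₂, b₁, b₀⟩ := b
  have := minorOne_mul_pbw hu.op (b₀, b₁, b₂, b₃)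
  simp only [Prod.mk_add_mk, op_pbw, IsLadder.op_minorOne] at this ⊢
  exact congrArg MulOpposite.unop this

theorem pbw_mul_minorZero_comm (hu : IsLadder q u) (b : Idx) :
    pbw u b * minorZero q u
      = q ^ (-2 * (b.2.2.2 : ℤ) + 2 * b.2.1 + 4 * b.1) • (minorZero q u * pbw u b) := by
  obtain ⟨b₃, b₂, b₁, b₀⟩ := b
  have := minorOne_mul_pbw_comm hu.op (b₀, b₁, b₂, b₃)
  simp only [op_pbw, IsLadder.op_minorOne] at this ⊢
  exact congrArg MulOpposite.unop this

/-! ### Unitriangular elements -/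

variable (u) in
/-- `x` is `E[a]`, up to a combination of higher `E[b]` with coefficients in `q ℤ[q]`. -/
def IsUnitriangular (a : Idx) (x : A) : Prop := x - pbw u a ∈ lattice u qZq (above a)

theorem isUnitriangular_pbw (a : Idx) : IsUnitriangular u a (pbw u a) := by
  rw [IsUnitriangular, sub_self]
  exact zero_mem _

theorem IsUnitriangular.sub {a : Idx} {x y : A} (hx : IsUnitriangular u a x)
    (hy : y ∈ lattice u qZq (above a)) : IsUnitriangular u a (x - y) := by
  have := sub_mem hx hy
  rwa [sub_right_comm] at this

theorem IsUnitriangular.map {φ : A →ₗ[Kq] A} {f : Idx → ℤ} {e : Idx}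
    (hφ : ∀ b, φ (pbw u b) = q ^ f b • pbw u (b + e)) {a : Idx}
    (hf : ∀ b, Below a b → 0 ≤ f b) (h0 : f a = 0) {x : A} (hx : IsUnitriangular u a x) :
    IsUnitriangular u (a + e) (φ x) := by
  have h1 : φ x - φ (pbw u a) ∈ lattice u qZq (above (a + e)) := by
    rw [← map_sub]
    refine lattice_map φ.toAddMonoidHom (fun b hb c hc => ?_) hx
    change φ (c • pbw u b) ∈ _
    rw [map_smul, hφ, smul_smul, mul_comm]
    exact smul_pbw_mem (add_mem_above hb e) (zpow_mul_mem_qZq (hf b hb.1) hc)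
  rwa [hφ, h0, zpow_zero, one_smul] at h1

theorem IsUnitriangular.map_mem {φ : A →ₗ[Kq] A} {f : Idx → ℤ} {e : Idx}
    (hφ : ∀ b, φ (pbw u b) = q ^ f b • pbw u (b + e)) {a a' : Idx}
    (hf : ∀ b, Below a b → 1 ≤ f b) (ha : a + e ∈ above a') {x : A}
    (hx : IsUnitriangular u a x) : φ x ∈ lattice u qZq (above a') := by
  have h1 : φ x - φ (pbw u a) ∈ lattice u qZq (above a') := by
    rw [← map_sub]
    refine lattice_map φ.toAddMonoidHom (fun b hb c hc => ?_) hx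
    change φ (c • pbw u b) ∈ _
    rw [map_smul, hφ, smul_smul, mul_comm]
    exact smul_pbw_mem (mem_above_of_below ha (hb.1.add e))
      (zpow_mul_mem_qZq ((hf b hb.1).trans' zero_le_one) hc)
  have h2 : φ (pbw u a) ∈ lattice u qZq (above a') := by
    rw [hφ]
    exact smul_pbw_mem ha (q_zpow_mem_qZq (hf a (Below.refl a)))
  simpa using add_mem h1 h2

theorem Below.minorOneExp_eq {a b : Idx} (h : Below a b) : minorOneExp b = minorOneExp a := by
  obtain ⟨a₃, a₂, a₁, a₀⟩ := a
  obtain ⟨b₃, b₂, b₁, b₀⟩ := b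
  obtain ⟨r, s, h₃, h₂, h₁, h₀⟩ := h
  simp only [minorOneExp]
  omega

theorem Below.minorZeroExp_eq {a b : Idx} (h : Below a b) : minorZeroExp b = minorZeroExp a := by
  obtain ⟨a₃, a₂, a₁, a₀⟩ := a
  obtain ⟨b₃, b₂, b₁, b₀⟩ := b
  obtain ⟨r, s, h₃, h₂, h₁, h₀⟩ := h
  simp only [minorZeroExp]
  omega

theorem IsUnitriangular.map_of_eq_sub {φ : A →ₗ[Kq] A} {f : Idx → ℤ} {e e' : Idx} {a : Idx}
    (hφ : ∀ b, Below a b → φ (pbw u b) = pbw u (b + e) - q ^ f b • pbw u (b + e'))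
    (hf : ∀ b, 1 ≤ f b) (he : e' ∈ above e) {x : A} (hx : IsUnitriangular u a x) :
    IsUnitriangular u (a + e) (φ x) := by
  have he' : ∀ b, b + e' ∈ above (b + e) := fun b => by
    rw [add_comm b, add_comm b]
    exact add_mem_above he b
  have h1 : φ x - φ (pbw u a) ∈ lattice u qZq (above (a + e)) := by
    rw [← map_sub]
    refine lattice_map φ.toAddMonoidHom (fun b hb c hc => ?_) hx
    change φ (c • pbw u b) ∈ _
    rw [map_smul, hφ b hb.1, smul_sub, smul_smul, mul_comm]
    exact sub_mem (smul_pbw_mem (add_mem_above hb e) hc)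
      (smul_pbw_mem (mem_above_of_below (add_mem_above hb e) (he' b).1)
        (zpow_mul_mem_qZq ((hf b).trans' zero_le_one) hc))
  have h2 : φ (pbw u a) - pbw u (a + e) ∈ lattice u qZq (above (a + e)) := by
    rw [hφ a (Below.refl a), sub_sub_cancel_left]
    exact neg_mem (smul_pbw_mem (he' a) (q_zpow_mem_qZq (hf a)))
  have := add_mem h1 h2
  rwa [sub_add_sub_cancel] at this

theorem IsUnitriangular.minorOne_mul (hu : IsLadder q u) {a : Idx} {x : A}
    (hx : IsUnitriangular u a x) :
    IsUnitriangular u (a + (1, 0, 1, 0)) (q ^ minorOneExp a • (minorOne q u * x)) := by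
  refine IsUnitriangular.map_of_eq_sub
    (φ := q ^ minorOneExp a • LinearMap.mulLeft Kq (minorOne q u)) (e' := (0, 2, 0, 0))
    (f := fun b => 1 + (b.1 : ℤ) + b.2.2.1) (fun b hb => ?_) (fun b => ?_) ⟨⟨1, 0, by simp⟩, by simp⟩ hx
  · rw [← hb.minorOneExp_eq]
    exact minorOne_mul_pbw hu b
  · omega

theorem IsUnitriangular.mul_minorZero (hu : IsLadder q u) {a : Idx} {x : A}
    (hx : IsUnitriangular u a x) :
    IsUnitriangular u (a + (0, 1, 0, 1)) (q ^ minorZeroExp a • (x * minorZero q u)) := by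
  refine IsUnitriangular.map_of_eq_sub
    (φ := q ^ minorZeroExp a • LinearMap.mulRight Kq (minorZero q u)) (e' := (0, 0, 2, 0))
    (f := fun b => 1 + (b.2.2.2 : ℤ) + b.2.1) (fun b hb => ?_) (fun b => ?_) ⟨⟨0, 1, by simp⟩, by simp⟩ hx
  · rw [← hb.minorZeroExp_eq]
    exact pbw_mul_minorZero hu b
  · omega

/-- The exponent of q is a linear form in the index that vanishes on both generators of the order,
so it is the same for every E[b] occurring in x. -/
theorem IsUnitriangular.minorOne_mul_comm (hu : IsLadder q u) {a : Idx} {x : A}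
    (hx : IsUnitriangular u a x) :
    minorOne q u * x
      = q ^ (-2 * (a.1 : ℤ) + 2 * a.2.2.1 + 4 * a.2.2.2) • (x * minorOne q u) := by
  set n := -2 * (a.1 : ℤ) + 2 * a.2.2.1 + 4 * a.2.2.2 with hn
  let φ : A →ₗ[Kq] A :=
    LinearMap.mulLeft Kq (minorOne q u) - q ^ n • LinearMap.mulRight Kq (minorOne q u)
  have hφ : ∀ b, Below a b → φ (pbw u b) = 0 := fun b hb => by
    change minorOne q u * pbw u b - q ^ n • (pbw u b * minorOne q u) = 0
    rw [minorOne_mul_pbw_comm hu, sub_eq_zero]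
    congr 2
    obtain ⟨a₃, a₂, a₁, a₀⟩ := a
    obtain ⟨b₃, b₂, b₁, b₀⟩ := b
    obtain ⟨r, s, h₃, h₂, h₁, h₀⟩ := hb
    simp only at hn ⊢
    omega
  have h1 : φ (x - pbw u a) ∈ (⊥ : AddSubgroup A) :=
    lattice_map φ.toAddMonoidHom (fun b hb c _ => by
      change φ (c • pbw u b) = 0
      rw [map_smul, hφ b hb.1, smul_zero]) hx
  have h2 : φ (x - pbw u a) = 0 := h1
  rw [map_sub, hφ a (Below.refl a), sub_zero] at h2
  exact sub_eq_zero.mp h2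

theorem IsUnitriangular.mul_minorZero_comm (hu : IsLadder q u) {a : Idx} {x : A}
    (hx : IsUnitriangular u a x) :
    x * minorZero q u
      = q ^ (-2 * (a.2.2.2 : ℤ) + 2 * a.2.1 + 4 * a.1) • (minorZero q u * x) := by
  set n := -2 * (a.2.2.2 : ℤ) + 2 * a.2.1 + 4 * a.1 with hn
  let φ : A →ₗ[Kq] A :=
    LinearMap.mulRight Kq (minorZero q u) - q ^ n • LinearMap.mulLeft Kq (minorZero q u)
  have hφ : ∀ b, Below a b → φ (pbw u b) = 0 := fun b hb => by
    change pbw u b * minorZero q u - q ^ n • (minorZero q u * pbw u b) = 0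
    rw [pbw_mul_minorZero_comm hu, sub_eq_zero]
    congr 2
    obtain ⟨a₃, a₂, a₁, a₀⟩ := a
    obtain ⟨b₃, b₂, b₁, b₀⟩ := b
    obtain ⟨r, s, h₃, h₂, h₁, h₀⟩ := hb
    simp only at hn ⊢
    omega
  have h1 : φ (x - pbw u a) ∈ (⊥ : AddSubgroup A) :=
    lattice_map φ.toAddMonoidHom (fun b hb c _ => by
      change φ (c • pbw u b) = 0
      rw [map_smul, hφ b hb.1, smul_zero]) hx
  have h2 : φ (x - pbw u a) = 0 := h1
  rw [map_sub, hφ a (Below.refl a), sub_zero] at h2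
  exact sub_eq_zero.mp h2

end Lattice

end KroneckerQuantum

end

/-! ### The involution on minors, rows and products with minors -/

section
namespace KroneckerQuantum

section Minors

variable {k A : Type*} [Field k] [Ring A] [Algebra k A] {t : k} {x : Fin 4 → A}

namespace IsLadder

theorem reverse_minorOne (h : IsLadder t x) (ht : t ≠ 0) :
    t ^ 8 • (x 1 * x 3) - (t ^ 2)⁻¹ • t ^ 8 • (x 2 * x 2) = t ^ 6 • minorOne t x := by
  rw [h.r13 ht, minorOne]
  match_scalars <;> field_simp <;> ring

theorem reverse_minorZero (h : IsLadder t x) (ht : t ≠ 0) :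
    t ^ 4 • (x 0 * x 2) - (t ^ 2)⁻¹ • t ^ 4 • (x 1 * x 1) = t ^ 2 • minorZero t x := by
  rw [h.r02 ht, minorZero]
  match_scalars <;> field_simp <;> ring

theorem reverse_minorMid (h : IsLadder t x) (ht : t ≠ 0) :
    t ^ 6 • (x 0 * x 3) - (t ^ 2)⁻¹ • t ^ 6 • (x 1 * x 2) = t ^ 4 • minorMid t x := by
  rw [h.r03 ht, h.r12 ht, minorMid]
  match_scalars <;> field_simp <;> ring

theorem reverse_minorProd (h : IsLadder t x) (ht : t ≠ 0) :
    t ^ 2 • (t ^ 2 • minorZero t x * t ^ 6 • minorOne t x) = t ^ 8 • minorProd t x := by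
  rw [minorProd, h.minorOne_minorZero ht]
  simp only [mul_smul_comm, smul_mul_assoc, smul_smul]
  congr 1
  field_simp

end IsLadder

end Minors

section Lattice

variable {A : Type*} [Ring A] [Algebra Kq A] {u : Fin 4 → A} {σ : A →+ A}

variable (u σ) in
/-- `x` is the dual canonical basis element attached to `a`. -/
def IsCanonical (a : Idx) (x : A) : Prop :=
  IsUnitriangular u a x ∧ σ x = q ^ (-normN a) • x

namespace IsBarLadder

theorem unique (h : IsBarLadder u σ) {a : Idx} {x y : A} (hx : IsCanonical u σ a x)
    (hy : IsCanonical u σ a y) : x = y := h.canonical_unique hx.1 hx.2 hy.1 hy.2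

theorem map_zpow_smul (h : IsBarLadder u σ) (n : ℤ) (x : A) :
    σ (q ^ n • x) = q ^ (-n) • σ x := by rw [h.map_smul, bar_zpow]

theorem map_u_three (h : IsBarLadder u σ) : σ (u 3) = q ^ 6 • u 3 := h.map_u 3

theorem map_u_two (h : IsBarLadder u σ) : σ (u 2) = q ^ 4 • u 2 := h.map_u 2

theorem map_u_one (h : IsBarLadder u σ) : σ (u 1) = q ^ 2 • u 1 := h.map_u 1

theorem map_u_zero (h : IsBarLadder u σ) : σ (u 0) = u 0 := by
  have := h.map_u 0
  rwa [Fin.val_zero, mul_zero, pow_zero, one_smul] at this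

theorem map_minorOne (h : IsBarLadder u σ) : σ (minorOne q u) = q ^ 6 • minorOne q u := by
  rw [← h.ladder.reverse_minorOne q_ne_zero, minorOne, map_sub, h.map_smul, h.map_mul, h.map_mul,
    h.map_u_three, h.map_u_two, h.map_u_one, bar_pow, smul_mul_smul_comm, smul_mul_smul_comm,
    ← pow_add, ← pow_add]

theorem map_minorZero (h : IsBarLadder u σ) : σ (minorZero q u) = q ^ 2 • minorZero q u := by
  rw [← h.ladder.reverse_minorZero q_ne_zero, minorZero, map_sub, h.map_smul, h.map_mul, h.map_mul,
    h.map_u_zero, h.map_u_two, h.map_u_one, bar_pow, smul_mul_smul_comm, mul_smul_comm, ← pow_add]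

theorem map_minorMid (h : IsBarLadder u σ) : σ (minorMid q u) = q ^ 4 • minorMid q u := by
  rw [← h.ladder.reverse_minorMid q_ne_zero, minorMid, map_sub, h.map_smul, h.map_mul, h.map_mul,
    h.map_u_zero, h.map_u_three, h.map_u_two, h.map_u_one, bar_pow, smul_mul_smul_comm,
    mul_smul_comm, ← pow_add]

theorem map_minorProd (h : IsBarLadder u σ) : σ (minorProd q u) = q ^ 8 • minorProd q u := by
  rw [← h.ladder.reverse_minorProd q_ne_zero, minorProd, h.map_smul, h.map_mul, h.map_minorZero,
    h.map_minorOne, map_inv₀, bar_pow, inv_inv]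

/-- z and T commute, so S_n is unchanged by reversal of products. Each z contributes q⁴ and each T
contributes q⁸, that is q⁴ per unit of n. -/
theorem map_minorCheb (h : IsBarLadder u σ) (m : ℕ) :
    σ (minorCheb q u m) = q ^ (4 * (m : ℤ) - 4) • minorCheb q u m := by
  induction m using Nat.twoStepInduction with
  | zero => rw [minorCheb, cheb, map_zero, smul_zero]
  | one =>
    rw [minorCheb, cheb, Nat.cast_one, mul_one, sub_self, zpow_zero, one_smul]
    have := h.map_pow (u 0) 0
    rwa [pow_zero, pow_zero] at this
  | more m ih ih' =>
    rw [minorCheb, cheb_succ (h.ladder.minorMid_minorProd q_ne_zero), map_sub, h.map_mul, h.map_mul,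
      ih, ih', h.map_minorMid, h.map_minorProd, ← cheb_succ (h.ladder.minorMid_minorProd q_ne_zero),
      cheb, smul_mul_smul_comm, smul_mul_smul_comm, smul_sub, ← zpow_natCast q, ← zpow_natCast q,
      ← zpow_add₀ q_ne_zero, ← zpow_add₀ q_ne_zero]
    congr 3 <;> (push_cast; ring)

/-- Applying σ to the defining form of the row gives its left form, which `leftRow_eq` converts
back. -/
theorem map_leftRow (h : IsBarLadder u σ) (m : ℕ) :
    σ (leftRow q u m) = q ^ (2 * (m : ℤ) + 6) • leftRow q u m := by
  have e : q ^ (2 * (m : ℤ) + 6) • leftRow q u m = q ^ (4 * (m : ℤ) + 6) •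
      (minorCheb q u (m + 1) * u 3
        - (q ^ 2)⁻¹ • (minorCheb q u m * (minorOne q u * u 2))) := by
    rw [h.ladder.leftRow_eq q_ne_zero, smul_smul, ← zpow_natCast q, ← zpow_add₀ q_ne_zero]
    congr 2
    push_cast
    ring
  rw [e, leftRow, map_sub, h.map_smul, h.map_mul, h.map_mul, h.map_mul, h.map_minorCheb,
    h.map_minorCheb, h.map_u_three, h.map_minorOne, h.map_u_two, bar_pow, smul_mul_smul_comm,
    smul_mul_smul_comm, smul_mul_smul_comm, ← h.ladder.minorOne_two q_ne_zero, smul_sub,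
    smul_comm _ (q ^ 2)⁻¹, ← zpow_natCast q 6, ← zpow_natCast q 4, ← zpow_add₀ q_ne_zero,
    ← zpow_add₀ q_ne_zero, ← zpow_add₀ q_ne_zero]
  congr 3
  · push_cast
    ring
  · congr 1
    push_cast
    ring

theorem map_rightRow (h : IsBarLadder u σ) (m : ℕ) :
    σ (rightRow q u m) = q ^ (2 * (m : ℤ)) • rightRow q u m := by
  have e : q ^ (2 * (m : ℤ)) • rightRow q u m = q ^ (4 * (m : ℤ)) •
      (u 0 * minorCheb q u (m + 1)
        - (q ^ 2)⁻¹ • (u 1 * minorZero q u * minorCheb q u m)) := by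
    rw [h.ladder.rightRow_eq q_ne_zero, smul_smul, ← zpow_natCast q, ← zpow_add₀ q_ne_zero]
    congr 2
    push_cast
    ring
  rw [e, rightRow, map_sub, h.map_smul, h.map_mul, h.map_mul, h.map_mul, h.map_minorCheb,
    h.map_minorCheb, h.map_u_zero, h.map_minorZero, h.map_u_one, bar_pow, mul_smul_comm,
    smul_mul_smul_comm, smul_mul_smul_comm, ← h.ladder.one_minorZero q_ne_zero, smul_sub,
    smul_comm _ (q ^ 2)⁻¹, ← zpow_natCast q 2, ← zpow_add₀ q_ne_zero,
    ← zpow_add₀ q_ne_zero]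
  congr 3
  · push_cast
    ring
  · congr 1
    push_cast
    ring

/-- Δ₁ is a σ-eigenvector and q-commutes with x, so the product is again an eigenvector; the
exponents agree with N at the shifted index. -/
theorem isCanonical_minorOne_mul (h : IsBarLadder u σ) {a : Idx} {x : A}
    (hx : IsCanonical u σ a x) :
    IsCanonical u σ (a + (1, 0, 1, 0)) (q ^ minorOneExp a • (minorOne q u * x)) := by
  refine ⟨hx.1.minorOne_mul h.ladder, ?_⟩
  rw [h.map_zpow_smul, h.map_mul, h.map_minorOne, hx.2, hx.1.minorOne_mul_comm h.ladder,
    smul_mul_smul_comm, smul_smul, smul_smul, smul_smul, ← zpow_natCast q 6,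
    ← zpow_add₀ q_ne_zero, ← zpow_add₀ q_ne_zero, ← zpow_add₀ q_ne_zero, ← zpow_add₀ q_ne_zero]
  obtain ⟨a₃, a₂, a₁, a₀⟩ := a
  congr 2
  simp only [minorOneExp, normN, Prod.mk_add_mk]
  push_cast
  ring

theorem isCanonical_mul_minorZero (h : IsBarLadder u σ) {a : Idx} {x : A}
    (hx : IsCanonical u σ a x) :
    IsCanonical u σ (a + (0, 1, 0, 1)) (q ^ minorZeroExp a • (x * minorZero q u)) := by
  refine ⟨hx.1.mul_minorZero h.ladder, ?_⟩
  rw [h.map_zpow_smul, h.map_mul, h.map_minorZero, hx.2, hx.1.mul_minorZero_comm h.ladder,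
    smul_mul_smul_comm, smul_smul, smul_smul, smul_smul, ← zpow_natCast q 2,
    ← zpow_add₀ q_ne_zero, ← zpow_add₀ q_ne_zero, ← zpow_add₀ q_ne_zero, ← zpow_add₀ q_ne_zero]
  obtain ⟨a₃, a₂, a₁, a₀⟩ := a
  congr 2
  simp only [minorZeroExp, normN, Prod.mk_add_mk]
  push_cast
  ring

end IsBarLadder

end Lattice

end KroneckerQuantum

end

section
namespace KroneckerQuantum

section Lattice

variable {A : Type*} [Ring A] [Algebra Kq A] {u : Fin 4 → A} {σ : A →+ A} {B : Idx → A}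

variable (B) in
/-- The element `B[m, 0, 1, m - 1]`. -/
def leftTail : ℕ → A
  | 0 => 0
  | m + 1 => B (m + 1, 0, 1, m)

variable (B) in
/-- The element `B[m - 1, 1, 0, m]`. -/
def rightTail : ℕ → A
  | 0 => 0
  | m + 1 => B (m, 1, 0, m + 1)

/-! ### Multiplication by generators and unitriangularity -/

/-- The first coordinate does not grow along the order, so the exponent n − b₃ is nonnegative, with
value 0 at a. -/
theorem IsUnitriangular.smul_three_mul {a : Idx} {x : A} (hx : IsUnitriangular u a x) {n : ℤ}
    (hn : n = a.1) : IsUnitriangular u (a + (1, 0, 0, 0)) (q ^ n • (u 3 * x)) := by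
  refine hx.map (φ := q ^ n • LinearMap.mulLeft Kq (u 3)) (f := fun b => n - b.1)
    (fun b => ?_) (fun b hb => ?_) (by simp [hn])
  · change q ^ n • (u 3 * pbw u b) = _
    rw [three_mul_pbw, smul_smul, ← zpow_add₀ q_ne_zero, sub_eq_add_neg]
  · obtain ⟨a₃, a₂, a₁, a₀⟩ := a
    obtain ⟨b₃, b₂, b₁, b₀⟩ := b
    obtain ⟨r, s, h₃, h₂, h₁, h₀⟩ := hb
    simp only at hn ⊢
    omega

theorem IsUnitriangular.smul_mul_zero {a : Idx} {x : A} (hx : IsUnitriangular u a x) {n : ℤ}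
    (hn : n = a.2.2.2) : IsUnitriangular u (a + (0, 0, 0, 1)) (q ^ n • (x * u 0)) := by
  refine hx.map (φ := q ^ n • LinearMap.mulRight Kq (u 0)) (f := fun b => n - b.2.2.2)
    (fun b => ?_) (fun b hb => ?_) (by simp [hn])
  · change q ^ n • (pbw u b * u 0) = _
    rw [pbw_mul_zero, smul_smul, ← zpow_add₀ q_ne_zero, sub_eq_add_neg]
  · obtain ⟨a₃, a₂, a₁, a₀⟩ := a
    obtain ⟨b₃, b₂, b₁, b₀⟩ := b
    obtain ⟨r, s, h₃, h₂, h₁, h₀⟩ := hb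
    simp only at hn ⊢
    omega

/-- The quantity 2b₃ + b₂ does not grow along the order, so the bound at a gives a positive power of
q for every b. -/
theorem IsUnitriangular.smul_two_mul_mem (hu : IsLadder q u) {a a' : Idx} {x : A}
    (hx : IsUnitriangular u a x) {n : ℤ} (hn : 2 * (a.1 : ℤ) + a.2.1 + 1 ≤ n)
    (ha : a + (0, 1, 0, 0) ∈ above a') : q ^ n • (u 2 * x) ∈ lattice u qZq (above a') := by
  refine hx.map_mem (φ := q ^ n • LinearMap.mulLeft Kq (u 2))
    (f := fun b => n + (-2 * (b.1 : ℤ) - b.2.1)) (fun b => ?_) (fun b hb => ?_) ha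
  · change q ^ n • (u 2 * pbw u b) = _
    rw [two_mul_pbw hu, smul_smul, ← zpow_add₀ q_ne_zero]
  · obtain ⟨a₃, a₂, a₁, a₀⟩ := a
    obtain ⟨b₃, b₂, b₁, b₀⟩ := b
    obtain ⟨r, s, h₃, h₂, h₁, h₀⟩ := hb
    simp only at hn ⊢
    omega

theorem IsUnitriangular.smul_mul_one_mem (hu : IsLadder q u) {a a' : Idx} {x : A}
    (hx : IsUnitriangular u a x) {n : ℤ} (hn : 2 * (a.2.2.2 : ℤ) + a.2.2.1 + 1 ≤ n)
    (ha : a + (0, 0, 1, 0) ∈ above a') : q ^ n • (x * u 1) ∈ lattice u qZq (above a') := by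
  refine hx.map_mem (φ := q ^ n • LinearMap.mulRight Kq (u 1))
    (f := fun b => n + (-2 * (b.2.2.2 : ℤ) - b.2.2.1)) (fun b => ?_) (fun b hb => ?_) ha
  · change q ^ n • (pbw u b * u 1) = _
    rw [pbw_mul_one hu, smul_smul, ← zpow_add₀ q_ne_zero]
  · obtain ⟨a₃, a₂, a₁, a₀⟩ := a
    obtain ⟨b₃, b₂, b₁, b₀⟩ := b
    obtain ⟨r, s, h₃, h₂, h₁, h₀⟩ := hb
    simp only at hn ⊢
    omega

namespace IsBarLadder

theorem isCanonical_zero (h : IsBarLadder u σ) : IsCanonical u σ 0 1 := by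
  refine ⟨?_, ?_⟩
  · rw [← pbw_zero (u := u)]
    exact isUnitriangular_pbw 0
  · have := h.map_pow (u 0) 0
    rw [pow_zero, pow_zero] at this
    rw [this]
    exact (one_smul Kq (1 : A)).symm

theorem isCanonical_two (h : IsBarLadder u σ) : IsCanonical u σ (0, 1, 0, 0) (u 2) := by
  refine ⟨?_, ?_⟩
  · have : pbw u (0, 1, 0, 0) = u 2 := by simp [pbw, pbwExp, mono]
    rw [← this]
    exact isUnitriangular_pbw _
  · rw [h.map_u_two, ← zpow_natCast q]
    rfl

theorem isCanonical_one (h : IsBarLadder u σ) : IsCanonical u σ (0, 0, 1, 0) (u 1) := by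
  refine ⟨?_, ?_⟩
  · have : pbw u (0, 0, 1, 0) = u 1 := by simp [pbw, pbwExp, mono]
    rw [← this]
    exact isUnitriangular_pbw _
  · rw [h.map_u_one, ← zpow_natCast q]
    rfl

/-! ### Closed formulas -/

section Closed

variable (u B) in
/-- The closed formula for `B[m, 0, 0, m]`. -/
def DiagFormula (m : ℕ) : Prop :=
  B (m, 0, 0, m) = q ^ (2 * (m : ℤ) * (m - 1)) • minorCheb q u (m + 1)

variable (u B) in
/-- The closed formula for `B[m + 1, 0, 0, m]`. -/
def LeftFormula (m : ℕ) : Prop :=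
  B (m + 1, 0, 0, m) = q ^ ((m : ℤ) * (2 * m - 1)) • leftRow q u m

variable (u B) in
/-- The closed formula for `B[m, 0, 0, m + 1]`. -/
def RightFormula (m : ℕ) : Prop :=
  B (m, 0, 0, m + 1) = q ^ ((m : ℤ) * (2 * m - 1)) • rightRow q u m

theorem minorOne_mul_canonical (h : IsBarLadder u σ) (hB : ∀ a, IsCanonical u σ a (B a)) (a : Idx) :
    B (a + (1, 0, 1, 0)) = q ^ minorOneExp a • (minorOne q u * B a) :=
  h.unique (hB _) (h.isCanonical_minorOne_mul (hB a))

theorem canonical_mul_minorZero (h : IsBarLadder u σ) (hB : ∀ a, IsCanonical u σ a (B a))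
    (a : Idx) : B (a + (0, 1, 0, 1)) = q ^ minorZeroExp a • (B a * minorZero q u) :=
  h.unique (hB _) (h.isCanonical_mul_minorZero (hB a))

theorem leftTail_eq (h : IsBarLadder u σ) (hB : ∀ a, IsCanonical u σ a (B a)) {m : ℕ}
    (hD : ∀ k < m, DiagFormula u B k) :
    leftTail B m = q ^ ((2 * (m : ℤ) - 1) * (m - 1)) • (minorOne q u * minorCheb q u m) := by
  cases m with
  | zero => rw [leftTail, minorCheb, cheb, mul_zero, smul_zero]
  | succ m =>
    have e : B (m + 1, 0, 1, m) = _ := h.minorOne_mul_canonical hB (m, 0, 0, m)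
    rw [leftTail, e, hD m m.lt_succ_self, mul_smul_comm, smul_smul, ← zpow_add₀ q_ne_zero]
    congr 2
    simp only [minorOneExp]
    push_cast
    ring

theorem rightTail_eq (h : IsBarLadder u σ) (hB : ∀ a, IsCanonical u σ a (B a)) {m : ℕ}
    (hD : ∀ k < m, DiagFormula u B k) :
    rightTail B m = q ^ ((2 * (m : ℤ) - 1) * (m - 1)) • (minorCheb q u m * minorZero q u) := by
  cases m with
  | zero => rw [rightTail, minorCheb, cheb, zero_mul, smul_zero]
  | succ m =>
    have e : B (m, 1, 0, m + 1) = _ := h.canonical_mul_minorZero hB (m, 0, 0, m)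
    rw [rightTail, e, hD m m.lt_succ_self, smul_mul_assoc, smul_smul, ← zpow_add₀ q_ne_zero]
    congr 2
    simp only [minorZeroExp]
    push_cast
    ring

/-- The right-hand side is unitriangular by the product rules and, by its closed form as a row, has
the required σ-eigenvalue. Uniqueness identifies it with the canonical element. -/
theorem left_expansion (h : IsBarLadder u σ) (hB : ∀ a, IsCanonical u σ a (B a)) {m : ℕ}
    (hD : ∀ k ≤ m, DiagFormula u B k) :
    B (m + 1, 0, 0, m) = q ^ (m : ℤ) • (u 3 * B (m, 0, 0, m))
      - q ^ (2 * (m : ℤ) + 1) • (u 2 * leftTail B m) ∧ LeftFormula u B m := by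
  have e : q ^ (m : ℤ) • (u 3 * B (m, 0, 0, m)) - q ^ (2 * (m : ℤ) + 1) • (u 2 * leftTail B m)
      = q ^ ((m : ℤ) * (2 * m - 1)) • leftRow q u m := by
    rw [h.leftTail_eq hB fun k hk => hD k hk.le, hD m le_rfl, leftRow, mul_smul_comm,
      mul_smul_comm, smul_smul, smul_smul, ← mul_assoc, h.ladder.minorOne_two q_ne_zero, smul_sub,
      smul_smul, ← q_zpow_two, ← zpow_add₀ q_ne_zero, ← zpow_add₀ q_ne_zero, ← zpow_add₀ q_ne_zero]
    congr 3 <;> ring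
  have hc : IsCanonical u σ (m + 1, 0, 0, m) (q ^ (m : ℤ) • (u 3 * B (m, 0, 0, m))
      - q ^ (2 * (m : ℤ) + 1) • (u 2 * leftTail B m)) := by
    refine ⟨((hB (m, 0, 0, m)).1.smul_three_mul rfl).sub ?_, ?_⟩
    · cases m with
      | zero =>
        rw [leftTail, mul_zero, smul_zero]
        exact zero_mem _
      | succ m =>
        -- The difference (−1, 1, 1, −1) of the indices is the sum of the two generators of the
        -- order.
        exact (hB (m + 1, 0, 1, m)).1.smul_two_mul_mem h.ladder (by push_cast; omega)
          ⟨⟨1, 1, by simp⟩, by simp⟩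
    · rw [e, h.map_zpow_smul, h.map_leftRow, smul_smul, smul_smul, ← zpow_add₀ q_ne_zero,
        ← zpow_add₀ q_ne_zero]
      congr 2
      simp only [normN]
      push_cast
      ring
  have := h.unique (hB _) hc
  exact ⟨this, this.trans e⟩

theorem right_expansion (h : IsBarLadder u σ) (hB : ∀ a, IsCanonical u σ a (B a)) {m : ℕ}
    (hD : ∀ k ≤ m, DiagFormula u B k) :
    B (m, 0, 0, m + 1) = q ^ (m : ℤ) • (B (m, 0, 0, m) * u 0)
      - q ^ (2 * (m : ℤ) + 1) • (rightTail B m * u 1) ∧ RightFormula u B m := by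
  have e : q ^ (m : ℤ) • (B (m, 0, 0, m) * u 0) - q ^ (2 * (m : ℤ) + 1) • (rightTail B m * u 1)
      = q ^ ((m : ℤ) * (2 * m - 1)) • rightRow q u m := by
    rw [h.rightTail_eq hB fun k hk => hD k hk.le, hD m le_rfl, rightRow, smul_mul_assoc,
      smul_mul_assoc, smul_smul, smul_smul, mul_assoc (minorCheb q u m), ← h.ladder.one_minorZero q_ne_zero,
      smul_sub, smul_smul, ← q_zpow_two, ← zpow_add₀ q_ne_zero, ← zpow_add₀ q_ne_zero, ← zpow_add₀ q_ne_zero]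
    congr 3 <;> ring
  have hc : IsCanonical u σ (m, 0, 0, m + 1) (q ^ (m : ℤ) • (B (m, 0, 0, m) * u 0)
      - q ^ (2 * (m : ℤ) + 1) • (rightTail B m * u 1)) := by
    refine ⟨((hB (m, 0, 0, m)).1.smul_mul_zero rfl).sub ?_, ?_⟩
    · cases m with
      | zero =>
        rw [rightTail, zero_mul, smul_zero]
        exact zero_mem _
      | succ m =>
        exact (hB (m, 1, 0, m + 1)).1.smul_mul_one_mem h.ladder (by push_cast; omega)
          ⟨⟨1, 1, by simp⟩, by simp⟩
    · rw [e, h.map_zpow_smul, h.map_rightRow, smul_smul, smul_smul, ← zpow_add₀ q_ne_zero,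
        ← zpow_add₀ q_ne_zero]
      congr 2
      simp only [normN]
      push_cast
      ring
  have := h.unique (hB _) hc
  exact ⟨this, this.trans e⟩

/-- The element B[m,1,0,m] is a row times Δ₀, so `leftRow_last` applies. -/
theorem diag_eq_right (h : IsBarLadder u σ) (hB : ∀ a, IsCanonical u σ a (B a)) {m : ℕ}
    (hL : ∀ k ≤ m, LeftFormula u B k) :
    q ^ (m : ℤ) • (B (m + 1, 0, 0, m) * u 0) - q ^ (2 * (m : ℤ) + 2) • (B (m, 1, 0, m) * u 1)
      = q ^ (2 * (m + 1 : ℤ) * m) • minorCheb q u (m + 2) := by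
  -- For m = 0 the index (0, 1, 0, 0) is not of the form a + (0, 1, 0, 1), and its element is u₂
  -- itself.
  cases m with
  | zero =>
    rw [h.unique (hB (0, 1, 0, 0)) h.isCanonical_two, hL 0 le_rfl, leftRow]
    simp only [minorCheb, cheb, mul_one, mul_zero, smul_zero, sub_zero, minorMid, Nat.cast_zero,
      zpow_zero, one_smul, zero_mul, zero_add, q_zpow_two]
  | succ m =>
    have e : B (m + 1, 1, 0, m + 1) = _ := h.canonical_mul_minorZero hB (m + 1, 0, 0, m)
    have e' : q ^ (2 * ((m + 1 : ℕ) + 1 : ℤ) * (m + 1 : ℕ)) • minorCheb q u (m + 1 + 2)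
        = q ^ (2 * (m + 1 : ℤ) * (m + 1)) • q ^ (2 * (m + 1)) • minorCheb q u (m + 3) := by
      rw [smul_smul, ← zpow_natCast q (2 * (m + 1)), ← zpow_add₀ q_ne_zero]
      congr 2
      push_cast
      ring
    rw [e, e', ← h.ladder.leftRow_last q_ne_zero, hL _ le_rfl, hL m m.le_succ]
    simp only [smul_mul_assoc, smul_smul, mul_assoc, smul_sub]
    rw [← q_zpow_two, ← zpow_add₀ q_ne_zero, ← zpow_add₀ q_ne_zero, ← zpow_add₀ q_ne_zero,
      ← zpow_add₀ q_ne_zero]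
    simp only [minorZeroExp]
    congr 3 <;> (push_cast; ring)

theorem diag_eq_left (h : IsBarLadder u σ) (hB : ∀ a, IsCanonical u σ a (B a)) {m : ℕ}
    (hR : ∀ k ≤ m, RightFormula u B k) :
    q ^ (m : ℤ) • (u 3 * B (m, 0, 0, m + 1)) - q ^ (2 * (m : ℤ) + 2) • (u 2 * B (m, 0, 1, m))
      = q ^ (2 * (m + 1 : ℤ) * m) • minorCheb q u (m + 2) := by
  cases m with
  | zero =>
    rw [h.unique (hB (0, 0, 1, 0)) h.isCanonical_one, hR 0 le_rfl, rightRow]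
    simp only [minorCheb, cheb, mul_one, mul_zero, smul_zero, sub_zero, minorMid, Nat.cast_zero,
      zpow_zero, one_smul, zero_mul, zero_add, q_zpow_two, one_mul]
  | succ m =>
    have e : B (m + 1, 0, 1, m + 1) = _ := h.minorOne_mul_canonical hB (m, 0, 0, m + 1)
    have e' : q ^ (2 * ((m + 1 : ℕ) + 1 : ℤ) * (m + 1 : ℕ)) • minorCheb q u (m + 1 + 2)
        = q ^ (2 * (m + 1 : ℤ) * (m + 1)) • q ^ (2 * (m + 1)) • minorCheb q u (m + 3) := by
      rw [smul_smul, ← zpow_natCast q (2 * (m + 1)), ← zpow_add₀ q_ne_zero]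
      congr 2
      push_cast
      ring
    rw [e, e', ← h.ladder.rightRow_last q_ne_zero, hR _ le_rfl, hR m m.le_succ]
    simp only [mul_smul_comm, smul_smul, mul_assoc, smul_sub]
    rw [← q_zpow_two, ← zpow_add₀ q_ne_zero, ← zpow_add₀ q_ne_zero, ← zpow_add₀ q_ne_zero,
      ← zpow_add₀ q_ne_zero]
    simp only [minorOneExp]
    congr 3 <;> (push_cast; ring)

theorem diag_expansion (h : IsBarLadder u σ) (hB : ∀ a, IsCanonical u σ a (B a)) {m : ℕ}
    (hL : ∀ k ≤ m, LeftFormula u B k) :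
    B (m + 1, 0, 0, m + 1) = q ^ (m : ℤ) • (B (m + 1, 0, 0, m) * u 0)
      - q ^ (2 * (m : ℤ) + 2) • (B (m, 1, 0, m) * u 1) ∧ DiagFormula u B (m + 1) := by
  have e := h.diag_eq_right hB hL
  have hc : IsCanonical u σ (m + 1, 0, 0, m + 1) (q ^ (m : ℤ) • (B (m + 1, 0, 0, m) * u 0)
      - q ^ (2 * (m : ℤ) + 2) • (B (m, 1, 0, m) * u 1)) := by
    refine ⟨((hB (m + 1, 0, 0, m)).1.smul_mul_zero rfl).sub ?_, ?_⟩
    · exact (hB (m, 1, 0, m)).1.smul_mul_one_mem h.ladder (by push_cast; omega)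
        ⟨⟨1, 1, by simp⟩, by simp⟩
    · rw [e, h.map_zpow_smul, h.map_minorCheb, smul_smul, smul_smul, ← zpow_add₀ q_ne_zero,
        ← zpow_add₀ q_ne_zero]
      congr 2
      simp only [normN]
      push_cast
      ring
  have := h.unique (hB _) hc
  refine ⟨this, this.trans (e.trans ?_)⟩
  push_cast
  rw [add_sub_cancel_right]

/-- The row formula at k uses the diagonal formulas up to k, and the diagonal formula at m + 1 uses
the row formulas up to m. -/
theorem diagFormula (h : IsBarLadder u σ) (hB : ∀ a, IsCanonical u σ a (B a)) (m : ℕ) :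
    DiagFormula u B m := by
  induction m using Nat.strong_induction_on with
  | _ m ih =>
    cases m with
    | zero =>
      rw [DiagFormula, Nat.cast_zero, mul_zero, zero_mul, zpow_zero, one_smul]
      exact h.unique (hB 0) h.isCanonical_zero
    | succ m =>
      exact (h.diag_expansion hB fun k hk =>
        (h.left_expansion hB fun j hj => ih j (by omega)).2).2

theorem leftFormula (h : IsBarLadder u σ) (hB : ∀ a, IsCanonical u σ a (B a)) (m : ℕ) :
    LeftFormula u B m := (h.left_expansion hB fun k _ => h.diagFormula hB k).2

theorem rightFormula (h : IsBarLadder u σ) (hB : ∀ a, IsCanonical u σ a (B a)) (m : ℕ) :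
    RightFormula u B m := (h.right_expansion hB fun k _ => h.diagFormula hB k).2

end Closed

/-! ### Recursion formulas -/

/-- The image of a recursion formula under the involution. -/
theorem map_expansion (h : IsBarLadder u σ) {x y z v w : A} {a b c l m r s r' s' : ℤ}
    (hx : σ x = q ^ (-a) • x) (hy : σ y = q ^ (-b) • y) (hz : σ z = q ^ (-c) • z)
    (hv : σ v = q ^ l • v) (hw : σ w = q ^ m • w)
    (hr : r' = a - b + l - r) (hs : s' = a - c + m - s) :
    (x = q ^ r • (v * y) - q ^ s • (w * z) → x = q ^ r' • (y * v) - q ^ s' • (z * w)) ∧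
    (x = q ^ r • (y * v) - q ^ s • (z * w) → x = q ^ r' • (v * y) - q ^ s' • (w * z)) := by
  have e1 : x = q ^ a • σ x := by
    rw [hx, smul_smul, ← zpow_add₀ q_ne_zero, add_neg_cancel, zpow_zero, one_smul]
  constructor <;> intro e <;> rw [e1, e] <;>
    rw [map_sub, h.map_zpow_smul, h.map_zpow_smul, h.map_mul, h.map_mul, hy, hz, hv, hw,
      smul_mul_smul_comm, smul_mul_smul_comm, smul_sub, smul_smul, smul_smul, smul_smul, smul_smul,
      ← zpow_add₀ q_ne_zero, ← zpow_add₀ q_ne_zero, ← zpow_add₀ q_ne_zero,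
      ← zpow_add₀ q_ne_zero, ← zpow_add₀ q_ne_zero, ← zpow_add₀ q_ne_zero, hr, hs] <;>
    congr 3 <;> ring

end IsBarLadder

end Lattice

end KroneckerQuantum

end

/-! ### The recursions, and the specialization to U_q⁺(w) -/

section
namespace KroneckerQuantum

section Lattice

variable {A : Type*} [Ring A] [Algebra Kq A] {u : Fin 4 → A} {σ : A →+ A} {B : Idx → A}

namespace IsBarLadder

/-- The exponent is −N(m, 0, 1, m − 1), written as a polynomial so that m = 0, where the element
vanishes, is covered too. -/
theorem map_leftTail (hB : ∀ a, IsCanonical u σ a (B a)) (m : ℕ) :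
    σ (leftTail B m) = q ^ (-(4 * (m : ℤ) ^ 2 - 8 * m - 2)) • leftTail B m := by
  cases m with
  | zero => rw [leftTail, map_zero, smul_zero]
  | succ m =>
    rw [leftTail, (hB _).2]
    congr 2
    simp only [normN]
    push_cast
    ring

theorem map_rightTail (hB : ∀ a, IsCanonical u σ a (B a)) (m : ℕ) :
    σ (rightTail B m) = q ^ (-(4 * (m : ℤ) ^ 2 - 8 * m + 2)) • rightTail B m := by
  cases m with
  | zero => rw [rightTail, map_zero, smul_zero]
  | succ m =>
    rw [rightTail, (hB _).2]
    congr 2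
    simp only [normN]
    push_cast
    ring

theorem left_recursion (h : IsBarLadder u σ) (hB : ∀ a, IsCanonical u σ a (B a)) {m : ℕ} {n : ℤ}
    (hn : n = m + 1) :
    B (m + 1, 0, 0, m) = q ^ (n - 1) • (u 3 * B (m, 0, 0, m))
      - q ^ (2 * n - 1) • (u 2 * leftTail B m) ∧
    B (m + 1, 0, 0, m) = q ^ (3 * n - 3) • (B (m, 0, 0, m) * u 3)
      - q ^ (2 * n - 3) • (leftTail B m * u 2) := by
  have e : B (m + 1, 0, 0, m) = q ^ (n - 1) • (u 3 * B (m, 0, 0, m))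
      - q ^ (2 * n - 1) • (u 2 * leftTail B m) := by
    rw [(h.left_expansion hB fun k _ => h.diagFormula hB k).1, hn]
    congr 3 <;> ring
  refine ⟨e, (h.map_expansion (hB _).2 (hB _).2 (map_leftTail hB m) (l := 6) (m := 4)
    h.map_u_three h.map_u_two ?_ ?_).1 e⟩ <;> simp only [normN, hn] <;> push_cast <;> ring

theorem right_recursion (h : IsBarLadder u σ) (hB : ∀ a, IsCanonical u σ a (B a)) {m : ℕ} {n : ℤ}
    (hn : n = m + 1) :
    B (m, 0, 0, m + 1) = q ^ (n - 1) • (B (m, 0, 0, m) * u 0)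
      - q ^ (2 * n - 1) • (rightTail B m * u 1) ∧
    B (m, 0, 0, m + 1) = q ^ (3 * n - 3) • (u 0 * B (m, 0, 0, m))
      - q ^ (2 * n - 3) • (u 1 * rightTail B m) := by
  have e : B (m, 0, 0, m + 1) = q ^ (n - 1) • (B (m, 0, 0, m) * u 0)
      - q ^ (2 * n - 1) • (rightTail B m * u 1) := by
    rw [(h.right_expansion hB fun k _ => h.diagFormula hB k).1, hn]
    congr 3 <;> ring
  refine ⟨e, (h.map_expansion (hB _).2 (hB _).2 (map_rightTail hB m) (l := 0) (m := 2)
    (by rw [h.map_u_zero, zpow_zero, one_smul]) h.map_u_one ?_ ?_).2 e⟩ <;>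
    simp only [normN, hn] <;> push_cast <;> ring

theorem diag_recursion_right (h : IsBarLadder u σ) (hB : ∀ a, IsCanonical u σ a (B a)) {m : ℕ}
    {n : ℤ} (hn : n = m + 1) :
    B (m + 1, 0, 0, m + 1) = q ^ (n - 1) • (B (m + 1, 0, 0, m) * u 0)
      - q ^ (2 * n) • (B (m, 1, 0, m) * u 1) ∧
    B (m + 1, 0, 0, m + 1) = q ^ (3 * n - 1) • (u 0 * B (m + 1, 0, 0, m))
      - q ^ (2 * n - 2) • (u 1 * B (m, 1, 0, m)) := by
  have e : B (m + 1, 0, 0, m + 1) = q ^ (n - 1) • (B (m + 1, 0, 0, m) * u 0)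
      - q ^ (2 * n) • (B (m, 1, 0, m) * u 1) := by
    rw [(h.diag_expansion hB fun k _ => h.leftFormula hB k).1, hn]
    congr 3 <;> ring
  refine ⟨e, (h.map_expansion (hB _).2 (hB _).2 (hB _).2 (l := 0) (m := 2)
    (by rw [h.map_u_zero, zpow_zero, one_smul]) h.map_u_one ?_ ?_).2 e⟩ <;>
    simp only [normN, hn] <;> push_cast <;> ring

/-- This right-hand side has the same closed form in S_{m+2} as the one in `diag_expansion`, so no
separate canonicity argument is needed. -/
theorem diag_recursion_left (h : IsBarLadder u σ) (hB : ∀ a, IsCanonical u σ a (B a)) {m : ℕ}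
    {n : ℤ} (hn : n = m + 1) :
    B (m + 1, 0, 0, m + 1) = q ^ (n - 1) • (u 3 * B (m, 0, 0, m + 1))
      - q ^ (2 * n) • (u 2 * B (m, 0, 1, m)) ∧
    B (m + 1, 0, 0, m + 1) = q ^ (3 * n - 1) • (B (m, 0, 0, m + 1) * u 3)
      - q ^ (2 * n - 2) • (B (m, 0, 1, m) * u 2) := by
  have e : B (m + 1, 0, 0, m + 1) = q ^ (n - 1) • (u 3 * B (m, 0, 0, m + 1))
      - q ^ (2 * n) • (u 2 * B (m, 0, 1, m)) := by
    have e1 := h.diag_eq_left hB fun k (_ : k ≤ m) => h.rightFormula hB k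
    rw [← h.diag_eq_right hB fun k _ => h.leftFormula hB k,
      ← (h.diag_expansion hB fun k _ => h.leftFormula hB k).1] at e1
    rw [← e1, hn]
    congr 3 <;> ring
  refine ⟨e, (h.map_expansion (hB _).2 (hB _).2 (hB _).2 (l := 6) (m := 4)
    h.map_u_three h.map_u_two ?_ ?_).1 e⟩ <;> simp only [normN, hn] <;> push_cast <;> ring

end IsBarLadder

end Lattice

/-! ### The algebra `U_q⁺(w)` -/

/-- The involution of `U_q⁺(w)`, as an additive map. -/
def sigmaHom : Uplus →+ Uplus := AddMonoidHom.mk' sigmaPlus sigmaPlus_add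

theorem isBarLadder_u : IsBarLadder u sigmaHom where
  ladder := isLadder_u
  linearIndependent := linearIndependent_mono
  induction P hc hu hadd hmul := Uplus_induction hc hu hadd hmul
  map_mul := sigmaPlus_mul
  map_smul := sigmaPlus_smul
  map_u := sigmaPlus_u
  involutive := sigmaPlus_sigmaPlus

theorem lowerLattice_eq (a : Idx) : lowerLattice a = lattice u qZq (above a) := by
  refine congrArg AddSubgroup.closure (Set.ext fun x => ⟨?_, ?_⟩)
  · rintro ⟨b, f, hb, hne, rfl⟩
    exact ⟨b, _, ⟨hb, hne⟩, mem_qZq.mpr ⟨f, rfl⟩, rfl⟩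
  · rintro ⟨b, c, hb, hc, rfl⟩
    obtain ⟨f, rfl⟩ := mem_qZq.mp hc
    exact ⟨b, f, hb.1, hb.2, rfl⟩

theorem isDualCanonicalBasis_of_isCanonical {B : Idx → Uplus}
    (hB : ∀ a, IsCanonical u sigmaHom a (B a)) : IsDualCanonicalBasis B where
  linearIndependent := isBarLadder_u.linearIndependent_unitriangular fun a => (hB a).1
  span_eq_top := isBarLadder_u.span_unitriangular fun a => (hB a).1
  unitriangular a := lowerLattice_eq a ▸ (hB a).1
  sigma_invariant := ⟨sigmaEquiv, isSigma_sigmaEquiv, fun a => congrArg MulOpposite.op (hB a).2⟩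

theorem IsDualCanonicalBasis.isCanonical {B : Idx → Uplus} (hB : IsDualCanonicalBasis B) (a : Idx) :
    IsCanonical u sigmaHom a (B a) := by
  obtain ⟨σ, hσ, h⟩ := hB.sigma_invariant
  have h1 := hB.unitriangular a
  rw [lowerLattice_eq] at h1
  refine ⟨h1, MulOpposite.op_injective ?_⟩
  exact (hσ.eq_sigmaPlus (B a)).symm.trans (h a)

theorem bracket_natCast (B : Idx → Uplus) (a₃ a₂ a₁ a₀ : ℕ) :
    bracket B a₃ a₂ a₁ a₀ = B (a₃, a₂, a₁, a₀) := by simp [bracket]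

theorem bracket_leftTail (B : Idx → Uplus) (m : ℕ) : bracket B m 0 1 (m - 1) = leftTail B m := by
  cases m with
  | zero => simp [bracket, leftTail]
  | succ m => simpa [leftTail, rightTail] using bracket_natCast B (m + 1) 0 1 m

theorem bracket_rightTail (B : Idx → Uplus) (m : ℕ) :
    bracket B (m - 1) 1 0 m = rightTail B m := by
  cases m with
  | zero => simp [bracket, rightTail]
  | succ m => simpa [leftTail, rightTail] using bracket_natCast B m 1 0 (m + 1)

end KroneckerQuantum

end

end

open KroneckerQuantum in
theorem theorem4p3 :
    ∃ B : Idx → Uplus, IsDualCanonicalBasis B ∧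
      (∀ B' : Idx → Uplus, IsDualCanonicalBasis B' → B' = B) ∧
      ∀ n : ℤ, 1 ≤ n →
        (bracket B n 0 0 (n - 1)
            = q ^ (n - 1) • (u 3 * bracket B (n - 1) 0 0 (n - 1))
              - q ^ (2 * n - 1) • (u 2 * bracket B (n - 1) 0 1 (n - 2)) ∧
          bracket B n 0 0 (n - 1)
            = q ^ (3 * n - 3) • (bracket B (n - 1) 0 0 (n - 1) * u 3)
              - q ^ (2 * n - 3) • (bracket B (n - 1) 0 1 (n - 2) * u 2)) ∧
        (bracket B (n - 1) 0 0 n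
            = q ^ (n - 1) • (bracket B (n - 1) 0 0 (n - 1) * u 0)
              - q ^ (2 * n - 1) • (bracket B (n - 2) 1 0 (n - 1) * u 1) ∧
          bracket B (n - 1) 0 0 n
            = q ^ (3 * n - 3) • (u 0 * bracket B (n - 1) 0 0 (n - 1))
              - q ^ (2 * n - 3) • (u 1 * bracket B (n - 2) 1 0 (n - 1))) ∧
        (bracket B n 0 0 n
            = q ^ (n - 1) • (bracket B n 0 0 (n - 1) * u 0)
              - q ^ (2 * n) • (bracket B (n - 1) 1 0 (n - 1) * u 1) ∧
          bracket B n 0 0 n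
            = q ^ (3 * n - 1) • (u 0 * bracket B n 0 0 (n - 1))
              - q ^ (2 * n - 2) • (u 1 * bracket B (n - 1) 1 0 (n - 1)) ∧
          bracket B n 0 0 n
            = q ^ (n - 1) • (u 3 * bracket B (n - 1) 0 0 n)
              - q ^ (2 * n) • (u 2 * bracket B (n - 1) 0 1 (n - 1)) ∧
          bracket B n 0 0 n
            = q ^ (3 * n - 1) • (bracket B (n - 1) 0 0 n * u 3)
              - q ^ (2 * n - 2) • (bracket B (n - 1) 0 1 (n - 1) * u 2)) := by
  choose B hB using isBarLadder_u.exists_canonical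
  have hB : ∀ a, IsCanonical u sigmaHom a (B a) := hB
  refine ⟨B, isDualCanonicalBasis_of_isCanonical hB, fun B' hB' =>
    funext fun a => isBarLadder_u.unique (hB'.isCanonical a) (hB a), fun n hn => ?_⟩
  obtain ⟨m, hm⟩ : ∃ m : ℕ, n = m + 1 := ⟨(n - 1).toNat, by omega⟩
  have b1 : bracket B n 0 0 (n - 1) = B (m + 1, 0, 0, m) := by
    rw [hm, add_sub_cancel_right]
    exact_mod_cast bracket_natCast B (m + 1) 0 0 m
  have b2 : bracket B (n - 1) 0 0 n = B (m, 0, 0, m + 1) := by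
    rw [hm, add_sub_cancel_right]
    exact_mod_cast bracket_natCast B m 0 0 (m + 1)
  have b3 : bracket B n 0 0 n = B (m + 1, 0, 0, m + 1) := by
    rw [hm]
    exact_mod_cast bracket_natCast B (m + 1) 0 0 (m + 1)
  have b4 : bracket B (n - 1) 0 0 (n - 1) = B (m, 0, 0, m) := by
    rw [hm, add_sub_cancel_right]
    exact_mod_cast bracket_natCast B m 0 0 m
  have b5 : bracket B (n - 1) 1 0 (n - 1) = B (m, 1, 0, m) := by
    rw [hm, add_sub_cancel_right]
    exact_mod_cast bracket_natCast B m 1 0 m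
  have b6 : bracket B (n - 1) 0 1 (n - 1) = B (m, 0, 1, m) := by
    rw [hm, add_sub_cancel_right]
    exact_mod_cast bracket_natCast B m 0 1 m
  -- For n = 1 the index n − 2 is negative and both sides are zero.
  have b7 : bracket B (n - 1) 0 1 (n - 2) = leftTail B m := by
    rw [← bracket_leftTail, show n - 1 = m by omega, show n - 2 = (m : ℤ) - 1 by omega]
  have b8 : bracket B (n - 2) 1 0 (n - 1) = rightTail B m := by
    rw [← bracket_rightTail, show n - 1 = m by omega, show n - 2 = (m : ℤ) - 1 by omega]
  rw [b1, b2, b3, b4, b5, b6, b7, b8]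
  exact ⟨isBarLadder_u.left_recursion hB hm, isBarLadder_u.right_recursion hB hm,
    (isBarLadder_u.diag_recursion_right hB hm).1, (isBarLadder_u.diag_recursion_right hB hm).2,
    isBarLadder_u.diag_recursion_left hB hm⟩
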